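/- Let $d\ge 3$ and consider $d$ Hermitian $N\times N$ matrices $M_1,\dots,M_d$ with the formal matrix integral $$Z=\int\prod_{c=1}^d dM_c\,\exp\Bigl(-\tfrac N2\sum_c\operatorname{tr}M_c^2+\sum_{a\in\mathbb N^d,\,|a|\ge2}\frac{N^{-\frac{d-2}2|a|}}{|a|}\binom{|a|}{a_1,\dots,a_d}\prod_c\alpha_c^{a_c}\operatorname{tr}M_c^{a_c}\Bigr),\qquad |a|=\sum_c a_c,$$ where all terms except $-\frac N2\sum_c \operatorname{tr}M_c^2$ are expanded as a power series in $\alpha_1,\dots,\alpha_d$ and integrated term by term; write $\langle\cdot\rangle$ for the corresponding expectation (a power series in $\alpha_1,\dots,\alpha_d$). Then the large $N$ limits of the coefficients (in $\alpha$) of $\frac1N\langle\operatorname{tr}M_c^p\rangle$ and of $\langle\operatorname{tr}M_i^p\operatorname{tr}M_j^q\rangle-\langle\operatorname{tr}M_i^p\rangle\langle\operatorname{tr}M_j^q\rangle$ exist, and the limiting power series converge for $\alpha\in\mathbb C^d$ with $\sum_p|\alpha_p|^2<1$. Fix such an $\alpha$. The generating functions of these limits, with weights $x^{-p-1}$ and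 $x_1^{-p-1}x_2^{-q-1}$, converge near infinity and continue to holomorphic functions $W^0_{e_c}$ on $\mathbb C\setminus\Gamma_c$ (planar disc functions) and $W^0_{e_i+e_j}$ on $(\mathbb C\setminus\Gamma_i)\times(\mathbb C\setminus\Gamma_j)$ (planar cylinder functions, $i=j$ allowed), where $\Gamma_c=\bigl[-\tfrac2{\sqrt{1-\alpha_c^2}},\tfrac2{\sqrt{1-\alpha_c^2}}\bigr]$. Let $\sigma_c(x)=\sqrt{x^2-\frac4{1-\alpha_c^2}}$ be the branch on $\mathbb C\setminus\Gamma_c$ with $\sigma_c(x)\sim x$ at infinity. Then: 1. (Disc functions) $W^0_{e_c}$ is the planar resolvent of the GUE with weight $e^{-\frac N2(1-\alpha_c^2)\operatorname{tr}M^2}$, and $$W^0_{e_c}(x)=\frac{1-\alpha_c^2}2\Bigl(x-\sqrt{x^2-\tfrac4{1-\alpha_c^2}}\Bigr).$$ 2. (Monocoloured cylinder functions) Let $W^0_{2,i}$ be the planar cylinder function of the GUE with weight $e^{-\frac N2(1-\alpha_i^2)\operatorname{tr}M^2}$, i.e. the holomorphic function on $(\mathbb C\setminus\Gamma_i)^2$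 equal for $x_1\ne x_2$ to $$W^0_{2,i}(x_1,x_2)=\frac{x_1x_2-\sigma_i(x_1)\sigma_i(x_2)-\frac4{1-\alpha_i^2}}{2(x_1-x_2)^2\sigma_i(x_1)\sigma_i(x_2)}.$$ Then $$W^0_{2e_i}(x_1,x_2)=W^0_{2,i}(x_1,x_2)-\frac{\sum_{p\ne i}(\alpha_i\alpha_p)^2}{\sum_{p}\alpha_p^2-1}\,\frac{W^0_{e_i}(x_1)W^0_{e_i}(x_2)}{(1-\alpha_i^2)\sigma_i(x_1)\sigma_i(x_2)}.$$ 3. (Bicoloured cylinder functions) For $i\ne j$, $$W^0_{e_i+e_j}(x_1,x_2)=-\frac{\alpha_i\alpha_j}{\sum_p\alpha_p^2-1}\,\frac{W^0_{e_i}(x_1)W^0_{e_j}(x_2)}{\sigma_i(x_1)\sigma_j(x_2)}.$$ 4. (Joukowsky coordinates) Put $x^{(c)}(z)=\frac1{\sqrt{1-\alpha_c^2}}\bigl(z+\frac1z\bigr)$ for $|z|>1$ and $$\omega^0_{e_i+e_j}(z_1,z_2)=\Bigl(W^0_{e_i+e_j}(x_1,x_2)+\frac{\delta_{ij}}{(x_1-x_2)^2}\Bigr)dx_1\,dx_2,\qquad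 x_1=x^{(i)}(z_1),\ x_2=x^{(j)}(z_2).$$ Then $$\omega^0_{2e_i}=\frac{dz_1dz_2}{(z_1-z_2)^2}-\frac{\sum_{p\ne i}(\alpha_i\alpha_p)^2}{\sum_p\alpha_p^2-1}\frac{dz_1dz_2}{z_1^2z_2^2},\qquad \omega^0_{e_i+e_j}=-\frac{\alpha_i\alpha_j\sqrt{(1-\alpha_i^2)(1-\alpha_j^2)}}{\sum_p\alpha_p^2-1}\frac{dz_1dz_2}{z_1^2z_2^2}\quad(i\ne j).$$ Consequently the global bidifferential $\omega^0_2$, equal to $\omega^0_{e_i+e_j}$ when $z_1$ lies on the $i$-th and $z_2$ on the $j$-th of $d$ disjoint copies of the $z$-plane, continues to a meromorphic bidifferential on the disjoint union of $d$ copies of $(\mathbb C\cup\{\infty\})\setminus\{0\}$, whose only singularity is a double pole, with principal part $dz_1dz_2/(z_1-z_2)^2$, along the diagonal $z_1=z_2$ on the same copy. -/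

import Mathlib

open Filter Topology MeasureTheory

noncomputable section

namespace TensorMatrixModel

/-! ### Hermitian matrices and Gaussian expectations -/

/-- The `N × N` Hermitian matrix with real coordinates `ξ`: the diagonal entries are `ξ a a`, the
entries above the diagonal are `ξ a b + i ξ b a`. Lebesgue measure in the `N²` coordinates `ξ` is
the measure `dM` on Hermitian matrices. -/
def hermitian {N : ℕ} (ξ : Fin N → Fin N → ℝ) : Matrix (Fin N) (Fin N) ℂ :=
  Matrix.of fun a b =>
    if a = b then (ξ a a : ℂ)
    else if a < b then (ξ a b : ℂ) + Complex.I * (ξ b a : ℂ)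
    else (ξ b a : ℂ) - Complex.I * (ξ a b : ℂ)

/-- The weight `exp (- N s / 2 * ∑_c tr M_c²)`. -/
def gaussianWeight {d N : ℕ} (s : ℂ) (M : Fin d → Matrix (Fin N) (Fin N) ℂ) : ℂ :=
  Complex.exp (-((N : ℂ) * s / 2) * ∑ c, ((M c) ^ 2).trace)

/-- The expectation of `O (M_1, …, M_d)` for `d` independent Hermitian `N × N` matrices with weight
`exp (- N s / 2 * ∑_c tr M_c²)`. -/
def gaussianExpect {d : ℕ} (N : ℕ) (s : ℂ) (O : (Fin d → Matrix (Fin N) (Fin N) ℂ) → ℂ) : ℂ :=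
  (∫ ξ : Fin d → Fin N → Fin N → ℝ,
      O (fun c => hermitian (ξ c)) * gaussianWeight s (fun c => hermitian (ξ c))) /
    ∫ ξ : Fin d → Fin N → Fin N → ℝ, gaussianWeight s (fun c => hermitian (ξ c))

/-! ### The matrix model as a formal integral

The weight of the model is `exp (-S)` with
`S = N / 2 * ∑_c tr M_c² + N^(2-d) * ∑_a t_a ∏_c tr M_c^(a_c)`, where
`t_a = - (1/|a|) * multinomial a * ∏_c α_c^(a_c) * N^(d - 2 - (d-2)/2 * |a|)` for `|a| ≥ 2` (and
`t_a = 0` otherwise). Everything except the Gaussian part is expanded in powers of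
`α_1, …, α_d`, which are the variables of the power series below, and integrated term by term. -/

/-- The coefficient of `∏_c α_c^(a_c)` in the coupling `t_a`. -/
def coupling (d N : ℕ) (a : Fin d →₀ ℕ) : ℂ :=
  if 2 ≤ a.degree then
    -((1 / (a.degree : ℂ)) * (a.multinomial : ℂ) *
      (((N : ℝ) ^ ((d : ℝ) - 2 - ((d : ℝ) - 2) / 2 * (a.degree : ℝ)) : ℝ) : ℂ))
  else 0

/-- The interaction `- N^(2-d) * ∑_a t_a ∏_c tr M_c^(a_c)`, a power series in `α_1, …, α_d`. -/
def interaction {d N : ℕ} (M : Fin d → Matrix (Fin N) (Fin N) ℂ) : MvPowerSeries (Fin d) ℂ :=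
  fun a => -((((N : ℝ) ^ (2 - (d : ℝ)) : ℝ) : ℂ) * coupling d N a * ∏ c, ((M c) ^ (a c)).trace)

/-- The exponential `∑_k V^k / k!` of a power series `V` without constant term: only the powers
`k ≤ |a|` contribute to the coefficient of the monomial `a`. -/
def formalExp {d : ℕ} (V : MvPowerSeries (Fin d) ℂ) : MvPowerSeries (Fin d) ℂ :=
  fun a => ∑ k ∈ Finset.range (a.degree + 1),
    MvPowerSeries.coeff a (V ^ k) / (k.factorial : ℂ)

/-- The formal integral of `O`, normalised by the Gaussian integral. -/
def formalIntegral {d : ℕ} (N : ℕ) (O : (Fin d → Matrix (Fin N) (Fin N) ℂ) → ℂ) :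
    MvPowerSeries (Fin d) ℂ :=
  fun a => gaussianExpect N 1
    (fun M => O M * MvPowerSeries.coeff a (formalExp (interaction M)))

/-- The expectation `⟨O⟩ = (1/Z) ∫ ∏ dM_c O e^(-S)` in the matrix model. -/
def expect {d : ℕ} (N : ℕ) (O : (Fin d → Matrix (Fin N) (Fin N) ℂ) → ℂ) :
    MvPowerSeries (Fin d) ℂ :=
  formalIntegral N O * (formalIntegral N (fun _ : Fin d → Matrix (Fin N) (Fin N) ℂ => 1))⁻¹

/-- `⟨tr M_c^p⟩`. -/
def moment {d : ℕ} (N : ℕ) (c : Fin d) (p : ℕ) : MvPowerSeries (Fin d) ℂ :=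
  expect N (fun M => ((M c) ^ p).trace)

/-- The connected correlation `⟨tr M_i^p tr M_j^q⟩ - ⟨tr M_i^p⟩ ⟨tr M_j^q⟩`. -/
def covariance {d : ℕ} (N : ℕ) (i j : Fin d) (p q : ℕ) : MvPowerSeries (Fin d) ℂ :=
  expect N (fun M => ((M i) ^ p).trace * ((M j) ^ q).trace) - moment N i p * moment N j q

/-- The power series `w` in `α_1, …, α_d` converges to `v` at the point `α`. -/
def HasValueAt {d : ℕ} (w : MvPowerSeries (Fin d) ℂ) (α : Fin d → ℂ) (v : ℂ) : Prop :=
  HasSum (fun a : Fin d →₀ ℕ => MvPowerSeries.coeff a w * ∏ c, α c ^ a c) v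

/-! ### Planar functions -/

/-- The principal square root. -/
def csqrt (z : ℂ) : ℂ := z ^ (1 / 2 : ℂ)

/-- The cut `[-2/√s, 2/√s]`. -/
def cut (s : ℂ) : Set ℂ := segment ℝ (-(2 / csqrt s)) (2 / csqrt s)

/-- The branch of `√(x² - 4/s)` on the complement of the cut that is equivalent to `x` at
infinity. -/
def sigma (s x : ℂ) : ℂ := x * csqrt (1 - 4 / (s * x ^ 2))

/-- `W` is the planar disc function `W⁰_{e_c}` of the matrix model at the couplings `α`: order by
order in the couplings, `⟨tr M_c^p⟩ / N` has a large `N` limit, these limits sum up to the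
coefficients of the expansion of `W` at infinity, and `W` is holomorphic away from the cut. -/
def IsPlanarDisc {d : ℕ} (α : Fin d → ℂ) (c : Fin d) (W : ℂ → ℂ) : Prop :=
  DifferentiableOn ℂ W (cut (1 - α c ^ 2))ᶜ ∧
  ∃ (w : ℕ → MvPowerSeries (Fin d) ℂ) (m : ℕ → ℂ),
    (∀ (p : ℕ) (a : Fin d →₀ ℕ),
      Tendsto (fun N : ℕ => (N : ℂ)⁻¹ * MvPowerSeries.coeff a (moment N c p)) atTop
        (𝓝 (MvPowerSeries.coeff a (w p)))) ∧
    (∀ p, HasValueAt (w p) α (m p)) ∧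
    ∃ R : ℝ, ∀ x : ℂ, R < ‖x‖ → HasSum (fun p : ℕ => m p / x ^ (p + 1)) (W x)

/-- `W` is the planar cylinder function `W⁰_{e_i + e_j}` of the matrix model at the couplings
`α`. -/
def IsPlanarCylinder {d : ℕ} (α : Fin d → ℂ) (i j : Fin d) (W : ℂ → ℂ → ℂ) : Prop :=
  DifferentiableOn ℂ (fun x : ℂ × ℂ => W x.1 x.2)
    ((cut (1 - α i ^ 2))ᶜ ×ˢ (cut (1 - α j ^ 2))ᶜ) ∧
  ∃ (w : ℕ → ℕ → MvPowerSeries (Fin d) ℂ) (m : ℕ → ℕ → ℂ),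
    (∀ (p q : ℕ) (a : Fin d →₀ ℕ),
      Tendsto (fun N : ℕ => MvPowerSeries.coeff a (covariance N i j p q)) atTop
        (𝓝 (MvPowerSeries.coeff a (w p q)))) ∧
    (∀ p q, HasValueAt (w p q) α (m p q)) ∧
    ∃ R : ℝ, ∀ x₁ x₂ : ℂ, R < ‖x₁‖ → R < ‖x₂‖ →
      HasSum (fun k : ℕ × ℕ => m k.1 k.2 / (x₁ ^ (k.1 + 1) * x₂ ^ (k.2 + 1))) (W x₁ x₂)

/-- Expectation in the Gaussian unitary ensemble with weight `exp (- N s / 2 * tr M²)`. -/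
def gueExpect (N : ℕ) (s : ℂ) (O : Matrix (Fin N) (Fin N) ℂ → ℂ) : ℂ :=
  gaussianExpect (d := 1) N s (fun M => O (M 0))

/-- `W` is the planar resolvent of the Gaussian unitary ensemble with weight
`exp (- N s / 2 * tr M²)`. -/
def IsGUEDisc (s : ℂ) (W : ℂ → ℂ) : Prop :=
  DifferentiableOn ℂ W (cut s)ᶜ ∧
  ∃ m : ℕ → ℂ,
    (∀ p : ℕ, Tendsto (fun N : ℕ => (N : ℂ)⁻¹ * gueExpect N s (fun M => (M ^ p).trace)) atTop
      (𝓝 (m p))) ∧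
    ∃ R : ℝ, ∀ x : ℂ, R < ‖x‖ → HasSum (fun p : ℕ => m p / x ^ (p + 1)) (W x)

/-- `W` is the planar cylinder function of the Gaussian unitary ensemble with weight
`exp (- N s / 2 * tr M²)`. -/
def IsGUECylinder (s : ℂ) (W : ℂ → ℂ → ℂ) : Prop :=
  DifferentiableOn ℂ (fun x : ℂ × ℂ => W x.1 x.2) ((cut s)ᶜ ×ˢ (cut s)ᶜ) ∧
  ∃ m : ℕ → ℕ → ℂ,
    (∀ p q : ℕ,
      Tendsto (fun N : ℕ =>
        gueExpect N s (fun M => (M ^ p).trace * (M ^ q).trace) -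
          gueExpect N s (fun M => (M ^ p).trace) * gueExpect N s (fun M => (M ^ q).trace))
        atTop (𝓝 (m p q))) ∧
    ∃ R : ℝ, ∀ x₁ x₂ : ℂ, R < ‖x₁‖ → R < ‖x₂‖ →
      HasSum (fun k : ℕ × ℕ => m k.1 k.2 / (x₁ ^ (k.1 + 1) * x₂ ^ (k.2 + 1))) (W x₁ x₂)

/-! ### Joukowsky coordinates and the global bidifferential -/

/-- The Joukowsky map `x(z) = (z + 1/z) / √s`, with `s = 1 - α_c²` for the colour `c`. It maps
`|z| > 1` onto the complement of the cut. -/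
def joukowsky (s z : ℂ) : ℂ := (1 / csqrt s) * (z + 1 / z)

/-- The coefficient of `dz₁ dz₂` in
`ω⁰_{e_i + e_j} = W⁰_{e_i + e_j}(x(z₁), x(z₂)) dx(z₁) dx(z₂)
  + δ_{ij} dx(z₁) dx(z₂) / (x(z₁) - x(z₂))²`. -/
def omega {d : ℕ} (α : Fin d → ℂ) (W : Fin d → Fin d → ℂ → ℂ → ℂ) (i j : Fin d) (z₁ z₂ : ℂ) : ℂ :=
  let x₁ := joukowsky (1 - α i ^ 2)
  let x₂ := joukowsky (1 - α j ^ 2)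
  W i j (x₁ z₁) (x₂ z₂) * deriv x₁ z₁ * deriv x₂ z₂ +
    if i = j then deriv x₁ z₁ * deriv x₂ z₂ / (x₁ z₁ - x₂ z₂) ^ 2 else 0

/-- The global bidifferential `ω⁰_2`, on pairs of points of the disjoint union of `d` copies of the
`z`-plane (a point is a colour together with a value of `z`). -/
def globalOmega {d : ℕ} (α : Fin d → ℂ) (W : Fin d → Fin d → ℂ → ℂ → ℂ) (P Q : Fin d × ℂ) : ℂ :=
  ∑ i, ∑ j, (if P.1 = i ∧ Q.1 = j then omega α W i j P.2 Q.2 else 0)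

/-- The bidifferential `ω(P, Q) dz(P) dz(Q)`, given for `|z| > 1` on `d` copies of the `z`-plane,
continues to a meromorphic bidifferential on the union of the `d` copies of `ℂ ∪ {∞} \ {0}`,
whose only singularity is a double pole (with coefficient `1` and no residue) along the diagonal
`P = Q`. The coordinate on `ℂ ∪ {∞} \ {0}` is `ζ = 1 / z ∈ ℂ`, so `dζ = - dz / z²`. -/
def HasDoublePoleOnlyOnDiagonal {d : ℕ} (ω : Fin d × ℂ → Fin d × ℂ → ℂ) : Prop :=
  ∃ h : Fin d → Fin d → ℂ × ℂ → ℂ,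
    (∀ i j, Differentiable ℂ (h i j)) ∧
    ∀ P Q : Fin d × ℂ, 1 < ‖P.2‖ → 1 < ‖Q.2‖ → P ≠ Q →
      ω P Q =
        ((if P.1 = Q.1 then 1 / (1 / P.2 - 1 / Q.2) ^ 2 else 0) + h P.1 Q.1 (1 / P.2, 1 / Q.2)) *
          (1 / P.2 ^ 2) * (1 / Q.2 ^ 2)

end TensorMatrixModel

end

set_option linter.unusedSectionVars false

noncomputable section

namespace TensorMatrixModel

/-! ### Power series over an algebra: coefficientwise maps and exponentials -/

section PowerSeriesTools

variable {τ A : Type*} [DecidableEq τ] [CommRing A] [Algebra ℂ A]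

/-! Give every trace tr M_c^p a formal source and write the exponent as N² ∑_a γ_a X^a ∏_c (tr
M_c^(a_c) / N), where the variables X are the sources together with the couplings α_c. The sources
enter linearly, so inserting a normalised trace multiplies by its expectation and adds N⁻² times a
source derivative (`sourceExpect_normTr_mul`). Hence products of normalised traces factorise at
large N, and a covariance of two traces is the source derivative of a one-trace expectation
(`covariance_eq`). Only one-trace expectations, as power series in sources and couplings, have to be
controlled.

Gaussian integration by parts gives their loop equations (`gaussianFunctional_loop`,
`isLoopSystem_sourceExpect`). These are triangular for the total matrix degree of monomial and
traces; the N⁻² terms respect this degree because a source has the degree of its trace. Induction on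
the degree yields all limits (`IsLoopSystem.tendsto_single`) and the limiting equations
(`IsLoopSystem.limit_loop`).

The coupling of a monomial a scales as N^((d-2)(1-|a|/2)), so only |a| = 2 survives. The terms α_c²
tr M_c² change the weight from 1 to 1 - α_c²; the terms α_c α_j tr M_c tr M_j couple different
colours only through first moments. The first moments vanish because 1 - ∑ α_c² is invertible
(`limitMoment_one`), so each colour has GUE moments m_p (`limitMoment_eq`). The covariances satisfy
the GUE covariance recursion with an added multiple of m_p, whose response is a multiple of p
m_(p-1), the effect of shifting the matrix by a scalar. The multiples solve a rank-one perturbed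
linear system of determinant 1 - ∑ α_c² (`limitCov_eq`). Since W/σ = -W' generates p m_(p-1), a
cylinder function is a GUE cylinder function (for equal colours) plus a constant times a product of
two factors W/σ.

What remains is analysis. The series in α are evaluated by a geometric majorant
(`HasValueAt.geometric`). The moment series satisfies F = 1 + u y² F², which makes the covariance
series algebraic (`covSeries_eq`, `hankelDerivSeries_mul`) and gives closed forms holomorphic off
the cuts. In Joukowsky coordinates W = √s / z and dx = σ dz / z, and everything becomes rational in
z. -/

/-- A linear map applied to each coefficient. -/
def mapLin {B : Type*} [CommRing B] [Algebra ℂ B] (l : A →ₗ[ℂ] B)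
    (f : MvPowerSeries τ A) : MvPowerSeries τ B :=
  fun m => l (MvPowerSeries.coeff m f)

@[simp] lemma coeff_mapLin {B : Type*} [CommRing B] [Algebra ℂ B] (l : A →ₗ[ℂ] B)
    (f : MvPowerSeries τ A) (m : τ →₀ ℕ) :
    MvPowerSeries.coeff m (mapLin l f) = l (MvPowerSeries.coeff m f) := rfl

lemma mapLin_add (l : A →ₗ[ℂ] ℂ) (f g : MvPowerSeries τ A) :
    mapLin l (f + g) = mapLin l f + mapLin l g := by
  ext m; simp

lemma mapLin_sum {ι : Type*} (l : A →ₗ[ℂ] ℂ) (s : Finset ι) (f : ι → MvPowerSeries τ A) :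
    mapLin l (∑ i ∈ s, f i) = ∑ i ∈ s, mapLin l (f i) := by
  ext m; simp

lemma mapLin_C_smul_mul (l : A →ₗ[ℂ] ℂ) (c : ℂ) (a : A) (f : MvPowerSeries τ A) :
    mapLin l (MvPowerSeries.C (c • a) * f) =
      MvPowerSeries.C c * mapLin l (MvPowerSeries.C a * f) := by
  ext m; simp [MvPowerSeries.coeff_C_mul]

lemma mapLin_pderiv (l : A →ₗ[ℂ] ℂ) (f : MvPowerSeries τ A) (q : τ) :
    mapLin l (MvPowerSeries.pderiv A q f) = MvPowerSeries.pderiv ℂ q (mapLin l f) := by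
  ext m
  simp only [coeff_mapLin, MvPowerSeries.coeff_pderiv]
  have : MvPowerSeries.coeff (m + Finsupp.single q 1) f * ((m q : A) + 1) =
      ((m q : ℂ) + 1) • MvPowerSeries.coeff (m + Finsupp.single q 1) f := by
    rw [Algebra.smul_def]; simp [mul_comm]
  rw [this, map_smul, smul_eq_mul, mul_comm]

/-- A derivation of the coefficient ring, applied to each coefficient. -/
def mapDer (D : Derivation ℂ A A) (f : MvPowerSeries τ A) : MvPowerSeries τ A :=
  mapLin (D : A →ₗ[ℂ] A) f

@[simp] lemma coeff_mapDer (D : Derivation ℂ A A) (f : MvPowerSeries τ A) (m : τ →₀ ℕ) :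
    MvPowerSeries.coeff m (mapDer D f) = D (MvPowerSeries.coeff m f) := rfl

lemma mapDer_mul (D : Derivation ℂ A A) (f g : MvPowerSeries τ A) :
    mapDer D (f * g) = f * mapDer D g + g * mapDer D f := by
  ext m
  rw [mul_comm g]
  simp only [coeff_mapDer, map_add, MvPowerSeries.coeff_mul, map_sum, Derivation.leibniz,
    smul_eq_mul, Finset.sum_add_distrib]
  congr 1
  exact Finset.sum_congr rfl fun x _ => mul_comm _ _

/-- The coefficientwise derivation. -/
def mapDerivation (D : Derivation ℂ A A) :
    Derivation ℂ (MvPowerSeries τ A) (MvPowerSeries τ A) :=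
  Derivation.mk'
    { toFun := mapDer D
      map_add' := fun f g => by ext m; simp
      map_smul' := fun c f => by
        ext m
        change D (c • MvPowerSeries.coeff m f) = c • D (MvPowerSeries.coeff m f)
        simp } fun f g => by simpa using mapDer_mul D f g

@[simp] lemma coeff_mapDerivation (D : Derivation ℂ A A) (f : MvPowerSeries τ A) (m : τ →₀ ℕ) :
    MvPowerSeries.coeff m (mapDerivation D f) = D (MvPowerSeries.coeff m f) := rfl

/-- Without constant term, V^k has order at least k; this is what makes the exponential a finite sum
in each coefficient. -/
lemma coeff_pow_eq_zero {V : MvPowerSeries τ A} (hV : MvPowerSeries.constantCoeff V = 0)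
    {m : τ →₀ ℕ} {k : ℕ} (h : m.degree < k) : MvPowerSeries.coeff m (V ^ k) = 0 := by
  apply MvPowerSeries.coeff_of_lt_order
  exact lt_of_lt_of_le (by exact_mod_cast h)
    (MvPowerSeries.le_order_pow_of_constantCoeff_eq_zero k hV)

/-- The partial sums of the exponential series. -/
def expPartial (V : MvPowerSeries τ A) (K : ℕ) : MvPowerSeries τ A :=
  ∑ k ∈ Finset.range (K + 1), ((k.factorial : ℂ)⁻¹) • V ^ k

/-- The exponential of a power series without constant term. -/
def expSeries (V : MvPowerSeries τ A) : MvPowerSeries τ A :=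
  fun m => MvPowerSeries.coeff m (expPartial V m.degree)

lemma coeff_smul' (c : ℂ) (f : MvPowerSeries τ A) (m : τ →₀ ℕ) :
    MvPowerSeries.coeff m (c • f) = c • MvPowerSeries.coeff m f := rfl

/-- The truncation may be taken later than the definition does; a derivation that shifts degrees
needs this freedom. -/
lemma coeff_expSeries {V : MvPowerSeries τ A} (hV : MvPowerSeries.constantCoeff V = 0)
    {m : τ →₀ ℕ} {K : ℕ} (h : m.degree ≤ K) :
    MvPowerSeries.coeff m (expSeries V) = MvPowerSeries.coeff m (expPartial V K) := by
  change MvPowerSeries.coeff m (expPartial V m.degree) = _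
  unfold expPartial
  rw [map_sum, map_sum]
  refine Finset.sum_subset (Finset.range_mono (by omega)) fun k _ hk => ?_
  rw [coeff_smul', coeff_pow_eq_zero hV (by simpa using hk), smul_zero]

lemma degree_le_of_antidiagonal {m : τ →₀ ℕ} {x : (τ →₀ ℕ) × (τ →₀ ℕ)}
    (hx : x ∈ Finset.HasAntidiagonal.antidiagonal m) : x.1.degree ≤ m.degree := by
  rw [← Finset.HasAntidiagonal.mem_antidiagonal.mp hx, map_add]; omega

lemma derivation_expPartial (D : Derivation ℂ (MvPowerSeries τ A) (MvPowerSeries τ A))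
    (V : MvPowerSeries τ A) (K : ℕ) :
    D (expPartial V (K + 1)) = expPartial V K * D V := by
  unfold expPartial
  rw [map_sum, Finset.sum_range_succ', Finset.sum_mul]
  simp only [pow_zero, Nat.factorial_zero, Nat.cast_one, inv_one, one_smul,
    Derivation.map_one_eq_zero, add_zero]
  refine Finset.sum_congr rfl fun k _ => ?_
  rw [Derivation.map_smul, Derivation.leibniz_pow, Nat.add_sub_cancel, smul_mul_assoc, smul_eq_mul,
    ← Nat.cast_smul_eq_nsmul ℂ, smul_smul]
  congr 1
  have : ((k + 1 : ℕ) : ℂ) ≠ 0 := by exact_mod_cast k.succ_ne_zero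
  rw [Nat.factorial_succ]; push_cast at this ⊢
  field_simp

/-- `D (exp V) = exp V * D V` for a derivation that lowers the degree by at most one. -/
lemma derivation_expSeries (D : Derivation ℂ (MvPowerSeries τ A) (MvPowerSeries τ A))
    (hD : ∀ (m : τ →₀ ℕ) (f g : MvPowerSeries τ A),
      (∀ n : τ →₀ ℕ, n.degree ≤ m.degree + 1 →
        MvPowerSeries.coeff n f = MvPowerSeries.coeff n g) →
      MvPowerSeries.coeff m (D f) = MvPowerSeries.coeff m (D g))
    {V : MvPowerSeries τ A} (hV : MvPowerSeries.constantCoeff V = 0) :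
    D (expSeries V) = expSeries V * D V := by
  ext m
  -- A coefficient of the derivative may involve coefficients one degree higher, hence truncation at
  -- `m.degree + 1`; differentiating lowers the truncation back to `m.degree`.
  rw [hD m (expSeries V) (expPartial V (m.degree + 1)) fun n hn => coeff_expSeries hV hn,
    derivation_expPartial, MvPowerSeries.coeff_mul, MvPowerSeries.coeff_mul]
  refine Finset.sum_congr rfl fun x hx => ?_
  rw [coeff_expSeries hV (degree_le_of_antidiagonal hx)]

lemma mapDerivation_expSeries (D : Derivation ℂ A A) {V : MvPowerSeries τ A}
    (hV : MvPowerSeries.constantCoeff V = 0) :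
    mapDerivation D (expSeries V) = expSeries V * mapDerivation D V :=
  derivation_expSeries _ (fun m f g h => by simp [h m (by omega)]) hV

lemma pderiv_expSeries (q : τ) {V : MvPowerSeries τ A}
    (hV : MvPowerSeries.constantCoeff V = 0) :
    MvPowerSeries.pderiv A q (expSeries V) = expSeries V * MvPowerSeries.pderiv A q V :=
  derivation_expSeries ((MvPowerSeries.pderiv A q).restrictScalars ℂ)
    (fun m f g h => by
      simp only [Derivation.restrictScalars_apply, MvPowerSeries.coeff_pderiv]
      rw [h _ (by rw [map_add, Finsupp.degree_single])]) hV

lemma constantCoeff_expSeries (V : MvPowerSeries τ A) :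
    MvPowerSeries.constantCoeff (expSeries V) = 1 := by
  rw [← MvPowerSeries.coeff_zero_eq_constantCoeff_apply]
  change MvPowerSeries.coeff 0 (expPartial V (0 : τ →₀ ℕ).degree) = 1
  simp [expPartial]

/-- The sum `∑_a X^a g_a`. -/
def monomialSum {R : Type*} [CommRing R] (g : (τ →₀ ℕ) → MvPowerSeries τ R) :
    MvPowerSeries τ R :=
  fun m => ∑ x ∈ Finset.HasAntidiagonal.antidiagonal m, MvPowerSeries.coeff x.2 (g x.1)

@[simp] lemma coeff_monomialSum {R : Type*} [CommRing R] (g : (τ →₀ ℕ) → MvPowerSeries τ R)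
    (m : τ →₀ ℕ) : MvPowerSeries.coeff m (monomialSum g) =
      ∑ x ∈ Finset.HasAntidiagonal.antidiagonal m, MvPowerSeries.coeff x.2 (g x.1) := rfl

lemma monomialSum_mul {R : Type*} [CommRing R] (g : (τ →₀ ℕ) → MvPowerSeries τ R)
    (f : MvPowerSeries τ R) : monomialSum g * f = monomialSum fun a => g a * f := by
  ext m
  simp only [MvPowerSeries.coeff_mul, coeff_monomialSum, Finset.sum_mul]
  rw [Finset.sum_sigma', Finset.sum_sigma']
  refine Finset.sum_nbij' (fun x => ⟨(x.2.1, x.2.2 + x.1.2), (x.2.2, x.1.2)⟩)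
    (fun x => ⟨(x.1.1 + x.2.1, x.2.2), (x.1.1, x.2.1)⟩) ?_ ?_ ?_ ?_ ?_
  all_goals
    rintro ⟨⟨a, b⟩, ⟨c, e⟩⟩ h
    simp only [Finset.mem_sigma, Finset.HasAntidiagonal.mem_antidiagonal] at h ⊢
  · obtain ⟨h1, h2⟩ := h
    exact ⟨by rw [← add_assoc, h2, h1], trivial⟩
  · obtain ⟨h1, h2⟩ := h
    exact ⟨by rw [add_assoc, h2, h1], trivial⟩
  · obtain ⟨h1, h2⟩ := h
    simp [h2]
  · obtain ⟨h1, h2⟩ := h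
    simp [h2]

/-- Only the first factor is expanded, its coefficients staying inside the functional. With the
derivative of the action as first factor this yields the sum over couplings in the loop equations.
-/
lemma mapLin_mul_eq_monomialSum (l : A →ₗ[ℂ] ℂ) (f g : MvPowerSeries τ A) :
    mapLin l (f * g) = monomialSum fun a =>
      mapLin l (MvPowerSeries.C (MvPowerSeries.coeff a f) * g) := by
  ext m
  simp only [coeff_mapLin, coeff_monomialSum, MvPowerSeries.coeff_C_mul]
  rw [MvPowerSeries.coeff_mul, map_sum]

end PowerSeriesTools

/-! ### Gaussian integrals of polynomials -/

/-- The unnormalised Gaussian moment `∫ x^n e^(-b x²) dx`. -/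
def gaussianMoment (b : ℂ) (n : ℕ) : ℂ := ∫ x : ℝ, (x : ℂ) ^ n * Complex.exp (-b * (x : ℂ) ^ 2)

lemma integrable_pow_mul_cexp_neg_mul_sq {b : ℂ} (hb : 0 < b.re) (n : ℕ) :
    Integrable fun x : ℝ => (x : ℂ) ^ n * Complex.exp (-b * (x : ℂ) ^ 2) := by
  refine ⟨(by fun_prop : Continuous fun x : ℝ =>
    (x : ℂ) ^ n * Complex.exp (-b * (x : ℂ) ^ 2)).aestronglyMeasurable, ?_⟩
  have := (integrable_rpow_mul_exp_neg_mul_sq hb (s := (n : ℝ))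
    (by have := n.cast_nonneg (α := ℝ); linarith)).hasFiniteIntegral
  rw [← hasFiniteIntegral_norm_iff] at this ⊢
  convert! this using 2 with x
  rw [norm_mul, norm_mul, norm_cexp_neg_mul_sq b, Real.rpow_natCast, norm_pow, norm_pow,
    Complex.norm_real, Real.norm_of_nonneg (Real.exp_pos _).le]

/-- The derivative of x^n e^(-b x²) integrates to zero. For n = 0 the truncated index n - 1 is
harmless, since the factor n vanishes. -/
lemma gaussianMoment_succ {b : ℂ} (hb : 0 < b.re) (n : ℕ) :
    2 * b * gaussianMoment b (n + 1) = n * gaussianMoment b (n - 1) := by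
  have hderiv : ∀ x : ℝ, HasDerivAt (fun x : ℝ => (x : ℂ) ^ n * Complex.exp (-b * (x : ℂ) ^ 2))
      (n * ((x : ℂ) ^ (n - 1) * Complex.exp (-b * (x : ℂ) ^ 2)) -
        2 * b * ((x : ℂ) ^ (n + 1) * Complex.exp (-b * (x : ℂ) ^ 2))) x := by
    intro x
    have h1 : HasDerivAt (fun z : ℂ => z ^ n * Complex.exp (-b * z ^ 2))
        (n * (x : ℂ) ^ (n - 1) * Complex.exp (-b * (x : ℂ) ^ 2) + (x : ℂ) ^ n *
          (Complex.exp (-b * (x : ℂ) ^ 2) * (-b * (2 * (x : ℂ) ^ (2 - 1))))) (x : ℂ) := by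
      have := (hasDerivAt_pow n (x : ℂ)).mul (((hasDerivAt_pow 2 (x : ℂ)).const_mul (-b)).cexp)
      exact_mod_cast this
    convert h1.comp_ofReal using 1
    ring
  have hi := integrable_pow_mul_cexp_neg_mul_sq hb
  have h := integral_eq_zero_of_hasDerivAt_of_integrable hderiv
    (((hi (n - 1)).const_mul _).sub ((hi (n + 1)).const_mul _)) (hi n)
  rw [integral_sub ((hi (n - 1)).const_mul _) ((hi (n + 1)).const_mul _),
    integral_const_mul, integral_const_mul] at h
  exact (sub_eq_zero.mp h).symm

lemma gaussianMoment_zero_ne_zero {b : ℂ} (hb : 0 < b.re) : gaussianMoment b 0 ≠ 0 := by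
  have h : gaussianMoment b 0 = (Real.pi / b : ℂ) ^ (1 / 2 : ℂ) := by
    simpa [gaussianMoment] using integral_gaussian_complex hb
  have hb0 : b ≠ 0 := fun h => by simp [h] at hb
  rw [h, Ne, Complex.cpow_eq_zero_iff]
  simp [hb0, Real.pi_ne_zero]

/-! ### Product functionals on polynomials. -/

section MomentFunctional

variable {ι : Type*} [Fintype ι]

/-- The linear functional on polynomials with `∏_i x_i^(m_i) ↦ ∏_i μ_i (m_i)`. -/
def momentFunctional (μ : ι → ℕ → ℂ) : MvPolynomial ι ℂ →ₗ[ℂ] ℂ :=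
  (MvPolynomial.basisMonomials ι ℂ).constr ℂ fun m => ∏ i, μ i (m i)

lemma momentFunctional_monomial (μ : ι → ℕ → ℂ) (m : ι →₀ ℕ) (c : ℂ) :
    momentFunctional μ (MvPolynomial.monomial m c) = c * ∏ i, μ i (m i) := by
  have h1 : MvPolynomial.monomial m c = c • MvPolynomial.basisMonomials ι ℂ m := by
    rw [MvPolynomial.coe_basisMonomials, MvPolynomial.smul_monomial]; simp
  rw [h1, map_smul, momentFunctional, Module.Basis.constr_basis, smul_eq_mul]

/-- The functional factorises over the variables, so the recursion in one exponent lifts to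
integration by parts on all polynomials. -/
lemma momentFunctional_X_mul [DecidableEq ι] {μ : ι → ℕ → ℂ} {i : ι} {t : ℂ}
    (h : ∀ n, t * μ i (n + 1) = n * μ i (n - 1)) (p : MvPolynomial ι ℂ) :
    t * momentFunctional μ (MvPolynomial.X i * p) =
      momentFunctional μ (MvPolynomial.pderiv i p) := by
  induction p using MvPolynomial.induction_on' with
  | add p q hp hq => rw [mul_add, map_add, map_add, map_add, mul_add, hp, hq]
  | monomial m c =>
    rw [MvPolynomial.pderiv_monomial, MvPolynomial.X, MvPolynomial.monomial_mul,
      momentFunctional_monomial, momentFunctional_monomial,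
      ← Finset.mul_prod_erase _ _ (Finset.mem_univ i),
      ← Finset.mul_prod_erase _ _ (Finset.mem_univ i)]
    have h1 : ∀ j ∈ Finset.univ.erase i, μ j ((Finsupp.single i 1 + m : ι →₀ ℕ) j) = μ j (m j) := by
      intro j hj
      have : i ≠ j := (Finset.ne_of_mem_erase hj).symm
      simp [this]
    have h2 : ∀ j ∈ Finset.univ.erase i, μ j ((m - Finsupp.single i 1 : ι →₀ ℕ) j) = μ j (m j) := by
      intro j hj
      have : i ≠ j := (Finset.ne_of_mem_erase hj).symm
      simp [this]
    rw [Finset.prod_congr rfl h1, Finset.prod_congr rfl h2]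
    have h3 := h (m i)
    simp only [Finsupp.add_apply, Finsupp.single_eq_same, Finsupp.tsub_apply, one_mul,
      add_comm 1 (m i)]
    linear_combination (c * ∏ j ∈ Finset.univ.erase i, μ j (m j)) * h3

end MomentFunctional

/-! ### The Gaussian matrix integral as a functional on polynomials in the coordinates. -/

section GaussianFunctional

variable {d N : ℕ}

/-- Labels of the real coordinates of `d` Hermitian `N × N` matrices. -/
abbrev Coord (d N : ℕ) := Fin d × Fin N × Fin N

/-- The coefficient of the square of a coordinate in `N s / 2 * ∑_c tr M_c²`. -/
def coordWeight (N : ℕ) (s : ℂ) {d : ℕ} (i : Coord d N) : ℂ :=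
  N * s / 2 * if i.2.1 = i.2.2 then 1 else 2

lemma coordWeight_re_pos {s : ℂ} (hs : 0 < s.re) (hN : N ≠ 0) (i : Coord d N) :
    0 < (coordWeight N s i).re := by
  have hN' : (0 : ℝ) < N := by exact_mod_cast Nat.pos_of_ne_zero hN
  have h : ((N : ℂ) * s / 2) = (((N : ℝ) / 2 : ℝ) : ℂ) * s := by push_cast; ring
  unfold coordWeight
  rw [h]
  split_ifs
  · rw [mul_one, Complex.re_ofReal_mul]; positivity
  · rw [mul_assoc, Complex.re_ofReal_mul, mul_comm s, show (2 : ℂ) = ((2 : ℝ) : ℂ) by norm_num,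
      Complex.re_ofReal_mul]
    positivity

lemma trace_hermitian_sq (ξ : Fin N → Fin N → ℝ) :
    ((hermitian ξ) ^ 2).trace = ∑ a, ∑ b, (if a = b then 1 else 2) * (ξ a b : ℂ) ^ 2 := by
  -- Off the diagonal M_ab M_ba = ξ_ab² + ξ_ba². The halves on the diagonal allow the same symmetric
  -- form for all pairs, after which exchanging a and b merges the two sums.
  have h1 : ((hermitian ξ) ^ 2).trace = ∑ a, ∑ b,
      ((if a = b then (ξ a b : ℂ) ^ 2 / 2 else (ξ a b : ℂ) ^ 2) +
        (if b = a then (ξ b a : ℂ) ^ 2 / 2 else (ξ b a : ℂ) ^ 2)) := by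
    simp only [sq, Matrix.trace, Matrix.diag_apply, Matrix.mul_apply]
    refine Finset.sum_congr rfl fun a _ => Finset.sum_congr rfl fun b _ => ?_
    simp only [hermitian, Matrix.of_apply]
    rcases lt_trichotomy a b with h | h | h
    · rw [if_neg h.ne, if_pos h, if_neg h.ne', if_neg h.not_gt, if_neg h.ne, if_neg h.ne']
      linear_combination (-(ξ b a : ℂ) ^ 2) * Complex.I_sq
    · subst h; simp
    · rw [if_neg h.ne', if_neg h.not_gt, if_neg h.ne, if_pos h, if_neg h.ne', if_neg h.ne]
      linear_combination (-(ξ a b : ℂ) ^ 2) * Complex.I_sq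
  rw [h1]
  simp only [Finset.sum_add_distrib]
  rw [add_comm, Finset.sum_comm, ← Finset.sum_add_distrib]
  refine Finset.sum_congr rfl fun a _ => ?_
  rw [← Finset.sum_add_distrib]
  refine Finset.sum_congr rfl fun b _ => ?_
  split_ifs <;> ring

/-- The point with coordinates `ξ`, as a family indexed by `Coord d N`. -/
def coordPoint (ξ : Fin d → Fin N → Fin N → ℝ) (i : Coord d N) : ℂ := (ξ i.1 i.2.1 i.2.2 : ℂ)

lemma gaussianWeight_eq (s : ℂ) (ξ : Fin d → Fin N → Fin N → ℝ) :
    gaussianWeight s (fun c => hermitian (ξ c)) =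
      ∏ c, ∏ a, ∏ b, Complex.exp (-coordWeight N s (c, a, b) * (ξ c a b : ℂ) ^ 2) := by
  simp only [gaussianWeight, trace_hermitian_sq, Finset.mul_sum, ← Complex.exp_sum]
  congr 1
  refine Finset.sum_congr rfl fun c _ => Finset.sum_congr rfl fun a _ =>
    Finset.sum_congr rfl fun b _ => ?_
  simp only [coordWeight]
  ring

/-- The unnormalised Gaussian functional on polynomials in the coordinates. -/
def gaussianPairing (d N : ℕ) (s : ℂ) : MvPolynomial (Coord d N) ℂ →ₗ[ℂ] ℂ :=
  momentFunctional fun i => gaussianMoment (coordWeight N s i)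

/-- Monomial and weight are products over the coordinates. The coordinate space is an iterated
function space, so Fubini is used once for each of the three indices. -/
lemma integral_monomial_mul_gaussianWeight {s : ℂ} (hs : 0 < s.re) (hN : N ≠ 0)
    (m : Coord d N →₀ ℕ) (c : ℂ) :
    Integrable (fun ξ : Fin d → Fin N → Fin N → ℝ =>
      MvPolynomial.eval (coordPoint ξ) (MvPolynomial.monomial m c) *
        gaussianWeight s (fun c => hermitian (ξ c))) ∧
    ∫ ξ : Fin d → Fin N → Fin N → ℝ,
      MvPolynomial.eval (coordPoint ξ) (MvPolynomial.monomial m c) *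
        gaussianWeight s (fun c => hermitian (ξ c)) =
      gaussianPairing d N s (MvPolynomial.monomial m c) := by
  have h : ∀ ξ : Fin d → Fin N → Fin N → ℝ,
      MvPolynomial.eval (coordPoint ξ) (MvPolynomial.monomial m c) *
        gaussianWeight s (fun c => hermitian (ξ c)) =
      c * ∏ k, ∏ a, ∏ b, ((ξ k a b : ℂ) ^ m (k, a, b) *
        Complex.exp (-coordWeight N s (k, a, b) * (ξ k a b : ℂ) ^ 2)) := by
    intro ξ
    rw [MvPolynomial.eval_monomial, gaussianWeight_eq, Finsupp.prod_fintype _ _ (by simp),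
      Fintype.prod_prod_type, mul_assoc]
    simp only [Fintype.prod_prod_type, coordPoint, Finset.prod_mul_distrib]
  simp only [h]
  refine ⟨Integrable.const_mul ?_ _, ?_⟩
  · refine Integrable.fintype_prod_dep (f := fun k (x : Fin N → Fin N → ℝ) =>
      ∏ a, ∏ b, ((x a b : ℂ) ^ m (k, a, b) *
        Complex.exp (-coordWeight N s (k, a, b) * (x a b : ℂ) ^ 2))) fun k => ?_
    refine Integrable.fintype_prod_dep (f := fun a (x : Fin N → ℝ) =>
      ∏ b, ((x b : ℂ) ^ m (k, a, b) *
        Complex.exp (-coordWeight N s (k, a, b) * (x b : ℂ) ^ 2))) fun a => ?_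
    exact Integrable.fintype_prod_dep (f := fun b (x : ℝ) =>
      ((x : ℂ) ^ m (k, a, b) *
        Complex.exp (-coordWeight N s (k, a, b) * (x : ℂ) ^ 2))) fun b =>
      integrable_pow_mul_cexp_neg_mul_sq (coordWeight_re_pos hs hN _) _
  · rw [integral_const_mul, gaussianPairing, momentFunctional_monomial, Fintype.prod_prod_type]
    congr 1
    rw [integral_fintype_prod_volume_eq_prod (fun k (x : Fin N → Fin N → ℝ) =>
      ∏ a, ∏ b, ((x a b : ℂ) ^ m (k, a, b) *
        Complex.exp (-coordWeight N s (k, a, b) * (x a b : ℂ) ^ 2)))]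
    refine Finset.prod_congr rfl fun k _ => ?_
    rw [integral_fintype_prod_volume_eq_prod (fun a (x : Fin N → ℝ) =>
      ∏ b, ((x b : ℂ) ^ m (k, a, b) *
        Complex.exp (-coordWeight N s (k, a, b) * (x b : ℂ) ^ 2))), Fintype.prod_prod_type]
    refine Finset.prod_congr rfl fun a _ => ?_
    rw [integral_fintype_prod_volume_eq_prod (fun b (x : ℝ) =>
      ((x : ℂ) ^ m (k, a, b) *
        Complex.exp (-coordWeight N s (k, a, b) * (x : ℂ) ^ 2)))]
    rfl

lemma integral_eval_mul_gaussianWeight {s : ℂ} (hs : 0 < s.re) (hN : N ≠ 0)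
    (p : MvPolynomial (Coord d N) ℂ) :
    Integrable (fun ξ : Fin d → Fin N → Fin N → ℝ =>
      MvPolynomial.eval (coordPoint ξ) p * gaussianWeight s (fun c => hermitian (ξ c))) ∧
    ∫ ξ : Fin d → Fin N → Fin N → ℝ,
      MvPolynomial.eval (coordPoint ξ) p * gaussianWeight s (fun c => hermitian (ξ c)) =
      gaussianPairing d N s p := by
  induction p using MvPolynomial.induction_on' with
  | monomial m c => exact integral_monomial_mul_gaussianWeight hs hN m c
  | add p q hp hq =>
    simp only [map_add, add_mul]
    exact ⟨hp.1.add hq.1, by rw [integral_add hp.1 hq.1, hp.2, hq.2]⟩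

lemma gaussianPairing_one_ne_zero {s : ℂ} (hs : 0 < s.re) (hN : N ≠ 0) :
    gaussianPairing d N s 1 ≠ 0 := by
  rw [← MvPolynomial.C_1, ← MvPolynomial.monomial_zero', gaussianPairing,
    momentFunctional_monomial, one_mul]
  exact Finset.prod_ne_zero_iff.mpr fun i _ =>
    gaussianMoment_zero_ne_zero (coordWeight_re_pos hs hN i)

/-- The normalised Gaussian functional on polynomials in the coordinates. -/
def gaussianFunctional (d N : ℕ) (s : ℂ) : MvPolynomial (Coord d N) ℂ →ₗ[ℂ] ℂ :=
  (gaussianPairing d N s 1)⁻¹ • gaussianPairing d N s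

lemma gaussianFunctional_one {s : ℂ} (hs : 0 < s.re) (hN : N ≠ 0) :
    gaussianFunctional d N s 1 = 1 := by
  simp [gaussianFunctional, gaussianPairing_one_ne_zero hs hN]

/-- This replaces integrals by a linear functional on polynomials, so that the loop equations become
purely algebraic. -/
lemma gaussianExpect_eq {s : ℂ} (hs : 0 < s.re) (hN : N ≠ 0)
    {O : (Fin d → Matrix (Fin N) (Fin N) ℂ) → ℂ} {p : MvPolynomial (Coord d N) ℂ}
    (h : ∀ ξ : Fin d → Fin N → Fin N → ℝ,
      O (fun c => hermitian (ξ c)) = MvPolynomial.eval (coordPoint ξ) p) :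
    gaussianExpect N s O = gaussianFunctional d N s p := by
  have h1 := (integral_eval_mul_gaussianWeight (d := d) hs hN 1).2
  simp only [map_one, one_mul] at h1
  simp only [gaussianExpect, h]
  rw [(integral_eval_mul_gaussianWeight hs hN p).2, h1, gaussianFunctional, LinearMap.smul_apply,
    smul_eq_mul, div_eq_inv_mul]

lemma gaussianFunctional_X_mul {s : ℂ} (hs : 0 < s.re) (hN : N ≠ 0) (i : Coord d N)
    (p : MvPolynomial (Coord d N) ℂ) :
    2 * coordWeight N s i * gaussianFunctional d N s (MvPolynomial.X i * p) =
      gaussianFunctional d N s (MvPolynomial.pderiv i p) := by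
  simp only [gaussianFunctional, LinearMap.smul_apply, smul_eq_mul]
  rw [mul_left_comm, gaussianPairing, momentFunctional_X_mul]
  exact fun n => gaussianMoment_succ (coordWeight_re_pos hs hN i) n

end GaussianFunctional

/-! ### Loop equations of the Gaussian functional -/

section Loop

variable {d N : ℕ}

/-- The Hermitian matrix of colour `c` with indeterminate coordinates. -/
def matX (c : Fin d) : Matrix (Fin N) (Fin N) (MvPolynomial (Coord d N) ℂ) :=
  Matrix.of fun a b =>
    if a = b then MvPolynomial.X (c, a, a)
    else if a < b then MvPolynomial.X (c, a, b) + Complex.I • MvPolynomial.X (c, b, a)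
    else MvPolynomial.X (c, b, a) - Complex.I • MvPolynomial.X (c, a, b)

/-- The polynomial `tr M_c^p`. -/
def trPow (N : ℕ) (c : Fin d) (p : ℕ) : MvPolynomial (Coord d N) ℂ :=
  ((matX c : Matrix (Fin N) (Fin N) _) ^ p).trace

lemma eval_matX (ξ : Fin d → Fin N → Fin N → ℝ) (c : Fin d) :
    (MvPolynomial.eval (coordPoint ξ)).mapMatrix (matX c) = hermitian (ξ c) := by
  ext a b
  simp only [RingHom.mapMatrix_apply, Matrix.map_apply, matX, hermitian, Matrix.of_apply]
  split_ifs <;> simp [coordPoint]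

lemma eval_trPow (ξ : Fin d → Fin N → Fin N → ℝ) (c : Fin d) (p : ℕ) :
    MvPolynomial.eval (coordPoint ξ) (trPow N c p) = ((hermitian (ξ c)) ^ p).trace := by
  rw [← eval_matX, ← map_pow, trPow, Matrix.trace, Matrix.trace, map_sum]
  rfl

lemma trPow_zero (c : Fin d) : trPow N c 0 = (N : MvPolynomial (Coord d N) ℂ) := by
  simp [trPow]

/-- The derivation with `M_c' (a', b') ↦ δ_(c c') δ_(a b') δ_(b a')`. -/
def entryDer (c : Fin d) (a b : Fin N) :
    Derivation ℂ (MvPolynomial (Coord d N) ℂ) (MvPolynomial (Coord d N) ℂ) :=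
  if a = b then MvPolynomial.pderiv (c, a, a)
  else if a < b then
    (1 / 2 : ℂ) • (MvPolynomial.pderiv (c, a, b) + Complex.I • MvPolynomial.pderiv (c, b, a))
  else
    (1 / 2 : ℂ) • (MvPolynomial.pderiv (c, b, a) - Complex.I • MvPolynomial.pderiv (c, a, b))

/-- For a < b put M_ab = x + iy. The Wirtinger operator (∂_x + i ∂_y)/2 kills x + iy and sends M_ba
= x - iy to 1, so `entryDer c a b` differentiates with respect to the entry (b, a) as if all entries
were independent. -/
lemma entryDer_matX (c c' : Fin d) (a b a' b' : Fin N) :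
    entryDer c a b (matX c' a' b') = if c = c' ∧ a' = b ∧ b' = a then 1 else 0 := by
  have hI : ∀ x : MvPolynomial (Coord d N) ℂ, Complex.I • Complex.I • x = -x := fun x => by
    rw [smul_smul, Complex.I_mul_I, neg_one_smul]
  have h2 : ((1 / 2 : ℂ) • (1 + 1) : MvPolynomial (Coord d N) ℂ) = 1 := by
    rw [← two_smul ℂ, smul_smul]; norm_num
  simp only [entryDer, matX, Matrix.of_apply]
  by_cases hc : c = c'
  swap
  · split_ifs <;>
      simp_all [MvPolynomial.pderiv_X, Ne.symm hc]
  subst hc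
  have h3 : ((2⁻¹ : ℂ) • 1 + (2⁻¹ : ℂ) • 1 : MvPolynomial (Coord d N) ℂ) = 1 := by
    rw [← smul_add, ← one_div, h2]
  have h4 : (Complex.I • (2⁻¹ : ℂ) • Complex.I • 1 : MvPolynomial (Coord d N) ℂ) =
      -((2⁻¹ : ℂ) • 1) := by
    rw [smul_comm (2⁻¹ : ℂ), hI]
  rcases lt_trichotomy a b with h | h | h <;> rcases lt_trichotomy a' b' with h' | h' | h' <;>
  (first | rw [if_neg h.ne, if_pos h] | rw [if_pos h] | rw [if_neg h.ne', if_neg h.not_gt]) <;>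
  (first | rw [if_neg h'.ne, if_pos h'] | rw [if_pos h'] | rw [if_neg h'.ne', if_neg h'.not_gt]) <;>
  simp only [Derivation.smul_apply, Derivation.add_apply, Derivation.sub_apply, map_add, map_sub,
    Derivation.map_smul, MvPolynomial.pderiv_X, Pi.single_apply, Prod.mk.injEq, true_and] <;>
  split_ifs <;> first | (exfalso; grind) | simp [h3, h4]

/-- Off-diagonal coordinates have twice the weight of diagonal ones, which cancels the 1/2 in the
Wirtinger operators; all entries therefore get the same factor N s. -/
lemma gaussianFunctional_matX_mul {s : ℂ} (hs : 0 < s.re) (hN : N ≠ 0) (c : Fin d) (a b : Fin N)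
    (f : MvPolynomial (Coord d N) ℂ) :
    N * s * gaussianFunctional d N s (matX c a b * f) =
      gaussianFunctional d N s (entryDer c a b f) := by
  have h := fun i => gaussianFunctional_X_mul (d := d) hs hN i f
  simp only [matX, entryDer, Matrix.of_apply]
  split_ifs with h1 h2
  · rw [← h]; simp only [coordWeight, if_true]; ring
  · have ha := h (c, a, b)
    have hb := h (c, b, a)
    simp only [coordWeight, if_neg h1, if_neg (Ne.symm h1)] at ha hb
    simp only [add_mul, smul_mul_assoc, map_add, map_smul, Derivation.smul_apply,
      Derivation.add_apply, smul_eq_mul, ← ha, ← hb]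
    ring
  · have ha := h (c, a, b)
    have hb := h (c, b, a)
    simp only [coordWeight, if_neg h1, if_neg (Ne.symm h1)] at ha hb
    simp only [sub_mul, smul_mul_assoc, map_sub, map_smul, Derivation.smul_apply,
      Derivation.sub_apply, smul_eq_mul, ← ha, ← hb]
    ring

lemma entryDer_pow_of_ne {c c' : Fin d} (h : c ≠ c') (a b i j : Fin N) (p : ℕ) :
    entryDer c a b ((matX c' ^ p) i j) = 0 := by
  induction p generalizing i j with
  | zero => simp only [pow_zero, Matrix.one_apply]; split_ifs <;> simp
  | succ p ih =>
    rw [pow_succ, Matrix.mul_apply, map_sum]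
    refine Finset.sum_eq_zero fun v _ => ?_
    simp [Derivation.leibniz, ih, entryDer_matX, h]

/-- By the Leibniz rule, the k-th term comes from the factor preceded by k others; removing it cuts
the product into M^k and M^(p-1-k). -/
lemma entryDer_pow (c : Fin d) (a b i j : Fin N) (p : ℕ) :
    entryDer c a b ((matX c ^ p) i j) =
      ∑ k ∈ Finset.range p, (matX c ^ k) i b * (matX c ^ (p - 1 - k)) a j := by
  induction p generalizing i j with
  | zero => simp only [pow_zero, Matrix.one_apply]; split_ifs <;> simp
  | succ p ih =>
    rw [pow_succ, Matrix.mul_apply, map_sum]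
    simp only [Derivation.leibniz, ih, entryDer_matX, smul_eq_mul, Finset.sum_add_distrib,
      Finset.mul_sum, true_and]
    rw [Finset.sum_comm, Finset.sum_range_succ, add_comm]
    congr 1
    · refine Finset.sum_congr rfl fun k hk => ?_
      have hk' : p + 1 - 1 - k = p - 1 - k + 1 := by
        have := Finset.mem_range.mp hk; omega
      rw [hk', pow_succ, Matrix.mul_apply, Finset.mul_sum]
      exact Finset.sum_congr rfl fun v _ => by ring
    · simp [Matrix.one_apply, ite_and, eq_comm]

lemma derivation_sum_apply {ι A : Type*} [CommRing A] [Algebra ℂ A] (t : Finset ι)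
    (D : ι → Derivation ℂ A A) (f : A) : (∑ i ∈ t, D i) f = ∑ i ∈ t, D i f := by
  classical
  induction t using Finset.induction_on with
  | empty => simp
  | insert i t hi ih => rw [Finset.sum_insert hi, Finset.sum_insert hi, Derivation.add_apply, ih]

/-- The derivation `∑_(a b) (M_c^p)_(b a) ∂/∂M_(b a)`. -/
def loopDer (c : Fin d) (p : ℕ) :
    Derivation ℂ (MvPolynomial (Coord d N) ℂ) (MvPolynomial (Coord d N) ℂ) :=
  ∑ a, ∑ b, (matX c ^ p) b a • entryDer c a b

lemma loopDer_apply (c : Fin d) (p : ℕ) (f : MvPolynomial (Coord d N) ℂ) :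
    loopDer c p f = ∑ a, ∑ b, (matX c ^ p) b a * entryDer c a b f := by
  simp only [loopDer, derivation_sum_apply, Derivation.smul_apply, smul_eq_mul]

lemma loopDer_trPow_of_ne {c c' : Fin d} (h : c ≠ c') (p q : ℕ) :
    loopDer c p (trPow N c' q) = 0 := by
  simp [loopDer_apply, trPow, Matrix.trace, entryDer_pow_of_ne h]

/-- The derivation is the infinitesimal change δM = M^p, under which tr M^q varies by q tr (M^p
M^(q-1)), by cyclicity. -/
lemma loopDer_trPow (c : Fin d) (p q : ℕ) :
    loopDer c p (trPow N c q) = q • trPow N c (p + q - 1) := by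
  simp only [loopDer_apply, trPow, Matrix.trace, Matrix.diag_apply, map_sum, entryDer_pow]
  have h1 : ∀ a b : Fin N, ∑ i, ∑ k ∈ Finset.range q,
      ((matX c : Matrix (Fin N) (Fin N) (MvPolynomial (Coord d N) ℂ)) ^ k) i b *
        (matX c ^ (q - 1 - k)) a i = q • (matX c ^ (q - 1)) a b := by
    intro a b
    rw [Finset.sum_comm]
    rw [Finset.sum_congr rfl (g := fun _ => (matX c ^ (q - 1)) a b), Finset.sum_const,
      Finset.card_range]
    intro k hk
    have hk' : q - 1 = (q - 1 - k) + k := by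
      have := Finset.mem_range.mp hk; omega
    conv_rhs => rw [hk', pow_add, Matrix.mul_apply]
    exact Finset.sum_congr rfl fun i _ => mul_comm _ _
  rw [Finset.sum_comm, Finset.sum_congr rfl fun _ _ => Finset.sum_comm]
  simp only [← Finset.mul_sum]
  rw [Finset.sum_congr rfl fun a _ => Finset.sum_congr rfl fun b _ =>
    congrArg ((matX c ^ p) b a * ·) (h1 a b)]
  -- For q = 0 the factor q kills the truncated exponents; otherwise q - 1 is a genuine difference.
  rcases Nat.eq_zero_or_pos q with rfl | hq
  · simp
  rw [Finset.sum_comm, Finset.smul_sum]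
  refine Finset.sum_congr rfl fun b _ => ?_
  rw [show p + q - 1 = p + (q - 1) by omega, pow_add, Matrix.mul_apply, Finset.smul_sum]
  exact Finset.sum_congr rfl fun a _ => by rw [mul_smul_comm]

/-- The Schwinger–Dyson equation: write tr M^(p+1) as the sum of M_ab (M^p)_ba and integrate each
M_ab by parts. The derivative of (M^p)_ba splits the trace in two, and the derivative of f assembles
to `loopDer`. -/
lemma gaussianFunctional_loop {s : ℂ} (hs : 0 < s.re) (hN : N ≠ 0) (c : Fin d) (p : ℕ)
    (f : MvPolynomial (Coord d N) ℂ) :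
    N * s * gaussianFunctional d N s (trPow N c (p + 1) * f) =
      gaussianFunctional d N s
        ((∑ k ∈ Finset.range p, trPow N c k * trPow N c (p - 1 - k)) * f + loopDer c p f) := by
  have h1 : trPow N c (p + 1) * f =
      ∑ a, ∑ b, matX c a b * ((matX c ^ p) b a * f) := by
    rw [trPow, pow_succ', Matrix.trace, Finset.sum_mul]
    refine Finset.sum_congr rfl fun a _ => ?_
    rw [Matrix.diag_apply, Matrix.mul_apply, Finset.sum_mul]
    exact Finset.sum_congr rfl fun b _ => mul_assoc _ _ _
  have h2 : ∑ a, ∑ b, entryDer c a b ((matX c ^ p) b a) =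
      ∑ k ∈ Finset.range p, trPow N c k * trPow N c (p - 1 - k) := by
    simp only [entryDer_pow]
    rw [Finset.sum_congr rfl fun a _ => Finset.sum_comm, Finset.sum_comm]
    refine Finset.sum_congr rfl fun k _ => ?_
    rw [trPow, trPow, Matrix.trace, Matrix.trace, Finset.sum_mul_sum, Finset.sum_comm]
    rfl
  rw [h1, loopDer_apply, ← h2]
  rw [map_sum, Finset.mul_sum, Finset.sum_mul, ← Finset.sum_add_distrib, map_sum]
  refine Finset.sum_congr rfl fun a _ => ?_
  rw [map_sum, Finset.mul_sum, Finset.sum_mul, ← Finset.sum_add_distrib, map_sum]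
  refine Finset.sum_congr rfl fun b _ => ?_
  rw [gaussianFunctional_matX_mul hs hN, Derivation.leibniz, smul_eq_mul, smul_eq_mul, add_comm,
    mul_comm f]

end Loop

/-! ### Large `N` limits of the solutions of the loop equations -/

/-- The label `(c, p)` stands for the normalised trace `tr M_c^p / N`. -/
abbrev Label (d : ℕ) := Fin d × ℕ

/-- The formal variables: a source for each label, and the couplings `α_c`. -/
abbrev Var (d : ℕ) := Label d ⊕ Fin d

variable {d : ℕ}

/-- The degree of a variable in the matrices. -/
def varDegree : Var d → ℕ := Sum.elim Prod.snd fun _ => 1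

/-- The degree of a variable in the matrix `M_c`. -/
def varColorDegree (c : Fin d) : Var d → ℕ :=
  Sum.elim (fun q => if q.1 = c then q.2 else 0) fun c' => if c' = c then 1 else 0

/-- The degree of a monomial in the matrices. -/
def monDegree (m : Var d →₀ ℕ) : ℕ := Finsupp.weight varDegree m

/-- The degree of a monomial in the matrix `M_c`. -/
def colorDegree (m : Var d →₀ ℕ) (c : Fin d) : ℕ := Finsupp.weight (varColorDegree c) m

lemma monDegree_add (m m' : Var d →₀ ℕ) : monDegree (m + m') = monDegree m + monDegree m' :=
  map_add _ _ _

lemma monDegree_single_inl (q : Label d) : monDegree (Finsupp.single (Sum.inl q) 1) = q.2 := by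
  simp [monDegree, Finsupp.weight_apply, varDegree]

lemma sum_colorDegree (m : Var d →₀ ℕ) : ∑ c, colorDegree m c = monDegree m := by
  simp only [colorDegree, monDegree, Finsupp.weight_apply, Finsupp.sum]
  rw [Finset.sum_comm]
  refine Finset.sum_congr rfl fun v _ => ?_
  rw [← Finset.smul_sum]
  congr 1
  rcases v with q | c <;> simp [varColorDegree, varDegree]

lemma colorDegree_add_sum_erase (m : Var d →₀ ℕ) (c : Fin d) :
    colorDegree m c + ∑ c' ∈ Finset.univ.erase c, colorDegree m c' = monDegree m := by
  rw [← sum_colorDegree, Finset.add_sum_erase _ _ (Finset.mem_univ c)]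

/-- The labels of `∏_(c' ≠ c) tr M_c'^(m_c')`. -/
def otherLabels (m : Var d →₀ ℕ) (c : Fin d) : Multiset (Label d) :=
  (Finset.univ.erase c).val.map fun c' => (c', colorDegree m c')

lemma otherLabels_sum (m : Var d →₀ ℕ) (c : Fin d) :
    ((otherLabels m c).map Prod.snd).sum = ∑ c' ∈ Finset.univ.erase c, colorDegree m c' := by
  simp only [otherLabels, Multiset.map_map]
  rfl

/-- The expectations `e N l` of products of normalised traces satisfy the loop equations of a
Gaussian model of weight `s` perturbed by `N² ∑_a γ_a X^a ∏_c (tr M_c^(a_c) / N)`. -/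
structure IsLoopSystem (s : ℂ) (γ : (Var d →₀ ℕ) → ℕ → ℂ)
    (e : ℕ → Multiset (Label d) → MvPowerSeries (Var d) ℂ) : Prop where
  zero : ∀ N ≠ 0, e N 0 = 1
  unit : ∀ N ≠ 0, ∀ c, e N {(c, 0)} = 1
  cons : ∀ N ≠ 0, ∀ q l, e N (q ::ₘ l) = e N {q} * e N l +
    MvPowerSeries.C (1 / (N : ℂ) ^ 2) * MvPowerSeries.pderiv ℂ (Sum.inl q) (e N l)
  loop : ∀ N ≠ 0, ∀ c p, MvPowerSeries.C s * e N {(c, p + 1)} =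
    ∑ k ∈ Finset.range p, e N ((c, k) ::ₘ {(c, p - 1 - k)}) +
      monomialSum fun a => MvPowerSeries.C (γ a N * colorDegree a c) *
        e N ((c, p + colorDegree a c - 1) ::ₘ otherLabels a c)

/-- The coefficientwise large `N` limit of the expectation of a normalised trace. -/
def limitExpect (e : ℕ → Multiset (Label d) → MvPowerSeries (Var d) ℂ) (q : Label d) :
    MvPowerSeries (Var d) ℂ :=
  fun m => limUnder atTop fun N => MvPowerSeries.coeff m (e N {q})

namespace IsLoopSystem

variable {s : ℂ} {γ : (Var d →₀ ℕ) → ℕ → ℂ}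
  {e : ℕ → Multiset (Label d) → MvPowerSeries (Var d) ℂ}

/-- Large N factorisation, by induction on the number of traces. The N⁻² correction differentiates
in the source of the removed trace, which raises the degree of the monomial by exactly the degree
leaving the list, so the bound n is preserved and the correction tends to 0. -/
lemma tendsto_prod_of_le (h : IsLoopSystem s γ e) {n : ℕ}
    (hn : ∀ (q : Label d) (m : Var d →₀ ℕ), monDegree m + q.2 ≤ n →
      Tendsto (fun N => MvPowerSeries.coeff m (e N {q})) atTop
        (𝓝 (MvPowerSeries.coeff m (limitExpect e q))))
    (l : Multiset (Label d)) (m : Var d →₀ ℕ)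
    (hm : monDegree m + (l.map Prod.snd).sum ≤ n) :
    Tendsto (fun N => MvPowerSeries.coeff m (e N l)) atTop
      (𝓝 (MvPowerSeries.coeff m (l.map (limitExpect e)).prod)) := by
  induction l using Multiset.induction_on generalizing m with
  | empty =>
    rw [Multiset.map_zero, Multiset.prod_zero]
    refine tendsto_const_nhds.congr' ?_
    filter_upwards [eventually_ne_atTop 0] with N hN
    rw [h.zero N hN]
  | cons q l ih =>
    rw [Multiset.map_cons, Multiset.sum_cons] at hm
    rw [Multiset.map_cons, Multiset.prod_cons, MvPowerSeries.coeff_mul]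
    have h1 : Tendsto (fun N => ∑ x ∈ Finset.HasAntidiagonal.antidiagonal m,
        MvPowerSeries.coeff x.1 (e N {q}) * MvPowerSeries.coeff x.2 (e N l)) atTop
        (𝓝 (∑ x ∈ Finset.HasAntidiagonal.antidiagonal m,
          MvPowerSeries.coeff x.1 (limitExpect e q) *
            MvPowerSeries.coeff x.2 (l.map (limitExpect e)).prod)) := by
      refine tendsto_finsetSum _ fun x hx => ?_
      have hx' := congrArg monDegree (Finset.HasAntidiagonal.mem_antidiagonal.mp hx)
      rw [monDegree_add] at hx'
      exact (hn _ _ (by omega)).mul (ih _ (by omega))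
    have h2 : Tendsto (fun N : ℕ => 1 / (N : ℂ) ^ 2 *
        (MvPowerSeries.coeff (m + Finsupp.single (Sum.inl q) 1) (e N l) *
          ((m (Sum.inl q) : ℂ) + 1))) atTop (𝓝 0) := by
      have h3 : Tendsto (fun N : ℕ => 1 / (N : ℂ) ^ 2) atTop (𝓝 0) := by
        have := (tendsto_inv_atTop_nhds_zero_nat (𝕜 := ℂ)).pow 2
        simpa [one_div] using this
      have h4 := (ih (m + Finsupp.single (Sum.inl q) 1)
        (by rw [monDegree_add, monDegree_single_inl]; omega)).mul_const ((m (Sum.inl q) : ℂ) + 1)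
      simpa using h3.mul h4
    have h5 := h1.add h2
    rw [add_zero] at h5
    refine h5.congr' ?_
    filter_upwards [eventually_ne_atTop 0] with N hN
    rw [h.cons N hN, map_add, MvPowerSeries.coeff_mul, MvPowerSeries.coeff_C_mul,
      MvPowerSeries.coeff_pderiv]

/-- The degree removed from m together with a reappears in the traces, minus the one power lost when
M^p is merged with the trace of colour c. The total therefore stays below that of the label (c, p +
1) on the left of the loop equation. -/
lemma degree_le {m : Var d →₀ ℕ} {c : Fin d} {p n : ℕ} {x : (Var d →₀ ℕ) × (Var d →₀ ℕ)}
    (hx : x ∈ Finset.HasAntidiagonal.antidiagonal m) (hm : monDegree m + p ≤ n)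
    (_h0 : colorDegree x.1 c ≠ 0) :
    monDegree x.2 + (((c, p + colorDegree x.1 c - 1) ::ₘ otherLabels x.1 c).map Prod.snd).sum
      ≤ n := by
  rw [Multiset.map_cons, Multiset.sum_cons, otherLabels_sum]
  have h1 := colorDegree_add_sum_erase x.1 c
  have hx' := congrArg monDegree (Finset.HasAntidiagonal.mem_antidiagonal.mp hx)
  rw [monDegree_add] at hx'
  dsimp only
  omega

/-- Passing to the limit in the right-hand side of a loop equation. -/
lemma tendsto_loop (h : IsLoopSystem s γ e) {γ' : (Var d →₀ ℕ) → ℂ}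
    (hγ : ∀ a, Tendsto (γ a) atTop (𝓝 (γ' a))) {n : ℕ}
    (hn : ∀ (q : Label d) (m : Var d →₀ ℕ), monDegree m + q.2 ≤ n →
      Tendsto (fun N => MvPowerSeries.coeff m (e N {q})) atTop
        (𝓝 (MvPowerSeries.coeff m (limitExpect e q))))
    (c : Fin d) (p : ℕ) (m : Var d →₀ ℕ) (hm : monDegree m + p ≤ n) :
    Tendsto (fun N => s * MvPowerSeries.coeff m (e N {(c, p + 1)})) atTop
      (𝓝 (MvPowerSeries.coeff m
        (∑ k ∈ Finset.range p, limitExpect e (c, k) * limitExpect e (c, p - 1 - k) +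
        monomialSum fun a => MvPowerSeries.C (γ' a * colorDegree a c) *
          (limitExpect e (c, p + colorDegree a c - 1) *
            ((otherLabels a c).map (limitExpect e)).prod)))) := by
  have h1 : Tendsto (fun N => ∑ k ∈ Finset.range p,
      MvPowerSeries.coeff m (e N ((c, k) ::ₘ {(c, p - 1 - k)}))) atTop
      (𝓝 (∑ k ∈ Finset.range p,
        MvPowerSeries.coeff m (limitExpect e (c, k) * limitExpect e (c, p - 1 - k)))) := by
    refine tendsto_finsetSum _ fun k hk => ?_
    have hk := Finset.mem_range.mp hk
    simpa using h.tendsto_prod_of_le hn ((c, k) ::ₘ {(c, p - 1 - k)}) m (by simp; omega)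
  have h2 : Tendsto (fun N => ∑ x ∈ Finset.HasAntidiagonal.antidiagonal m,
      γ x.1 N * colorDegree x.1 c * MvPowerSeries.coeff x.2
        (e N ((c, p + colorDegree x.1 c - 1) ::ₘ otherLabels x.1 c))) atTop
      (𝓝 (∑ x ∈ Finset.HasAntidiagonal.antidiagonal m,
        γ' x.1 * colorDegree x.1 c * MvPowerSeries.coeff x.2
        (limitExpect e (c, p + colorDegree x.1 c - 1) *
            ((otherLabels x.1 c).map (limitExpect e)).prod))) := by
    refine tendsto_finsetSum _ fun x hx => ?_
    -- Monomials without colour c do not contribute, so the truncated exponent never matters.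
    by_cases h0 : colorDegree x.1 c = 0
    · simp [h0]
    · have := h.tendsto_prod_of_le hn _ x.2 (degree_le hx hm h0)
      rw [Multiset.map_cons, Multiset.prod_cons] at this
      exact ((hγ x.1).mul_const _).mul this
  have h3 := h1.add h2
  rw [map_add, map_sum, coeff_monomialSum]
  simp only [MvPowerSeries.coeff_C_mul]
  refine h3.congr' ?_
  filter_upwards [eventually_ne_atTop 0] with N hN
  have h4 := congrArg (MvPowerSeries.coeff m) (h.loop N hN c p)
  rw [MvPowerSeries.coeff_C_mul, map_add, map_sum, coeff_monomialSum] at h4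
  simp only [MvPowerSeries.coeff_C_mul] at h4
  exact h4.symm

/-- All coefficients of the expectations of normalised traces converge. -/
theorem tendsto_single (h : IsLoopSystem s γ e) {γ' : (Var d →₀ ℕ) → ℂ}
    (hγ : ∀ a, Tendsto (γ a) atTop (𝓝 (γ' a))) (hs : s ≠ 0) (q : Label d) (m : Var d →₀ ℕ) :
    Tendsto (fun N => MvPowerSeries.coeff m (e N {q})) atTop
      (𝓝 (MvPowerSeries.coeff m (limitExpect e q))) := by
  -- Induction on the total degree of monomial and trace: the right side of the loop equation for p
  -- + 1 has degree at most `monDegree m + p`. The existence shown here is what turns the `limUnder`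
  -- in `limitExpect` into an actual limit.
  suffices ∀ n, ∀ (q : Label d) (m : Var d →₀ ℕ), monDegree m + q.2 ≤ n →
      Tendsto (fun N => MvPowerSeries.coeff m (e N {q})) atTop
        (𝓝 (MvPowerSeries.coeff m (limitExpect e q))) from this _ q m le_rfl
  intro n
  induction n with
  | zero =>
    rintro ⟨c, p⟩ m hm
    obtain rfl : p = 0 := by dsimp only at hm; omega
    refine tendsto_nhds_limUnder ⟨MvPowerSeries.coeff m 1, tendsto_const_nhds.congr' ?_⟩
    filter_upwards [eventually_ne_atTop 0] with N hN
    rw [h.unit N hN]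
  | succ n ih =>
    rintro ⟨c, p⟩ m hm
    rcases p with _ | p
    · refine tendsto_nhds_limUnder ⟨MvPowerSeries.coeff m 1, tendsto_const_nhds.congr' ?_⟩
      filter_upwards [eventually_ne_atTop 0] with N hN
      rw [h.unit N hN]
    · refine tendsto_nhds_limUnder ⟨_, ((h.tendsto_loop hγ ih c p m
        (by dsimp only at hm; omega)).const_mul s⁻¹).congr fun N => ?_⟩
      rw [inv_mul_cancel_left₀ hs]

theorem limit_unit (h : IsLoopSystem s γ e) (c : Fin d) : limitExpect e (c, 0) = 1 := by
  ext m
  refine Tendsto.limUnder_eq (tendsto_const_nhds.congr' ?_)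
  filter_upwards [eventually_ne_atTop 0] with N hN
  rw [h.unit N hN]

/-- The loop equations in the large `N` limit. -/
theorem limit_loop (h : IsLoopSystem s γ e) {γ' : (Var d →₀ ℕ) → ℂ}
    (hγ : ∀ a, Tendsto (γ a) atTop (𝓝 (γ' a))) (hs : s ≠ 0) (c : Fin d) (p : ℕ) :
    MvPowerSeries.C s * limitExpect e (c, p + 1) =
      ∑ k ∈ Finset.range p, limitExpect e (c, k) * limitExpect e (c, p - 1 - k) +
        monomialSum fun a => MvPowerSeries.C (γ' a * colorDegree a c) *
          (limitExpect e (c, p + colorDegree a c - 1) *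
            ((otherLabels a c).map (limitExpect e)).prod) := by
  ext m
  rw [MvPowerSeries.coeff_C_mul]
  exact tendsto_nhds_unique ((h.tendsto_single hγ hs (c, p + 1) m).const_mul s)
    (h.tendsto_loop hγ (fun q m _ => h.tendsto_single hγ hs q m) c p m le_rfl)

end IsLoopSystem

/-! ### The normalised expectation of the model with sources -/

section Model

variable {d N : ℕ}

/-- The embedding of the couplings into the formal variables. -/
def couplingVar (d : ℕ) : Fin d ↪ Var d := ⟨Sum.inr, Sum.inr_injective⟩

/-- The couplings of the model with sources: `1` for a source, `g` for the monomials in the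
couplings `α_c`. -/
def sourceCoupling (g : (Fin d →₀ ℕ) → ℕ → ℂ) (m : Var d →₀ ℕ) (N : ℕ) : ℂ :=
  let m₁ := m.comapDomain Sum.inl Sum.inl_injective.injOn
  let m₂ := m.comapDomain Sum.inr Sum.inr_injective.injOn
  if m₁ = 0 then g m₂ N else if m₂ = 0 ∧ m₁.degree = 1 then 1 else 0

/-- The normalised trace `tr M_c^p / N`. -/
def normTr (N : ℕ) (q : Label d) : MvPolynomial (Coord d N) ℂ := (N : ℂ)⁻¹ • trPow N q.1 q.2

/-- The exponent of the model with sources. -/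
def sourceAction (N : ℕ) (g : (Fin d →₀ ℕ) → ℕ → ℂ) :
    MvPowerSeries (Var d) (MvPolynomial (Coord d N) ℂ) :=
  fun m => ((N : ℂ) ^ 2 * sourceCoupling g m N) • ∏ c, normTr N (c, colorDegree m c)

lemma coeff_sourceAction (g : (Fin d →₀ ℕ) → ℕ → ℂ) (m : Var d →₀ ℕ) :
    MvPowerSeries.coeff m (sourceAction N g) =
      ((N : ℂ) ^ 2 * sourceCoupling g m N) • ∏ c, normTr N (c, colorDegree m c) := rfl

lemma normTr_zero (hN : N ≠ 0) (c : Fin d) : normTr N (c, 0) = 1 := by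
  have hN' : (N : ℂ) ≠ 0 := by exact_mod_cast hN
  rw [normTr, trPow_zero, ← map_natCast (algebraMap ℂ (MvPolynomial (Coord d N) ℂ)),
    Algebra.algebraMap_eq_smul_one, smul_smul, inv_mul_cancel₀ hN', one_smul]

lemma trPow_eq (hN : N ≠ 0) (c : Fin d) (p : ℕ) : trPow N c p = (N : ℂ) • normTr N (c, p) := by
  have hN' : (N : ℂ) ≠ 0 := by exact_mod_cast hN
  rw [normTr, smul_smul, mul_inv_cancel₀ hN', one_smul]

lemma constantCoeff_sourceAction {g : (Fin d →₀ ℕ) → ℕ → ℂ} (hg : ∀ N, g 0 N = 0) :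
    MvPowerSeries.constantCoeff (sourceAction N g) = 0 := by
  rw [← MvPowerSeries.coeff_zero_eq_constantCoeff_apply, coeff_sourceAction]
  simp [sourceCoupling, hg]

lemma comapDomain_inl_add_single (m : Var d →₀ ℕ) (q : Label d) :
    (m + Finsupp.single (Sum.inl q) 1).comapDomain Sum.inl Sum.inl_injective.injOn =
      m.comapDomain Sum.inl Sum.inl_injective.injOn + Finsupp.single q 1 := by
  ext q'
  simp [Finsupp.single_apply]

lemma comapDomain_inr_add_single (m : Var d →₀ ℕ) (q : Label d) :
    (m + Finsupp.single (Sum.inl q) 1).comapDomain Sum.inr Sum.inr_injective.injOn =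
      m.comapDomain Sum.inr Sum.inr_injective.injOn := by
  ext q'
  simp

lemma eq_zero_of_comapDomain {m : Var d →₀ ℕ}
    (h1 : m.comapDomain Sum.inl Sum.inl_injective.injOn = 0)
    (h2 : m.comapDomain Sum.inr Sum.inr_injective.injOn = 0) : m = 0 := by
  ext v
  rcases v with q | c
  · exact DFunLike.congr_fun h1 q
  · exact DFunLike.congr_fun h2 c

/-- A source occurs only as a linear monomial by itself, never multiplied by another source or by a
coupling. -/
lemma sourceCoupling_add_single (g : (Fin d →₀ ℕ) → ℕ → ℂ) (m : Var d →₀ ℕ) (q : Label d) :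
    sourceCoupling g (m + Finsupp.single (Sum.inl q) 1) N = if m = 0 then 1 else 0 := by
  have h1 : m.comapDomain Sum.inl Sum.inl_injective.injOn + Finsupp.single q 1 ≠ 0 := by
    intro h
    have := DFunLike.congr_fun h q
    simp at this
  simp only [sourceCoupling, comapDomain_inl_add_single, comapDomain_inr_add_single, if_neg h1,
    map_add, Finsupp.degree_single]
  refine if_congr ⟨fun h => eq_zero_of_comapDomain ?_ h.1, ?_⟩ rfl rfl
  · rw [← Finsupp.degree_eq_zero_iff]; omega
  · rintro rfl
    constructor
    · ext; simp
    · rw [show (0 : Var d →₀ ℕ).comapDomain Sum.inl Sum.inl_injective.injOn = 0 by ext; simp]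
      simp

lemma colorDegree_single_inl (q : Label d) (c : Fin d) :
    colorDegree (Finsupp.single (Sum.inl q) 1) c = if q.1 = c then q.2 else 0 := by
  simp [colorDegree, Finsupp.weight_apply, varColorDegree]

lemma prod_normTr_single (hN : N ≠ 0) (q : Label d) :
    ∏ c, normTr N (c, colorDegree (Finsupp.single (Sum.inl q) 1) c) = normTr N q := by
  rw [← Finset.mul_prod_erase _ _ (Finset.mem_univ q.1), Finset.prod_eq_one, mul_one,
    colorDegree_single_inl, if_pos rfl]
  intro c hc
  rw [colorDegree_single_inl, if_neg (Finset.ne_of_mem_erase hc).symm, normTr_zero hN]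

/-- Linearity in the sources makes this derivative constant, so a source derivative of the integrand
just inserts the trace, with a factor N². -/
lemma pderiv_sourceAction (hN : N ≠ 0) (g : (Fin d →₀ ℕ) → ℕ → ℂ) (q : Label d) :
    MvPowerSeries.pderiv _ (Sum.inl q) (sourceAction N g) =
      MvPowerSeries.C ((N : ℂ) ^ 2 • normTr N q) := by
  ext1 m
  rw [MvPowerSeries.coeff_pderiv, coeff_sourceAction, sourceCoupling_add_single,
    MvPowerSeries.coeff_C]
  split_ifs with h
  · subst h
    rw [zero_add, prod_normTr_single hN]
    simp
  · simp

lemma derivation_prod_eq_zero {A ι : Type*} [CommRing A] [Algebra ℂ A] (D : Derivation ℂ A A)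
    (t : Finset ι) {f : ι → A} (h : ∀ i ∈ t, D (f i) = 0) : D (∏ i ∈ t, f i) = 0 := by
  classical
  induction t using Finset.induction_on with
  | empty => simp
  | insert i t hi ih =>
    rw [Finset.prod_insert hi, Derivation.leibniz, h i (Finset.mem_insert_self _ _),
      ih fun j hj => h j (Finset.mem_insert_of_mem hj)]
    simp

/-- Only the trace of colour c is moved by the derivation; the other colours are carried along as
`otherLabels`. -/
lemma loopDer_coeff_sourceAction (g : (Fin d →₀ ℕ) → ℕ → ℂ) (c : Fin d) (p : ℕ)
    (m : Var d →₀ ℕ) :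
    loopDer c p (MvPowerSeries.coeff m (sourceAction N g)) =
      ((N : ℂ) ^ 2 * (sourceCoupling g m N * colorDegree m c)) •
        (((c, p + colorDegree m c - 1) ::ₘ otherLabels m c).map (normTr N)).prod := by
  rw [coeff_sourceAction, Derivation.map_smul, ← Finset.mul_prod_erase _ _ (Finset.mem_univ c),
    Derivation.leibniz, derivation_prod_eq_zero, smul_zero, zero_add, Multiset.map_cons,
    Multiset.prod_cons, otherLabels, Multiset.map_map, smul_eq_mul]
  · rw [normTr, Derivation.map_smul, loopDer_trPow, ← mul_assoc ((N : ℂ) ^ 2),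
      mul_smul _ (colorDegree m c : ℂ)]
    congr 1
    rw [mul_comm, smul_comm, normTr, ← Nat.cast_smul_eq_nsmul ℂ, smul_mul_assoc]
    rfl
  · intro c' hc'
    rw [normTr, Derivation.map_smul, loopDer_trPow_of_ne (Finset.ne_of_mem_erase hc').symm,
      smul_zero]

/-- The integrand of the model with sources. -/
def sourceExp (N : ℕ) (g : (Fin d →₀ ℕ) → ℕ → ℂ) :
    MvPowerSeries (Var d) (MvPolynomial (Coord d N) ℂ) := expSeries (sourceAction N g)

/-- The unnormalised expectation of a polynomial in the model with sources. -/
def sourceIntegral (s : ℂ) (g : (Fin d →₀ ℕ) → ℕ → ℂ) (F : MvPolynomial (Coord d N) ℂ) :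
    MvPowerSeries (Var d) ℂ :=
  mapLin (gaussianFunctional d N s) (MvPowerSeries.C F * sourceExp N g)

/-- The expectation of a polynomial in the model with sources. -/
def sourceExpect (s : ℂ) (g : (Fin d →₀ ℕ) → ℕ → ℂ) (F : MvPolynomial (Coord d N) ℂ) :
    MvPowerSeries (Var d) ℂ :=
  sourceIntegral s g F * (sourceIntegral s g (1 : MvPolynomial (Coord d N) ℂ))⁻¹

variable {s : ℂ} {g : (Fin d →₀ ℕ) → ℕ → ℂ}

lemma constantCoeff_sourceIntegral (F : MvPolynomial (Coord d N) ℂ) :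
    MvPowerSeries.constantCoeff (sourceIntegral s g F) = gaussianFunctional d N s F := by
  rw [sourceIntegral, ← MvPowerSeries.coeff_zero_eq_constantCoeff_apply, coeff_mapLin,
    MvPowerSeries.coeff_C_mul, MvPowerSeries.coeff_zero_eq_constantCoeff_apply, sourceExp,
    constantCoeff_expSeries, mul_one]

lemma constantCoeff_sourceIntegral_one (hs : 0 < s.re) (hN : N ≠ 0) :
    MvPowerSeries.constantCoeff
      (sourceIntegral s g (1 : MvPolynomial (Coord d N) ℂ)) ≠ 0 := by
  rw [constantCoeff_sourceIntegral, gaussianFunctional_one hs hN]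
  exact one_ne_zero

lemma sourceExpect_mul (hs : 0 < s.re) (hN : N ≠ 0) (F : MvPolynomial (Coord d N) ℂ) :
    sourceExpect s g F * sourceIntegral s g (1 : MvPolynomial (Coord d N) ℂ) =
      sourceIntegral s g F := by
  rw [sourceExpect, mul_assoc, MvPowerSeries.inv_mul_cancel _
    (constantCoeff_sourceIntegral_one hs hN), mul_one]

lemma constantCoeff_sourceExpect (hs : 0 < s.re) (hN : N ≠ 0) (F : MvPolynomial (Coord d N) ℂ) :
    MvPowerSeries.constantCoeff (sourceExpect s g F) = gaussianFunctional d N s F := by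
  rw [sourceExpect, map_mul, MvPowerSeries.constantCoeff_inv, constantCoeff_sourceIntegral,
    constantCoeff_sourceIntegral, gaussianFunctional_one hs hN, inv_one, mul_one]

lemma sourceExpect_one (hs : 0 < s.re) (hN : N ≠ 0) :
    sourceExpect s g (1 : MvPolynomial (Coord d N) ℂ) = 1 :=
  MvPowerSeries.mul_inv_cancel _ (constantCoeff_sourceIntegral_one hs hN)

lemma sourceExpect_smul (c : ℂ) (F : MvPolynomial (Coord d N) ℂ) :
    sourceExpect s g (c • F) = MvPowerSeries.C c * sourceExpect s g F := by
  rw [sourceExpect, sourceIntegral, mapLin_C_smul_mul, mul_assoc]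
  rfl

lemma pderiv_mapLin_C_mul {τ A : Type*} [DecidableEq τ] [CommRing A] [Algebra ℂ A]
    (l : A →ₗ[ℂ] ℂ) {X : MvPowerSeries τ A} {q : τ} {t : A}
    (h : MvPowerSeries.pderiv A q X = X * MvPowerSeries.C t) (F : A) :
    MvPowerSeries.pderiv ℂ q (mapLin l (MvPowerSeries.C F * X)) =
      mapLin l (MvPowerSeries.C (t * F) * X) := by
  rw [← mapLin_pderiv, Derivation.leibniz, h, MvPowerSeries.pderiv_C, smul_zero, add_zero,
    smul_eq_mul, map_mul]
  congr 1
  ring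

lemma pderiv_sourceIntegral (hN : N ≠ 0) (hg : ∀ N, g 0 N = 0) (q : Label d)
    (F : MvPolynomial (Coord d N) ℂ) :
    MvPowerSeries.pderiv ℂ (Sum.inl q) (sourceIntegral s g F) =
      MvPowerSeries.C ((N : ℂ) ^ 2) * sourceIntegral s g (normTr N q * F) := by
  have h := pderiv_expSeries (Sum.inl q) (constantCoeff_sourceAction (N := N) hg)
  rw [pderiv_sourceAction hN] at h
  rw [sourceIntegral, sourceExp, pderiv_mapLin_C_mul _ h, smul_mul_assoc, mapLin_C_smul_mul]
  rfl

/-- Multiplication by a trace in terms of the derivative with respect to its source. -/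
lemma sourceExpect_normTr_mul (hs : 0 < s.re) (hN : N ≠ 0) (hg : ∀ N, g 0 N = 0) (q : Label d)
    (F : MvPolynomial (Coord d N) ℂ) :
    sourceExpect s g (normTr N q * F) =
      sourceExpect s g (normTr N q) * sourceExpect s g F +
        MvPowerSeries.C (1 / (N : ℂ) ^ 2) *
          MvPowerSeries.pderiv ℂ (Sum.inl q) (sourceExpect s g F) := by
  have hN' : (N : ℂ) ≠ 0 := by exact_mod_cast hN
  have hC : MvPowerSeries.C (σ := Var d) (1 / (N : ℂ) ^ 2) * MvPowerSeries.C ((N : ℂ) ^ 2) = 1 := by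
    rw [← map_mul, one_div_mul_cancel (pow_ne_zero 2 hN'), map_one]
  have h0 := constantCoeff_sourceIntegral_one (d := d) (g := g) hs hN
  have hZ : sourceIntegral s g (1 : MvPolynomial (Coord d N) ℂ) ≠ 0 := by
    intro h; rw [h] at h0; simp at h0
  -- Differentiating ⟨F⟩ Z = ∫ F in the source of q gives the quotient rule without differentiating
  -- an inverse; cancelling Z ends the proof.
  have h1 := congrArg (MvPowerSeries.pderiv ℂ (Sum.inl q)) (sourceExpect_mul (g := g) hs hN F)
  rw [Derivation.leibniz, pderiv_sourceIntegral hN hg, pderiv_sourceIntegral hN hg, mul_one,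
    ← sourceExpect_mul hs hN, ← sourceExpect_mul hs hN (normTr N q * F), smul_eq_mul,
    smul_eq_mul] at h1
  apply mul_right_cancel₀ hZ
  set Z := sourceIntegral s g (1 : MvPolynomial (Coord d N) ℂ)
  linear_combination (-MvPowerSeries.C (σ := Var d) (1 / (N : ℂ) ^ 2)) * h1 +
    (sourceExpect s g (normTr N q) * sourceExpect s g F * Z -
      sourceExpect s g (normTr N q * F) * Z) * hC

/-- The Gaussian loop equation is applied to every coefficient of the integrand, and D(exp V) = exp
V · D V turns the derivative term into a sum over couplings. Every term then carries N², from the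
two normalised traces or from the action, and it cancels. -/
lemma sourceIntegral_loop (hs : 0 < s.re) (hN : N ≠ 0) (hg : ∀ N, g 0 N = 0) (c : Fin d) (p : ℕ) :
    MvPowerSeries.C s * sourceIntegral s g (normTr N (c, p + 1)) =
      ∑ k ∈ Finset.range p, sourceIntegral s g (normTr N (c, k) * normTr N (c, p - 1 - k)) +
      monomialSum fun a => MvPowerSeries.C (sourceCoupling g a N * colorDegree a c) *
        sourceIntegral s g
          (((c, p + colorDegree a c - 1) ::ₘ otherLabels a c).map (normTr N)).prod := by
  have hN' : (N : ℂ) ≠ 0 := by exact_mod_cast hN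
  have h1 : mapLin (gaussianFunctional d N s)
      (MvPowerSeries.C (((N : ℂ) * s) • trPow N c (p + 1)) * sourceExp N g) =
      mapLin (gaussianFunctional d N s)
        (MvPowerSeries.C (∑ k ∈ Finset.range p, trPow N c k * trPow N c (p - 1 - k)) *
          sourceExp N g + mapDerivation (loopDer c p) (sourceExp N g)) := by
    ext m
    rw [coeff_mapLin, coeff_mapLin, MvPowerSeries.coeff_C_mul, smul_mul_assoc, map_smul,
      smul_eq_mul, gaussianFunctional_loop hs hN,
      map_add (MvPowerSeries.coeff m), MvPowerSeries.coeff_C_mul, coeff_mapDerivation]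
  rw [mapLin_add, sourceExp, mapDerivation_expSeries _ (constantCoeff_sourceAction hg),
    mul_comm (expSeries _) (mapDerivation _ _),
    mapLin_mul_eq_monomialSum _ (mapDerivation (loopDer c p) (sourceAction N g)), ← sourceExp,
    map_sum, Finset.sum_mul, mapLin_sum] at h1
  simp only [trPow_eq hN, smul_mul_smul_comm, coeff_mapDerivation, loopDer_coeff_sourceAction,
    mapLin_C_smul_mul, smul_smul] at h1
  have hC : MvPowerSeries.C (σ := Var d) ((N : ℂ) ^ 2) ≠ 0 := by
    rw [Ne, map_eq_zero_iff _ MvPowerSeries.C_injective]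
    exact pow_ne_zero 2 hN'
  apply mul_left_cancel₀ hC
  rw [mul_add, Finset.mul_sum, mul_comm (MvPowerSeries.C _) (monomialSum _), monomialSum_mul]
  calc _ = _ := by
        rw [← mul_assoc, ← map_mul, show (N : ℂ) ^ 2 * s = N * s * N by ring]; rfl
    _ = _ := h1
    _ = _ := by
        congr 1
        · refine Finset.sum_congr rfl fun k _ => ?_
          rw [sq]; rfl
        · congr 1
          funext a
          rw [map_mul, mul_comm _ (MvPowerSeries.C ((N : ℂ) ^ 2)), mul_assoc]
          rfl

/-- The expectations of products of normalised traces satisfy the loop equations. -/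
theorem isLoopSystem_sourceExpect (hs : 0 < s.re) (hg : ∀ N, g 0 N = 0) :
    IsLoopSystem s (sourceCoupling g) fun N l => sourceExpect s g (l.map (normTr N)).prod where
  zero N hN := by simpa using sourceExpect_one hs hN
  unit N hN c := by simpa [normTr_zero hN] using sourceExpect_one hs hN
  cons N hN q l := by
    simpa using sourceExpect_normTr_mul hs hN hg q (l.map (normTr N)).prod
  loop N hN c p := by
    have h := congrArg (· * (sourceIntegral s g (1 : MvPolynomial (Coord d N) ℂ))⁻¹)
      (sourceIntegral_loop hs hN hg c p)
    simp only [add_mul, monomialSum_mul, Finset.sum_mul, mul_assoc] at h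
    simpa [sourceExpect] using h

end Model

/-! ### Comparison with the matrix model and with the Gaussian unitary ensemble -/

section Comparison

variable {d N : ℕ}

/-- The couplings of the matrix model. -/
def modelCoupling (d : ℕ) (a : Fin d →₀ ℕ) (N : ℕ) : ℂ := -coupling d N a

lemma modelCoupling_zero (N : ℕ) : modelCoupling d 0 N = 0 := by
  simp [modelCoupling, coupling]

lemma colorDegree_embDomain (a : Fin d →₀ ℕ) (c : Fin d) :
    colorDegree (a.embDomain (couplingVar d)) c = a c := by
  simp only [colorDegree, Finsupp.weight_apply, Finsupp.sum_embDomain]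
  rw [Finsupp.sum_fintype _ _ (by simp)]
  simp [couplingVar, varColorDegree]

lemma sourceCoupling_embDomain (g : (Fin d →₀ ℕ) → ℕ → ℂ) (a : Fin d →₀ ℕ) :
    sourceCoupling g (a.embDomain (couplingVar d)) N = g a N := by
  have h1 : (a.embDomain (couplingVar d)).comapDomain Sum.inl Sum.inl_injective.injOn = 0 := by
    ext q
    rw [Finsupp.comapDomain_apply, Finsupp.embDomain_of_notMem_range]
    · rfl
    · simp [couplingVar]
  have h2 : (a.embDomain (couplingVar d)).comapDomain Sum.inr Sum.inr_injective.injOn = a := by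
    ext c
    rw [Finsupp.comapDomain_apply]
    exact Finsupp.embDomain_apply_self _ _ _
  simp only [sourceCoupling, h1, h2, if_true]

/-- `killCompl` sets the sources to zero. The prefactor N^(2-d) of the interaction is N² times one
normalising N⁻¹ per colour; colours with a_c = 0 count as well, since tr M^0 = N. -/
lemma map_killCompl_sourceAction (hN : N ≠ 0) (ξ : Fin d → Fin N → Fin N → ℝ) :
    MvPowerSeries.map (MvPolynomial.eval (coordPoint ξ))
      (MvPowerSeries.killCompl (couplingVar d) (sourceAction N (modelCoupling d))) =
      interaction fun c => hermitian (ξ c) := by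
  ext a
  have hN0 : (0 : ℝ) < N := by exact_mod_cast Nat.pos_of_ne_zero hN
  have hN' : (N : ℂ) ≠ 0 := by exact_mod_cast hN
  rw [MvPowerSeries.coeff_map, MvPowerSeries.coeff_killCompl, coeff_sourceAction,
    sourceCoupling_embDomain]
  change _ = -((((N : ℝ) ^ (2 - (d : ℝ)) : ℝ) : ℂ) * coupling d N a *
    ∏ c, ((hermitian (ξ c)) ^ (a c)).trace)
  have h1 : (((N : ℝ) ^ (2 - (d : ℝ)) : ℝ) : ℂ) = (N : ℂ) ^ 2 * ((N : ℂ)⁻¹) ^ d := by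
    rw [Real.rpow_sub hN0, Real.rpow_natCast, show (2 : ℝ) = ((2 : ℕ) : ℝ) by norm_num,
      Real.rpow_natCast]
    push_cast
    rw [inv_pow, div_eq_mul_inv]
  simp only [MvPolynomial.smul_eval, map_prod, colorDegree_embDomain, normTr, eval_trPow,
    Finset.prod_mul_distrib, Finset.prod_const, Finset.card_univ, Fintype.card_fin]
  rw [h1, modelCoupling]
  ring

/-- Embedding the exponents preserves the degree, so both exponentials are truncated at the same
order. -/
lemma coeff_killCompl_sourceExp (hN : N ≠ 0) (ξ : Fin d → Fin N → Fin N → ℝ) (a : Fin d →₀ ℕ) :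
    MvPolynomial.eval (coordPoint ξ) (MvPowerSeries.coeff (a.embDomain (couplingVar d))
      (sourceExp N (modelCoupling d))) =
      MvPowerSeries.coeff a (formalExp (interaction fun c => hermitian (ξ c))) := by
  have hdeg : (a.embDomain (couplingVar d)).degree = a.degree := by
    simp [Finsupp.degree_eq_sum, Finsupp.embDomain_eq_mapDomain]
  change MvPolynomial.eval _ (MvPowerSeries.coeff _ (expPartial _ _)) =
    ∑ k ∈ Finset.range (a.degree + 1), _
  rw [hdeg, expPartial, map_sum, map_sum]
  refine Finset.sum_congr rfl fun k _ => ?_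
  rw [coeff_smul', MvPolynomial.smul_eval, ← MvPowerSeries.coeff_killCompl, map_pow,
    ← MvPowerSeries.coeff_map, map_pow, map_killCompl_sourceAction hN, div_eq_inv_mul]

/-- At vanishing sources the model with sources is the matrix model. -/
lemma killCompl_sourceIntegral (hN : N ≠ 0) {O : (Fin d → Matrix (Fin N) (Fin N) ℂ) → ℂ}
    {F : MvPolynomial (Coord d N) ℂ}
    (h : ∀ ξ : Fin d → Fin N → Fin N → ℝ,
      O (fun c => hermitian (ξ c)) = MvPolynomial.eval (coordPoint ξ) F) :
    MvPowerSeries.killCompl (couplingVar d) (sourceIntegral 1 (modelCoupling d) F) =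
      formalIntegral N O := by
  ext a
  rw [MvPowerSeries.coeff_killCompl, sourceIntegral, coeff_mapLin, MvPowerSeries.coeff_C_mul]
  change _ = gaussianExpect N 1 fun M => O M * MvPowerSeries.coeff a (formalExp (interaction M))
  refine (gaussianExpect_eq (by norm_num : (0 : ℝ) < (1 : ℂ).re) hN fun ξ => ?_).symm
  rw [map_mul, h, coeff_killCompl_sourceExp hN]

lemma killCompl_sourceExpect (hN : N ≠ 0) {O : (Fin d → Matrix (Fin N) (Fin N) ℂ) → ℂ}
    {F : MvPolynomial (Coord d N) ℂ}
    (h : ∀ ξ : Fin d → Fin N → Fin N → ℝ,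
      O (fun c => hermitian (ξ c)) = MvPolynomial.eval (coordPoint ξ) F) :
    MvPowerSeries.killCompl (couplingVar d) (sourceExpect 1 (modelCoupling d) F) =
      expect N O := by
  have h1 : MvPowerSeries.killCompl (couplingVar d)
      (sourceIntegral 1 (modelCoupling d) (1 : MvPolynomial (Coord d N) ℂ)) =
      formalIntegral N fun _ : Fin d → Matrix (Fin N) (Fin N) ℂ => 1 :=
    killCompl_sourceIntegral hN (by simp)
  have h2 := constantCoeff_sourceIntegral_one (d := d) (g := modelCoupling d) (s := 1)
    (by simp) hN
  have h3 : MvPowerSeries.constantCoeff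
      (formalIntegral N fun _ : Fin d → Matrix (Fin N) (Fin N) ℂ => 1) ≠ 0 := by
    rw [← h1, ← MvPowerSeries.coeff_zero_eq_constantCoeff_apply, MvPowerSeries.coeff_killCompl,
      Finsupp.embDomain_zero, MvPowerSeries.coeff_zero_eq_constantCoeff_apply]
    exact h2
  rw [sourceExpect, map_mul, killCompl_sourceIntegral hN h, expect]
  congr 1
  rw [MvPowerSeries.eq_inv_iff_mul_eq_one h3, ← h1, ← map_mul,
    MvPowerSeries.inv_mul_cancel _ h2, map_one]

lemma moment_eq (hN : N ≠ 0) (c : Fin d) (p : ℕ) :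
    moment N c p = MvPowerSeries.C (N : ℂ) *
      MvPowerSeries.killCompl (couplingVar d)
        (sourceExpect 1 (modelCoupling d) (normTr N (c, p))) := by
  rw [moment, ← killCompl_sourceExpect hN (F := trPow N c p) fun ξ => (eval_trPow ξ c p).symm,
    trPow_eq hN, sourceExpect_smul, map_mul, MvPowerSeries.killCompl_C]

/-- Removing the normalisation of two traces gives N², which cancels the N⁻² in
`sourceExpect_normTr_mul`. The limit of a covariance is thus a limit of coefficients of a one-trace
expectation. -/
lemma covariance_eq (hN : N ≠ 0) (i j : Fin d) (p q : ℕ) :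
    covariance N i j p q = MvPowerSeries.killCompl (couplingVar d)
      (MvPowerSeries.pderiv ℂ (Sum.inl (j, q))
        (sourceExpect 1 (modelCoupling d) (normTr N (i, p)))) := by
  have hN' : (N : ℂ) ≠ 0 := by exact_mod_cast hN
  have h1 := killCompl_sourceExpect (O := fun M : Fin d → Matrix (Fin N) (Fin N) ℂ =>
    ((M i) ^ p).trace * ((M j) ^ q).trace) (F := trPow N i p * trPow N j q) hN
    fun ξ => by rw [map_mul, eval_trPow, eval_trPow]
  have hC : MvPowerSeries.C (σ := Fin d) ((N : ℂ) * N) * MvPowerSeries.C (1 / (N : ℂ) ^ 2) = 1 := by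
    rw [← map_mul, show (N : ℂ) * N * (1 / (N : ℂ) ^ 2) = 1 by field_simp, map_one]
  rw [covariance, ← h1, moment_eq hN, moment_eq hN, trPow_eq hN, trPow_eq hN, smul_mul_smul_comm,
    sourceExpect_smul, mul_comm (normTr N (i, p)), sourceExpect_normTr_mul (by simp) hN
      modelCoupling_zero]
  simp only [map_mul, map_add, MvPowerSeries.killCompl_C] at hC ⊢
  linear_combination MvPowerSeries.killCompl (couplingVar d)
      (MvPowerSeries.pderiv ℂ (Sum.inl (j, q))
        (sourceExpect 1 (modelCoupling d) (normTr N (i, p)))) * hC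

/-- The GUE is the one-colour system with g = 0; zero sources then means taking the constant term.
-/
lemma gueExpect_eq {s : ℂ} (hs : 0 < s.re) (hN : N ≠ 0) {O : Matrix (Fin N) (Fin N) ℂ → ℂ}
    {F : MvPolynomial (Coord 1 N) ℂ}
    (h : ∀ ξ : Fin 1 → Fin N → Fin N → ℝ,
      O (hermitian (ξ 0)) = MvPolynomial.eval (coordPoint ξ) F) :
    gueExpect N s O = MvPowerSeries.constantCoeff (sourceExpect s 0 F) := by
  rw [constantCoeff_sourceExpect hs hN]
  exact gaussianExpect_eq hs hN h

lemma gueExpect_trace {s : ℂ} (hs : 0 < s.re) (hN : N ≠ 0) (p : ℕ) :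
    gueExpect N s (fun M => (M ^ p).trace) =
      N * MvPowerSeries.constantCoeff (sourceExpect s 0 (normTr (d := 1) N (0, p))) := by
  rw [gueExpect_eq hs hN (F := trPow N 0 p) fun ξ => (eval_trPow ξ 0 p).symm, trPow_eq hN,
    sourceExpect_smul, map_mul, MvPowerSeries.constantCoeff_C]

lemma gueExpect_covariance {s : ℂ} (hs : 0 < s.re) (hN : N ≠ 0) (p q : ℕ) :
    gueExpect N s (fun M => (M ^ p).trace * (M ^ q).trace) -
      gueExpect N s (fun M => (M ^ p).trace) * gueExpect N s (fun M => (M ^ q).trace) =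
      MvPowerSeries.constantCoeff (MvPowerSeries.pderiv ℂ (Sum.inl (0, q))
        (sourceExpect s 0 (normTr (d := 1) N (0, p)))) := by
  have hN' : (N : ℂ) ≠ 0 := by exact_mod_cast hN
  rw [gueExpect_trace hs hN, gueExpect_trace hs hN, gueExpect_eq hs hN
    (F := trPow N 0 p * trPow N 0 q) fun ξ => by rw [map_mul, eval_trPow, eval_trPow],
    trPow_eq hN, trPow_eq hN, smul_mul_smul_comm,
    sourceExpect_smul, mul_comm (normTr N (0, p)), sourceExpect_normTr_mul hs hN (by simp)]
  simp only [map_mul, map_add, MvPowerSeries.constantCoeff_C]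
  field_simp
  ring

end Comparison

/-! ### The large `N` loop equations at vanishing sources -/

section MonomialSum

variable {τ R : Type*} [DecidableEq τ] [CommRing R]

/-- Pairs whose first exponent lacks q have weight zero; on the others one unit of q can be removed
bijectively. -/
lemma sum_antidiagonal_add_single {M : Type*} [AddCommMonoid M] (m : τ →₀ ℕ) (q : τ)
    (f : (τ →₀ ℕ) → (τ →₀ ℕ) → M) :
    ∑ x ∈ Finset.HasAntidiagonal.antidiagonal (m + Finsupp.single q 1 : τ →₀ ℕ), x.1 q • f x.1 x.2 =
      ∑ x ∈ Finset.HasAntidiagonal.antidiagonal m,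
        (x.1 q + 1) • f (x.1 + Finsupp.single q 1) x.2 := by
  symm
  refine Finset.sum_bij_ne_zero (fun x _ _ => (x.1 + Finsupp.single q 1, x.2)) ?_ ?_ ?_ ?_
  · intro x hx _
    rw [Finset.HasAntidiagonal.mem_antidiagonal] at hx ⊢
    rw [← hx]
    exact add_right_comm _ _ _
  · intro x _ _ y _ _ h
    rw [Prod.mk.injEq, add_left_inj] at h
    exact Prod.ext h.1 h.2
  · rintro ⟨x₁, x₂⟩ hx h0
    have hq : x₁ q ≠ 0 := fun h => h0 (by simp [h])
    have hle : Finsupp.single q 1 ≤ x₁ := by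
      rw [Finsupp.single_le_iff]; exact Nat.one_le_iff_ne_zero.mpr hq
    have hx1 : x₁ - Finsupp.single q 1 + Finsupp.single q 1 = x₁ := tsub_add_cancel_of_le hle
    have hq1 : (x₁ - Finsupp.single q 1 : τ →₀ ℕ) q + 1 = x₁ q := by
      simp; omega
    refine ⟨(x₁ - Finsupp.single q 1, x₂), ?_, ?_, ?_⟩
    · rw [Finset.HasAntidiagonal.mem_antidiagonal] at hx ⊢
      apply add_right_cancel (b := Finsupp.single q 1)
      rw [← hx, add_right_comm, hx1]
    · simpa only [hx1, hq1] using h0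
    · simp only [hx1]
  · intro x _ _
    simp

/-- The Leibniz rule for ∑ X^a g_a: differentiate g_a, or differentiate X^a and shift the index. -/
lemma pderiv_monomialSum (g : (τ →₀ ℕ) → MvPowerSeries τ R) (q : τ) :
    MvPowerSeries.pderiv R q (monomialSum g) =
      (monomialSum fun a => MvPowerSeries.pderiv R q (g a)) +
        monomialSum fun a => (a q + 1) • g (a + Finsupp.single q 1) := by
  ext m
  rw [MvPowerSeries.coeff_pderiv, map_add, coeff_monomialSum, coeff_monomialSum,
    coeff_monomialSum]
  simp only [map_nsmul]
  have h1 := sum_antidiagonal_add_single m q fun a b => MvPowerSeries.coeff b (g a)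
  have h2 := sum_antidiagonal_add_single m q fun a b => MvPowerSeries.coeff a (g b)
  have h3 := Finsupp.sum_antidiagonal_swap (m + Finsupp.single q 1)
    fun a b => a q • MvPowerSeries.coeff b (g a)
  have h4 := Finsupp.sum_antidiagonal_swap m
    fun a b => MvPowerSeries.coeff a (MvPowerSeries.pderiv R q (g b))
  rw [← h1, ← h4, h3, Finset.sum_mul]
  simp only [MvPowerSeries.coeff_pderiv]
  have h5 : ∑ x ∈ Finset.HasAntidiagonal.antidiagonal m,
      MvPowerSeries.coeff (x.1 + Finsupp.single q 1) (g x.2) * ((x.1 q : R) + 1) =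
      ∑ x ∈ Finset.HasAntidiagonal.antidiagonal m,
        (x.1 q + 1) • MvPowerSeries.coeff (x.1 + Finsupp.single q 1) (g x.2) := by
    refine Finset.sum_congr rfl fun x _ => ?_
    rw [nsmul_eq_mul, mul_comm]; push_cast; rfl
  have h8 := Finsupp.sum_antidiagonal_swap (m + Finsupp.single q 1)
    fun a b => MvPowerSeries.coeff b (g a) * ((m q : R) + 1)
  rw [h5, ← h2, h8, ← Finset.sum_add_distrib]
  refine Finset.sum_congr rfl fun x hx => ?_
  have hx' := DFunLike.congr_fun (Finset.HasAntidiagonal.mem_antidiagonal.mp hx) q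
  simp only [Finsupp.add_apply, Finsupp.single_eq_same] at hx'
  -- The multiplicity m_q + 1 produced by the derivative is the sum of the exponents of q in the two
  -- parts.
  rw [← add_smul, hx', nsmul_eq_mul, mul_comm]; push_cast; rfl

/-- Every decomposition of an embedded exponent is a sum of embedded exponents, so no other
monomials intervene. -/
lemma killCompl_monomialSum {σ : Type*} [DecidableEq σ] (i : σ ↪ τ)
    (g : (τ →₀ ℕ) → MvPowerSeries τ R) :
    MvPowerSeries.killCompl i (monomialSum g) =
      monomialSum fun a => MvPowerSeries.killCompl i (g (a.embDomain i)) := by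
  ext m
  rw [MvPowerSeries.coeff_killCompl, coeff_monomialSum, coeff_monomialSum,
    ← Finsupp.image_prodMap_embDomain_antidiagonal, Finset.sum_image]
  · rfl
  · exact (Prod.map_injective.mpr ⟨Finsupp.embDomain_injective i,
      Finsupp.embDomain_injective i⟩).injOn

lemma monomialSum_eq_sum {ι : Type*} [Fintype ι] {f : ι → τ →₀ ℕ} (hf : Function.Injective f)
    {g : (τ →₀ ℕ) → MvPowerSeries τ R} (hg : ∀ a, a ∉ Set.range f → g a = 0) :
    monomialSum g = ∑ i, MvPowerSeries.monomial (f i) 1 * g (f i) := by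
  classical
  ext m
  simp only [coeff_monomialSum, map_sum, MvPowerSeries.coeff_mul, MvPowerSeries.coeff_monomial]
  rw [Finset.sum_comm]
  refine Finset.sum_congr rfl fun x _ => ?_
  by_cases hx : x.1 ∈ Set.range f
  · obtain ⟨i, hi⟩ := hx
    rw [Finset.sum_eq_single i]
    · simp [hi]
    · intro j _ hj
      rw [if_neg, zero_mul]
      rw [← hi]
      exact fun h => hj (hf h).symm
    · simp
  · rw [hg _ hx, map_zero, Finset.sum_eq_zero]
    intro i _
    rw [if_neg, zero_mul]
    exact fun h => hx ⟨i, h.symm⟩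

end MonomialSum

/-! ### Limiting equations for moments and covariances. -/

section LimitEquations

variable {d : ℕ}

/-- The limiting coupling does not depend on N; the final argument 0 is a dummy value of N. -/
lemma tendsto_sourceCoupling {g : (Fin d →₀ ℕ) → ℕ → ℂ} {g' : (Fin d →₀ ℕ) → ℂ}
    (hg : ∀ a, Tendsto (g a) atTop (𝓝 (g' a))) (m : Var d →₀ ℕ) :
    Tendsto (sourceCoupling g m) atTop (𝓝 (sourceCoupling (fun a _ => g' a) m 0)) := by
  unfold sourceCoupling
  dsimp only
  split_ifs
  · exact hg _
  · exact tendsto_const_nhds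
  · exact tendsto_const_nhds

/-- The large `N` limit of `⟨tr M_c^p⟩ / N`. -/
def limitMoment (e : ℕ → Multiset (Label d) → MvPowerSeries (Var d) ℂ) (c : Fin d) (p : ℕ) :
    MvPowerSeries (Fin d) ℂ :=
  MvPowerSeries.killCompl (couplingVar d) (limitExpect e (c, p))

/-- The large `N` limit of the covariance of `tr M_c^p` with the trace labelled by `q`. -/
def limitCov (e : ℕ → Multiset (Label d) → MvPowerSeries (Var d) ℂ) (q : Label d) (c : Fin d)
    (p : ℕ) : MvPowerSeries (Fin d) ℂ :=
  MvPowerSeries.killCompl (couplingVar d)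
    (MvPowerSeries.pderiv ℂ (Sum.inl q) (limitExpect e (c, p)))

/-- The limit of the contribution of the monomial `a` to the loop equation. -/
def loopTerm (e : ℕ → Multiset (Label d) → MvPowerSeries (Var d) ℂ) (c : Fin d) (p : ℕ)
    (a : Fin d →₀ ℕ) : MvPowerSeries (Var d) ℂ :=
  limitExpect e (c, p + a c - 1) * ∏ c' ∈ Finset.univ.erase c, limitExpect e (c', a c')

variable {s : ℂ} {g : (Fin d →₀ ℕ) → ℕ → ℂ} {g' : (Fin d →₀ ℕ) → ℂ}
  {e : ℕ → Multiset (Label d) → MvPowerSeries (Var d) ℂ}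

lemma loopTerm_eq (c : Fin d) (p : ℕ) (a : Fin d →₀ ℕ) :
    limitExpect e (c, p + colorDegree (a.embDomain (couplingVar d)) c - 1) *
      ((otherLabels (a.embDomain (couplingVar d)) c).map (limitExpect e)).prod =
      loopTerm e c p a := by
  rw [loopTerm, otherLabels, Multiset.map_map]
  simp only [colorDegree_embDomain, Function.comp_def]
  rfl

lemma limitMoment_zero (h : IsLoopSystem s (sourceCoupling g) e) (c : Fin d) :
    limitMoment e c 0 = 1 := by
  rw [limitMoment, h.limit_unit, map_one]

lemma limitCov_zero (h : IsLoopSystem s (sourceCoupling g) e) (q : Label d) (c : Fin d) :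
    limitCov e q c 0 = 0 := by
  rw [limitCov, h.limit_unit, Derivation.map_one_eq_zero, map_zero]

lemma limitMoment_loop (h : IsLoopSystem s (sourceCoupling g) e)
    (hg : ∀ a, Tendsto (g a) atTop (𝓝 (g' a))) (hs : s ≠ 0) (c : Fin d) (p : ℕ) :
    MvPowerSeries.C s * limitMoment e c (p + 1) =
      ∑ k ∈ Finset.range p, limitMoment e c k * limitMoment e c (p - 1 - k) +
      monomialSum fun a => MvPowerSeries.C (g' a * a c) *
        MvPowerSeries.killCompl (couplingVar d) (loopTerm e c p a) := by
  have h1 := congrArg (MvPowerSeries.killCompl (couplingVar d))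
    (h.limit_loop (tendsto_sourceCoupling hg) hs c p)
  rw [map_mul, MvPowerSeries.killCompl_C, map_add, map_sum, killCompl_monomialSum] at h1
  simp only [loopTerm_eq] at h1
  simpa only [map_mul (MvPowerSeries.killCompl (couplingVar d)),
    colorDegree_embDomain, sourceCoupling_embDomain, MvPowerSeries.killCompl_C] using! h1

lemma monomialSum_ite_zero {τ R : Type*} [DecidableEq τ] [CommRing R] (f : MvPowerSeries τ R) :
    (monomialSum fun a => if a = 0 then f else 0) = f := by
  ext m
  rw [coeff_monomialSum, Finset.sum_eq_single (0, m)]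
  · simp
  · rintro ⟨a, b⟩ hx hne
    rw [if_neg, map_zero]
    rintro rfl
    rw [Finset.HasAntidiagonal.mem_antidiagonal, zero_add] at hx
    exact hne (by rw [← hx])
  · simp

lemma pderiv_C_mul' {τ R : Type*} [CommRing R] (q : τ) (c : R) (f : MvPowerSeries τ R) :
    MvPowerSeries.pderiv R q (MvPowerSeries.C c * f) =
      MvPowerSeries.C c * MvPowerSeries.pderiv R q f := by
  rw [Derivation.leibniz, MvPowerSeries.pderiv_C, smul_zero, add_zero, smul_eq_mul]

lemma limitExpect_otherLabels_single (h : IsLoopSystem s (sourceCoupling g) e) (q : Label d) :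
    ((otherLabels (Finsupp.single (Sum.inl q) 1) q.1).map (limitExpect e)).prod = 1 := by
  rw [otherLabels, Multiset.map_map]
  refine Finset.prod_eq_one fun c hc => ?_
  rw [Function.comp_apply, colorDegree_single_inl, if_neg (Finset.ne_of_mem_erase hc).symm,
    h.limit_unit]

/-- The limiting loop equation is differentiated in the source of q before the sources are set to
zero. The last term comes from the linear source monomial itself. -/
lemma limitCov_loop (h : IsLoopSystem s (sourceCoupling g) e)
    (hg : ∀ a, Tendsto (g a) atTop (𝓝 (g' a))) (hs : s ≠ 0) (q : Label d) (c : Fin d) (p : ℕ) :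
    MvPowerSeries.C s * limitCov e q c (p + 1) =
      ∑ k ∈ Finset.range p, (limitMoment e c k * limitCov e q c (p - 1 - k) +
        limitMoment e c (p - 1 - k) * limitCov e q c k) +
      (monomialSum fun a => MvPowerSeries.C (g' a * a c) *
        MvPowerSeries.killCompl (couplingVar d)
          (MvPowerSeries.pderiv ℂ (Sum.inl q) (loopTerm e c p a))) +
      if q.1 = c then (q.2 : MvPowerSeries (Fin d) ℂ) * limitMoment e c (p + q.2 - 1) else 0 := by
  have h1 := congrArg (fun f => MvPowerSeries.killCompl (couplingVar d)
    (MvPowerSeries.pderiv ℂ (Sum.inl q) f)) (h.limit_loop (tendsto_sourceCoupling hg) hs c p)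
  rw [pderiv_C_mul', map_mul, MvPowerSeries.killCompl_C, map_add, map_sum, pderiv_monomialSum,
    map_add, map_add, map_sum, killCompl_monomialSum, killCompl_monomialSum, ← add_assoc] at h1
  simp only [pderiv_C_mul', loopTerm_eq] at h1
  simp only [Derivation.leibniz _ (limitExpect e (c, _)) (limitExpect e (c, _)), smul_eq_mul,
    map_add, map_mul,
    colorDegree_embDomain, sourceCoupling_embDomain, MvPowerSeries.killCompl_C] at h1
  refine h1.trans ?_
  congr 1
  · simp only [map_mul]
    rfl
  -- The terms in which X^a was differentiated survive at zero sources only for a = 0, because a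
  -- source never multiplies another variable.
  rw [← monomialSum_ite_zero (if q.1 = c then _ else _)]
  congr 1
  funext a
  rw [sourceCoupling_add_single]
  by_cases ha : a = 0
  · subst ha
    rw [Finsupp.embDomain_zero, if_pos rfl, if_pos rfl, zero_add, colorDegree_single_inl]
    split_ifs with hc
    · subst hc
      rw [limitExpect_otherLabels_single h, mul_one, limitMoment]
      simp
    · simp
  · rw [if_neg ha, if_neg (mt Finsupp.embDomain_eq_zero.mp ha)]
    simp

end LimitEquations

/-! ### Planar moments and covariances of the Gaussian unitary ensemble -/

section Planar

variable {A : Type*} [CommRing A]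

/-- The planar moments of the Gaussian unitary ensemble with weight `1 / u`. -/
def gueMoment (u : A) : ℕ → A
  | 0 => 1
  | p + 1 => u * ∑ k : Fin p, gueMoment u k * gueMoment u (p - 1 - k)
decreasing_by all_goals omega

/-- The planar covariances of the Gaussian unitary ensemble with weight `1 / u`. -/
def gueCov (u : A) (q : ℕ) : ℕ → A
  | 0 => 0
  | p + 1 => u * (2 * ∑ k : Fin p, gueMoment u k * gueCov u q (p - 1 - k) +
      q * gueMoment u (p + q - 1))
decreasing_by all_goals omega

lemma gueMoment_zero (u : A) : gueMoment u 0 = 1 := by rw [gueMoment]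

lemma gueMoment_succ (u : A) (p : ℕ) :
    gueMoment u (p + 1) =
      u * ∑ k ∈ Finset.range p, gueMoment u k * gueMoment u (p - 1 - k) := by
  rw [gueMoment, Finset.sum_range fun k => gueMoment u k * gueMoment u (p - 1 - k)]

lemma gueCov_zero (u : A) (q : ℕ) : gueCov u q 0 = 0 := by rw [gueCov]

lemma gueCov_succ (u : A) (q p : ℕ) :
    gueCov u q (p + 1) =
      u * (2 * ∑ k ∈ Finset.range p, gueMoment u k * gueCov u q (p - 1 - k) +
        q * gueMoment u (p + q - 1)) := by
  rw [gueCov, Finset.sum_range fun k => gueMoment u k * gueCov u q (p - 1 - k)]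

lemma eq_gueMoment {u s : A} (hu : u * s = 1) {m : ℕ → A} (h0 : m 0 = 1)
    (hm : ∀ p, s * m (p + 1) = ∑ k ∈ Finset.range p, m k * m (p - 1 - k)) (p : ℕ) :
    m p = gueMoment u p := by
  induction p using Nat.strong_induction_on with
  | _ p ih =>
    rcases p with _ | p
    · rw [h0, gueMoment_zero]
    · rw [gueMoment_succ, ← one_mul (m (p + 1)), ← hu, mul_assoc, hm]
      congr 1
      refine Finset.sum_congr rfl fun k hk => ?_
      have := Finset.mem_range.mp hk
      rw [ih k (by omega), ih (p - 1 - k) (by omega)]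

/-- The derivative of the planar moments under a shift of the matrix. -/
lemma succ_mul_gueMoment (u : A) (p : ℕ) :
    (p + 1 : A) * gueMoment u p =
      2 * ∑ k ∈ Finset.range p,
        gueMoment u k * (u * ((p - 1 - k : ℕ) * gueMoment u (p - 1 - k - 1))) +
      gueMoment u p := by
  rcases p with _ | n
  · simp
  have h1 : ∑ k ∈ Finset.range (n + 1),
      gueMoment u k * (u * ((n + 1 - 1 - k : ℕ) * gueMoment u (n + 1 - 1 - k - 1))) =
      u * ∑ k ∈ Finset.range n, ((n - k : ℕ) : A) * (gueMoment u k * gueMoment u (n - 1 - k)) := by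
    rw [Finset.sum_range_succ, Finset.mul_sum]
    simp only [Nat.add_sub_cancel, Nat.sub_self, Nat.cast_zero, zero_mul, mul_zero, add_zero]
    refine Finset.sum_congr rfl fun k _ => ?_
    rw [show n - k - 1 = n - 1 - k by omega]
    ring
  have h2 : ∑ k ∈ Finset.range n, ((n - k : ℕ) : A) * (gueMoment u k * gueMoment u (n - 1 - k)) =
      ∑ k ∈ Finset.range n, ((k + 1 : ℕ) : A) * (gueMoment u k * gueMoment u (n - 1 - k)) := by
    rw [← Finset.sum_range_reflect]
    refine Finset.sum_congr rfl fun k hk => ?_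
    have := Finset.mem_range.mp hk
    rw [show n - (n - 1 - k) = k + 1 by omega, show n - 1 - (n - 1 - k) = k by omega]
    ring
  -- Averaging with the reflection of k replaces the weight n - k by ((n - k) + (k + 1))/2, a
  -- constant.
  have h3 : 2 * ∑ k ∈ Finset.range n, ((n - k : ℕ) : A) * (gueMoment u k * gueMoment u (n - 1 - k))
      = (n + 1 : A) * ∑ k ∈ Finset.range n, gueMoment u k * gueMoment u (n - 1 - k) := by
    rw [two_mul]
    nth_rewrite 2 [h2]
    rw [← Finset.sum_add_distrib, Finset.mul_sum]
    refine Finset.sum_congr rfl fun k hk => ?_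
    have hk := Finset.mem_range.mp hk
    rw [← add_mul, ← Nat.cast_add, show n - k + (k + 1) = n + 1 by omega]
    push_cast; rfl
  rw [h1, mul_left_comm, h3, gueMoment_succ]
  push_cast
  ring

/-- The unique solution of the linearised loop equations. -/
lemma eq_gueCov_add {u s : A} (hu : u * s = 1) {K : ℕ → A} {q : ℕ} {r θ : A} (h0 : K 0 = 0)
    (hK : ∀ p, s * K (p + 1) = 2 * ∑ k ∈ Finset.range p, gueMoment u k * K (p - 1 - k) +
      θ * gueMoment u p + r * (q * gueMoment u (p + q - 1))) (p : ℕ) :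
    K p = r * gueCov u q p + θ * (u * (p * gueMoment u (p - 1))) := by
  induction p using Nat.strong_induction_on with
  | _ p ih =>
    rcases p with _ | p
    · rw [h0, gueCov_zero]; simp
    · have h1 : ∑ k ∈ Finset.range p, gueMoment u k * K (p - 1 - k) =
          r * ∑ k ∈ Finset.range p, gueMoment u k * gueCov u q (p - 1 - k) +
          θ * ∑ k ∈ Finset.range p, gueMoment u k * (u * ((p - 1 - k : ℕ) *
            gueMoment u (p - 1 - k - 1))) := by
        rw [Finset.mul_sum, Finset.mul_sum, ← Finset.sum_add_distrib]
        refine Finset.sum_congr rfl fun k hk => ?_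
        have := Finset.mem_range.mp hk
        rw [ih (p - 1 - k) (by omega)]
        ring
      have h2 := hK p
      rw [h1] at h2
      -- This says that p ↦ u p m_(p-1) solves the linearised equation with right-hand side m_p, the
      -- response to a shift of the matrix.
      have h3 := succ_mul_gueMoment u p
      rw [gueCov_succ, Nat.add_sub_cancel]
      push_cast
      linear_combination u * h2 - u * θ * h3 - K (p + 1) * hu

end Planar

/-! ### Large N limit of the couplings of the matrix model. -/

section Model

variable {d : ℕ}

/-- The large `N` limit of the couplings of the model. -/
def planarCoupling (a : Fin d →₀ ℕ) : ℂ := if a.degree = 2 then (a.multinomial : ℂ) / 2 else 0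

/-- The exponent (d - 2)(1 - |a|/2) is zero for |a| = 2 and negative for |a| ≥ 3, as d ≥ 3. -/
lemma tendsto_modelCoupling (hd : 3 ≤ d) (a : Fin d →₀ ℕ) :
    Tendsto (modelCoupling d a) atTop (𝓝 (planarCoupling a)) := by
  have hd' : (3 : ℝ) ≤ d := by exact_mod_cast hd
  unfold planarCoupling modelCoupling coupling
  by_cases h2 : 2 ≤ a.degree
  swap
  · rw [if_neg (by omega)]
    simp [h2]
  simp only [if_pos h2, neg_neg]
  split_ifs with h
  · have h0 : ∀ N : ℕ, (N : ℝ) ^ ((d : ℝ) - 2 - ((d : ℝ) - 2) / 2 * (a.degree : ℝ)) = 1 := by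
      intro N
      rw [h, show (d : ℝ) - 2 - ((d : ℝ) - 2) / 2 * ((2 : ℕ) : ℝ) = 0 by push_cast; ring,
        Real.rpow_zero]
    simp only [h0]
    refine tendsto_const_nhds.congr fun N => ?_
    rw [h]
    push_cast
    ring
  · have h3 : (3 : ℝ) ≤ a.degree := by exact_mod_cast (by omega : 3 ≤ a.degree)
    have h4 : Tendsto (fun N : ℕ => (N : ℝ) ^ ((d : ℝ) - 2 - ((d : ℝ) - 2) / 2 * (a.degree : ℝ)))
        atTop (𝓝 0) := by
      have h5 : 0 < -((d : ℝ) - 2 - ((d : ℝ) - 2) / 2 * (a.degree : ℝ)) := by nlinarith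
      have := (tendsto_rpow_neg_atTop h5).comp tendsto_natCast_atTop_atTop
      simpa [Function.comp_def] using this
    have h6 := ((Complex.continuous_ofReal.tendsto 0).comp h4).const_mul
      (1 / (a.degree : ℂ) * (a.multinomial : ℂ))
    simpa [Function.comp_def] using h6

/-- The exponent of `α_c α_j`. -/
def pairExponent (c j : Fin d) : Fin d →₀ ℕ := Finsupp.single c 1 + Finsupp.single j 1

lemma pairExponent_injective (c : Fin d) : Function.Injective (pairExponent c) := by
  intro i j h
  rw [pairExponent, pairExponent, add_right_inj] at h
  exact (Finsupp.single_left_inj one_ne_zero).mp h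

/-- A quadratic monomial containing α_c is α_c α_j for some j, so each loop equation keeps only d
couplings. -/
lemma planarCoupling_mul_eq_zero {c : Fin d} {a : Fin d →₀ ℕ}
    (ha : a ∉ Set.range (pairExponent c)) : planarCoupling a * a c = 0 := by
  by_contra h
  rw [mul_eq_zero, not_or] at h
  obtain ⟨h1, h2⟩ := h
  have h2 : a c ≠ 0 := by exact_mod_cast h2
  have hdeg : a.degree = 2 := by
    by_contra h3
    exact h1 (if_neg h3)
  have hle : Finsupp.single c 1 ≤ a := by
    rw [Finsupp.single_le_iff]; exact Nat.one_le_iff_ne_zero.mpr h2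
  have h4 : Finsupp.single c 1 + (a - Finsupp.single c 1) = a := add_tsub_cancel_of_le hle
  have h5 : (a - Finsupp.single c 1).degree = 1 := by
    have := congrArg Finsupp.degree h4
    rw [map_add, Finsupp.degree_single] at this
    omega
  obtain ⟨j, hj⟩ : ∃ j, (a - Finsupp.single c 1 : Fin d →₀ ℕ) j ≠ 0 := by
    by_contra! h6
    rw [show a - Finsupp.single c 1 = 0 from Finsupp.ext h6] at h5
    simp at h5
  have h7 : Finsupp.single j 1 + (a - Finsupp.single c 1 - Finsupp.single j 1) =
      a - Finsupp.single c 1 := add_tsub_cancel_of_le (by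
    rw [Finsupp.single_le_iff]; exact Nat.one_le_iff_ne_zero.mpr hj)
  have h8 : a - Finsupp.single c 1 - Finsupp.single j 1 = 0 := by
    rw [← Finsupp.degree_eq_zero_iff]
    have := congrArg Finsupp.degree h7
    rw [map_add, Finsupp.degree_single] at this
    omega
  rw [h8, add_zero] at h7
  exact ha ⟨j, by rw [pairExponent, h7, h4]⟩

/-- The product multinomial · a_c / 2 is 1 · 2 / 2 for a square and 2 · 1 / 2 for a mixed monomial.
-/
lemma planarCoupling_pairExponent (c j : Fin d) :
    planarCoupling (pairExponent c j) * pairExponent c j c = 1 := by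
  have hdeg : (pairExponent c j).degree = 2 := by simp [pairExponent]
  rw [planarCoupling, if_pos hdeg]
  by_cases h : c = j
  · subst h
    have h1 : pairExponent c c = Finsupp.single c 2 := by
      rw [pairExponent, ← Finsupp.single_add]
    rw [h1, Finsupp.multinomial_eq_of_support_subset Finsupp.support_single_subset,
      Nat.multinomial_singleton]
    simp
  · have h1 : (pairExponent c j).multinomial = 2 := by
      have hs : (pairExponent c j).support ⊆ {c, j} := by
        intro x hx
        by_contra h3
        rw [Finset.mem_insert, Finset.mem_singleton, not_or] at h3
        simp [pairExponent, Ne.symm h3.1, Ne.symm h3.2] at hx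
      rw [Finsupp.multinomial_eq_of_support_subset hs, Nat.binomial_one h]
      · simp [pairExponent, h]
      · simp [pairExponent, Ne.symm h]
    have h2 : pairExponent c j c = 1 := by
      simp [pairExponent, Ne.symm h]
    rw [h1, h2]
    norm_num

end Model

/-! ### Solution of the planar loop equations of the model -/

section ModelSolution

variable {d : ℕ}

lemma monomialSum_planarCoupling (c : Fin d) (Z : (Fin d →₀ ℕ) → MvPowerSeries (Fin d) ℂ) :
    (monomialSum fun a => MvPowerSeries.C (planarCoupling a * a c) * Z a) =
      MvPowerSeries.X c ^ 2 * Z (pairExponent c c) +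
        MvPowerSeries.X c * ∑ j ∈ Finset.univ.erase c,
          MvPowerSeries.X j * Z (pairExponent c j) := by
  rw [monomialSum_eq_sum (pairExponent_injective c)]
  · have h : ∀ j, MvPowerSeries.monomial (pairExponent c j) (1 : ℂ) *
        (MvPowerSeries.C (planarCoupling (pairExponent c j) * pairExponent c j c) *
          Z (pairExponent c j)) =
        MvPowerSeries.X c * (MvPowerSeries.X j * Z (pairExponent c j)) := by
      intro j
      have h1 : (MvPowerSeries.C 1 : MvPowerSeries (Fin d) ℂ) = 1 := map_one _
      rw [planarCoupling_pairExponent, h1, one_mul, ← mul_assoc, MvPowerSeries.X, MvPowerSeries.X,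
        MvPowerSeries.monomial_mul_monomial, mul_one]
      rfl
    simp only [h]
    rw [← Finset.add_sum_erase _ _ (Finset.mem_univ c), Finset.mul_sum]
    ring
  · intro a ha
    rw [planarCoupling_mul_eq_zero ha, map_zero, zero_mul]

variable {e : ℕ → Multiset (Label d) → MvPowerSeries (Var d) ℂ} {s : ℂ}
  {g : (Fin d →₀ ℕ) → ℕ → ℂ}

lemma pairExponent_self_apply (c c' : Fin d) :
    pairExponent c c c' = if c = c' then 2 else 0 := by
  simp only [pairExponent, Finsupp.add_apply, Finsupp.single_apply]
  split_ifs <;> rfl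

/-- The square α_c² reproduces the moment on the left of the loop equation; moving it there changes
the weight 1 into 1 - α_c². -/
lemma loopTerm_pairExponent_self (h : IsLoopSystem s (sourceCoupling g) e) (c : Fin d) (p : ℕ) :
    loopTerm e c p (pairExponent c c) = limitExpect e (c, p + 1) := by
  rw [loopTerm, Finset.prod_eq_one, mul_one, pairExponent_self_apply, if_pos rfl]
  · rfl
  · intro c' hc'
    rw [pairExponent_self_apply, if_neg (Finset.ne_of_mem_erase hc').symm, h.limit_unit]

lemma loopTerm_pairExponent (h : IsLoopSystem s (sourceCoupling g) e) {c j : Fin d} (hj : j ≠ c)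
    (p : ℕ) :
    loopTerm e c p (pairExponent c j) = limitExpect e (c, p) * limitExpect e (j, 1) := by
  have h1 : pairExponent c j c = 1 := by simp [pairExponent, hj]
  have h2 : pairExponent c j j = 1 := by simp [pairExponent, hj.symm]
  rw [loopTerm, h1, Nat.add_sub_cancel, Finset.prod_eq_single j, h2]
  · intro c' hc' hne
    have h3 : pairExponent c j c' = 0 := by
      simp [pairExponent, (Finset.ne_of_mem_erase hc').symm, hne.symm]
    rw [h3, h.limit_unit]
  · intro hj'
    exact absurd (Finset.mem_erase.mpr ⟨hj, Finset.mem_univ j⟩) hj'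

/-- The power series `1 / (1 - α_c²)`. -/
def colorSeries (c : Fin d) : MvPowerSeries (Fin d) ℂ := (1 - MvPowerSeries.X c ^ 2)⁻¹

/-- The power series `1 / (1 - ∑_c α_c²)`. -/
def totalSeries (d : ℕ) : MvPowerSeries (Fin d) ℂ := (1 - ∑ c : Fin d, MvPowerSeries.X c ^ 2)⁻¹

lemma colorSeries_mul (c : Fin d) :
    colorSeries c * (1 - MvPowerSeries.X c ^ 2) = 1 :=
  MvPowerSeries.inv_mul_cancel _ (by simp)

lemma totalSeries_mul : totalSeries d * (1 - ∑ c : Fin d, MvPowerSeries.X c ^ 2) = 1 :=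
  MvPowerSeries.inv_mul_cancel _ (by simp)

lemma limitMoment_model (h : IsLoopSystem 1 (sourceCoupling g) e)
    (hg : ∀ a, Tendsto (g a) atTop (𝓝 (planarCoupling a))) (c : Fin d) (p : ℕ) :
    limitMoment e c (p + 1) =
      ∑ k ∈ Finset.range p, limitMoment e c k * limitMoment e c (p - 1 - k) +
      (MvPowerSeries.X c ^ 2 * limitMoment e c (p + 1) +
        MvPowerSeries.X c * ∑ j ∈ Finset.univ.erase c,
          MvPowerSeries.X j * (limitMoment e c p * limitMoment e j 1)) := by
  have h1 := limitMoment_loop h hg one_ne_zero c p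
  rw [monomialSum_planarCoupling, map_one, one_mul, loopTerm_pairExponent_self h] at h1
  refine h1.trans ?_
  congr 3
  refine Finset.sum_congr rfl fun j hj => ?_
  rw [loopTerm_pairExponent h (Finset.ne_of_mem_erase hj), map_mul]
  rfl

lemma limitCov_model (h : IsLoopSystem 1 (sourceCoupling g) e)
    (hg : ∀ a, Tendsto (g a) atTop (𝓝 (planarCoupling a))) (q : Label d) (c : Fin d) (p : ℕ) :
    limitCov e q c (p + 1) =
      ∑ k ∈ Finset.range p, (limitMoment e c k * limitCov e q c (p - 1 - k) +
        limitMoment e c (p - 1 - k) * limitCov e q c k) +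
      (MvPowerSeries.X c ^ 2 * limitCov e q c (p + 1) +
        MvPowerSeries.X c * ∑ j ∈ Finset.univ.erase c,
          MvPowerSeries.X j * (limitMoment e c p * limitCov e q j 1 +
            limitMoment e j 1 * limitCov e q c p)) +
      if q.1 = c then (q.2 : MvPowerSeries (Fin d) ℂ) * limitMoment e c (p + q.2 - 1) else 0 := by
  have h1 := limitCov_loop h hg one_ne_zero q c p
  rw [monomialSum_planarCoupling, map_one, one_mul, loopTerm_pairExponent_self h] at h1
  refine h1.trans ?_
  congr 4
  refine Finset.sum_congr rfl fun j hj => ?_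
  rw [loopTerm_pairExponent h (Finset.ne_of_mem_erase hj), Derivation.leibniz, smul_eq_mul,
    smul_eq_mul, map_add, map_mul, map_mul]
  rfl

/-- For p = 0 the equations read m_1(c) = α_c Y with Y = ∑ α_j m_1(j). Hence (1 - ∑ α_c²) Y = 0, and
that factor is an invertible series. -/
lemma limitMoment_one (h : IsLoopSystem 1 (sourceCoupling g) e)
    (hg : ∀ a, Tendsto (g a) atTop (𝓝 (planarCoupling a))) (c : Fin d) :
    limitMoment e c 1 = 0 := by
  set Y : MvPowerSeries (Fin d) ℂ := ∑ j, MvPowerSeries.X j * limitMoment e j 1 with hY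
  have h1 : ∀ c : Fin d, limitMoment e c 1 = MvPowerSeries.X c * Y := by
    intro c
    have h2 := limitMoment_model h hg c 0
    simp only [Finset.range_zero, Finset.sum_empty, zero_add, limitMoment_zero h, one_mul] at h2
    rw [hY, ← Finset.add_sum_erase _ _ (Finset.mem_univ c)]
    linear_combination h2
  have h2 : Y = (∑ c : Fin d, MvPowerSeries.X c ^ 2) * Y := by
    rw [Finset.sum_mul]
    conv_lhs => rw [hY]
    refine Finset.sum_congr rfl fun c _ => ?_
    rw [h1 c]; ring
  have h3 : Y = 0 := by
    linear_combination totalSeries d * h2 - Y * totalSeries_mul (d := d)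
  rw [h1, h3, mul_zero]

/-- The planar moments of the model are those of a Gaussian unitary ensemble. -/
theorem limitMoment_eq (h : IsLoopSystem 1 (sourceCoupling g) e)
    (hg : ∀ a, Tendsto (g a) atTop (𝓝 (planarCoupling a))) (c : Fin d) (p : ℕ) :
    limitMoment e c p = gueMoment (colorSeries c) p := by
  refine eq_gueMoment (colorSeries_mul c) (limitMoment_zero h c) (fun p => ?_) p
  have h1 := limitMoment_model h hg c p
  simp only [limitMoment_one h hg, mul_zero, Finset.sum_const_zero, add_zero] at h1
  linear_combination h1

lemma sum_reflect_mul {A : Type*} [CommRing A] (f K : ℕ → A) (p : ℕ) :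
    ∑ k ∈ Finset.range p, (f k * K (p - 1 - k) + f (p - 1 - k) * K k) =
      2 * ∑ k ∈ Finset.range p, f k * K (p - 1 - k) := by
  rw [Finset.sum_add_distrib, two_mul]
  congr 1
  rw [← Finset.sum_range_reflect]
  refine Finset.sum_congr rfl fun k hk => ?_
  have := Finset.mem_range.mp hk
  rw [show p - 1 - (p - 1 - k) = k by omega]

/-- The planar covariances of the model. -/
theorem limitCov_eq (h : IsLoopSystem 1 (sourceCoupling g) e)
    (hg : ∀ a, Tendsto (g a) atTop (𝓝 (planarCoupling a))) (q : Label d) (c : Fin d) (p : ℕ) :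
    limitCov e q c p = (if q.1 = c then gueCov (colorSeries c) q.2 p else 0) +
      (MvPowerSeries.X c * MvPowerSeries.X q.1 * totalSeries d +
        if q.1 = c then 1 - colorSeries c else 0) *
      (((p : MvPowerSeries (Fin d) ℂ) * gueMoment (colorSeries c) (p - 1)) *
        ((q.2 : MvPowerSeries (Fin d) ℂ) * gueMoment (colorSeries q.1) (q.2 - 1))) := by
  obtain ⟨i, q⟩ := q
  dsimp only
  set b : MvPowerSeries (Fin d) ℂ := (q : MvPowerSeries (Fin d) ℂ) * gueMoment (colorSeries i) (q - 1) with hb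
  set Y : MvPowerSeries (Fin d) ℂ := ∑ j, MvPowerSeries.X j * limitCov e (i, q) j 1 with hY
  -- Since the first moments vanish, the colours interact only through Y; the missing summand j = c
  -- is restored by subtracting it.
  have hrec : ∀ (c : Fin d) (p : ℕ), (1 - MvPowerSeries.X c ^ 2) * limitCov e (i, q) c (p + 1) =
      2 * ∑ k ∈ Finset.range p, gueMoment (colorSeries c) k * limitCov e (i, q) c (p - 1 - k) +
      (MvPowerSeries.X c * (Y - MvPowerSeries.X c * limitCov e (i, q) c 1)) *
        gueMoment (colorSeries c) p +
      (if i = c then 1 else 0) * ((q : MvPowerSeries (Fin d) ℂ) * gueMoment (colorSeries c) (p + q - 1)) := by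
    intro c p
    have h1 := limitCov_model h hg (i, q) c p
    rw [sum_reflect_mul] at h1
    simp only [limitMoment_one h hg, zero_mul, add_zero, limitMoment_eq h hg] at h1
    have h2 : ∑ j ∈ Finset.univ.erase c, MvPowerSeries.X j *
        (gueMoment (colorSeries c) p * limitCov e (i, q) j 1) =
        gueMoment (colorSeries c) p * (Y - MvPowerSeries.X c * limitCov e (i, q) c 1) := by
      rw [hY, ← Finset.add_sum_erase _ _ (Finset.mem_univ c), add_sub_cancel_left, Finset.mul_sum]
      exact Finset.sum_congr rfl fun j _ => by ring
    rw [h2] at h1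
    split_ifs at h1 ⊢ <;> linear_combination h1
  have hone : ∀ c : Fin d, limitCov e (i, q) c 1 =
      MvPowerSeries.X c * Y + if i = c then b else 0 := by
    intro c
    have h1 := hrec c 0
    simp only [Finset.range_zero, Finset.sum_empty, gueMoment_zero, zero_add] at h1
    split_ifs at h1 ⊢ with hc
    · subst hc
      linear_combination h1
    · linear_combination h1
  -- Summing the equations for p = 1 against α_c closes the system in the single unknown Y, with
  -- coefficient 1 - ∑ α_c².
  have hYeq : Y = totalSeries d * MvPowerSeries.X i * b := by
    have h2 : Y = (∑ c : Fin d, MvPowerSeries.X c ^ 2) * Y + MvPowerSeries.X i * b := by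
      conv_lhs => rw [hY]
      simp only [hone, mul_add, Finset.sum_add_distrib, mul_ite, mul_zero, Finset.sum_ite_eq,
        Finset.mem_univ, if_true, Finset.sum_mul]
      congr 1
      exact Finset.sum_congr rfl fun c _ => by ring
    linear_combination totalSeries d * h2 - Y * totalSeries_mul (d := d)
  -- Here θ = α_c (Y - α_c K_c(1)), where K_c(1) is the covariance at p = 1. Dividing by 1 - α_c²
  -- leaves α_c Y, and for i = c an additional (1 - 1/(1 - α_c²)) b.
  have h3 := eq_gueCov_add (colorSeries_mul c) (limitCov_zero h (i, q) c) (hrec c) p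
  rw [h3, hone, hYeq]
  have h4 := colorSeries_mul c
  split_ifs with hc
  · subst hc
    linear_combination (MvPowerSeries.X i ^ 2 * totalSeries d * b + b) * p *
      gueMoment (colorSeries i) (p - 1) * h4
  · linear_combination (MvPowerSeries.X c * MvPowerSeries.X i * totalSeries d * b) * p *
      gueMoment (colorSeries c) (p - 1) * h4

end ModelSolution

/-! ### Planar loop equations of the Gaussian unitary ensemble. -/

section GUESolution

variable {e : ℕ → Multiset (Label 1) → MvPowerSeries (Var 1) ℂ} {s : ℂ}

lemma constantCoeff_killCompl {d : ℕ} (f : MvPowerSeries (Var d) ℂ) :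
    MvPowerSeries.constantCoeff (MvPowerSeries.killCompl (couplingVar d) f) =
      MvPowerSeries.constantCoeff f := by
  rw [← MvPowerSeries.coeff_zero_eq_constantCoeff_apply, MvPowerSeries.coeff_killCompl,
    Finsupp.embDomain_zero, MvPowerSeries.coeff_zero_eq_constantCoeff_apply]

lemma monomialSum_zero {τ R : Type*} [DecidableEq τ] [CommRing R] :
    (monomialSum fun _ => 0 : MvPowerSeries τ R) = 0 := by
  ext m; simp

lemma constantCoeff_limitMoment_gue (h : IsLoopSystem s (sourceCoupling 0) e) (hs : s ≠ 0)
    (p : ℕ) :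
    MvPowerSeries.constantCoeff (limitExpect e (0, p)) = gueMoment s⁻¹ p := by
  rw [← constantCoeff_killCompl]
  refine eq_gueMoment (m := fun p => MvPowerSeries.constantCoeff (limitMoment e 0 p))
    (inv_mul_cancel₀ hs) ?_ (fun p => ?_) p
  · rw [limitMoment_zero h, map_one]
  · have h1 := limitMoment_loop (g' := 0) h (fun _ => tendsto_const_nhds) hs 0 p
    simp only [Pi.zero_apply, zero_mul, map_zero, monomialSum_zero, add_zero] at h1
    simpa using congrArg MvPowerSeries.constantCoeff h1

lemma constantCoeff_limitCov_gue (h : IsLoopSystem s (sourceCoupling 0) e) (hs : s ≠ 0)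
    (p q : ℕ) :
    MvPowerSeries.constantCoeff
      (MvPowerSeries.pderiv ℂ (Sum.inl (0, q)) (limitExpect e (0, p))) = gueCov s⁻¹ q p := by
  rw [← constantCoeff_killCompl]
  have h2 : ∀ k, MvPowerSeries.constantCoeff (limitMoment e 0 k) = gueMoment s⁻¹ k := fun k => by
    rw [limitMoment, constantCoeff_killCompl, constantCoeff_limitMoment_gue h hs]
  have h3 := eq_gueCov_add (K := fun p => MvPowerSeries.constantCoeff (limitCov e (0, q) 0 p))
    (r := 1) (θ := 0) (q := q) (inv_mul_cancel₀ hs) ?_ (fun p => ?_) p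
  · rw [zero_mul, add_zero, one_mul] at h3
    exact h3
  · rw [limitCov_zero h, map_zero]
  · have h1 := limitCov_loop (g' := 0) h (fun _ => tendsto_const_nhds) hs (0, q) 0 p
    simp only [Pi.zero_apply, zero_mul, map_zero, monomialSum_zero, add_zero, sum_reflect_mul,
      if_true] at h1
    have h4 : MvPowerSeries.constantCoeff (2 : MvPowerSeries (Fin 1) ℂ) = 2 := map_ofNat _ 2
    simpa [h2, h4] using congrArg MvPowerSeries.constantCoeff h1

end GUESolution

/-! ### Values of power series -/

section Values

variable {d : ℕ} {α : Fin d → ℂ} {f g : MvPowerSeries (Fin d) ℂ} {v w : ℂ}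

lemma hasValueAt_monomial (n : Fin d →₀ ℕ) (r : ℂ) :
    HasValueAt (MvPowerSeries.monomial n r) α (r * ∏ c, α c ^ n c) := by
  have h := hasSum_single (f := fun a : Fin d →₀ ℕ =>
    MvPowerSeries.coeff a (MvPowerSeries.monomial n r) * ∏ c, α c ^ a c) n
    (fun a ha => by rw [MvPowerSeries.coeff_monomial_ne ha, zero_mul])
  rwa [MvPowerSeries.coeff_monomial_same] at h

lemma hasValueAt_zero : HasValueAt (0 : MvPowerSeries (Fin d) ℂ) α 0 := by
  have h := hasValueAt_monomial (α := α) 0 0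
  rwa [map_zero, zero_mul] at h

lemma hasValueAt_one : HasValueAt (1 : MvPowerSeries (Fin d) ℂ) α 1 := by
  have h := hasValueAt_monomial (α := α) 0 1
  simpa [MvPowerSeries.monomial_zero_one] using h

lemma hasValueAt_X (c : Fin d) : HasValueAt (MvPowerSeries.X c) α (α c) := by
  have h := hasValueAt_monomial (α := α) (Finsupp.single c 1) 1
  rw [Finset.prod_eq_single c (fun b _ hb => by simp [hb.symm]) (by simp)] at h
  simpa [MvPowerSeries.X] using h

lemma HasValueAt.add (hf : HasValueAt f α v) (hg : HasValueAt g α w) :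
    HasValueAt (f + g) α (v + w) := by
  have h := HasSum.add hf hg
  simp only [← add_mul] at h
  exact h

lemma HasValueAt.neg (hf : HasValueAt f α v) : HasValueAt (-f) α (-v) := by
  have h := HasSum.neg hf
  simp only [← neg_mul] at h
  exact h

lemma HasValueAt.sub (hf : HasValueAt f α v) (hg : HasValueAt g α w) :
    HasValueAt (f - g) α (v - w) := by
  rw [sub_eq_add_neg, sub_eq_add_neg]
  exact hf.add hg.neg

lemma coeff_mul_mul_prod (a : Fin d →₀ ℕ) :
    MvPowerSeries.coeff a (f * g) * ∏ c, α c ^ a c =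
      ∑ k ∈ Finset.HasAntidiagonal.antidiagonal a,
        (MvPowerSeries.coeff k.1 f * ∏ c, α c ^ k.1 c) *
          (MvPowerSeries.coeff k.2 g * ∏ c, α c ^ k.2 c) := by
  rw [MvPowerSeries.coeff_mul, Finset.sum_mul]
  refine Finset.sum_congr rfl fun k hk => ?_
  rw [← Finset.HasAntidiagonal.mem_antidiagonal.mp hk]
  simp only [Finsupp.add_apply, pow_add, Finset.prod_mul_distrib]
  ring

/-- For complex families summability is absolute, so the Cauchy product needs no further assumption.
-/
lemma hasSum_antidiagonal {F G : (Fin d →₀ ℕ) → ℂ} (hF : HasSum F v) (hG : HasSum G w) :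
    HasSum (fun a => ∑ k ∈ Finset.HasAntidiagonal.antidiagonal a, F k.1 * G k.2) (v * w) := by
  have h1 := summable_mul_of_summable_norm hF.summable.norm hG.summable.norm
  have h2 := (summable_sum_mul_antidiagonal_of_summable_mul h1).hasSum
  rwa [← hF.summable.tsum_mul_tsum_eq_tsum_sum_antidiagonal hG.summable h1, hF.tsum_eq,
    hG.tsum_eq] at h2

lemma HasValueAt.mul (hf : HasValueAt f α v) (hg : HasValueAt g α w) :
    HasValueAt (f * g) α (v * w) := by
  unfold HasValueAt
  simp only [coeff_mul_mul_prod]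
  exact hasSum_antidiagonal (F := fun a => MvPowerSeries.coeff a f * ∏ c, α c ^ a c)
    (G := fun a => MvPowerSeries.coeff a g * ∏ c, α c ^ a c) hf hg

lemma hasValueAt_sum {ι : Type*} {s : Finset ι} {F : ι → MvPowerSeries (Fin d) ℂ} {V : ι → ℂ}
    (h : ∀ i ∈ s, HasValueAt (F i) α (V i)) : HasValueAt (∑ i ∈ s, F i) α (∑ i ∈ s, V i) := by
  have h1 := hasSum_sum h
  simp only [← Finset.sum_mul, ← map_sum] at h1
  exact h1

lemma hasValueAt_natCast (n : ℕ) : HasValueAt (n : MvPowerSeries (Fin d) ℂ) α n := by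
  induction n with
  | zero => simpa using hasValueAt_zero
  | succ n ih => simpa using ih.add hasValueAt_one

lemma HasValueAt.pow (hf : HasValueAt f α v) (n : ℕ) : HasValueAt (f ^ n) α (v ^ n) := by
  induction n with
  | zero => simpa using hasValueAt_one
  | succ n ih => simpa [pow_succ] using ih.mul hf

lemma norm_coeff_X_sq_mul (c : Fin d) :
    HasSum (fun a : Fin d →₀ ℕ =>
      ‖MvPowerSeries.coeff a (MvPowerSeries.X c ^ 2 : MvPowerSeries (Fin d) ℂ) *
        ∏ c, α c ^ a c‖) (‖α c‖ ^ 2) := by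
  have h := hasSum_single (f := fun a : Fin d →₀ ℕ =>
    ‖MvPowerSeries.coeff a (MvPowerSeries.X c ^ 2 : MvPowerSeries (Fin d) ℂ) *
      ∏ c, α c ^ a c‖) (Finsupp.single c 2)
    (fun a ha => by rw [MvPowerSeries.coeff_X_pow, if_neg ha, zero_mul, norm_zero])
  rw [MvPowerSeries.coeff_X_pow, if_pos rfl, one_mul,
    Finset.prod_eq_single c (fun b _ hb => by simp [hb.symm]) (by simp)] at h
  simpa using h

/-- A power series whose value is absolutely bounded by less than one has a geometric series. -/
lemma HasValueAt.geometric (hf : HasValueAt f α v) {ρ : ℝ} (hρ : ρ < 1)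
    (hfρ : ∑' a, ‖MvPowerSeries.coeff a f * ∏ c, α c ^ a c‖ ≤ ρ) (hg : g * (1 - f) = 1) :
    HasValueAt g α (1 - v)⁻¹ := by
  set A : (Fin d →₀ ℕ) → ℝ := fun a => ‖MvPowerSeries.coeff a f * ∏ c, α c ^ a c‖ with hA
  set B : (Fin d →₀ ℕ) → ℝ := fun a => ‖MvPowerSeries.coeff a g * ∏ c, α c ^ a c‖ with hB
  have hA0 : ∀ a, 0 ≤ A a := fun a => norm_nonneg _
  have hB0 : ∀ a, 0 ≤ B a := fun a => norm_nonneg _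
  have hAs : Summable A := (HasSum.summable hf).norm
  have hrec : ∀ a, B a ≤ (if a = 0 then 1 else 0) +
      ∑ k ∈ Finset.HasAntidiagonal.antidiagonal a, A k.1 * B k.2 := by
    intro a
    have h1 : g = 1 + f * g := by linear_combination hg
    have h2 : MvPowerSeries.coeff a g * ∏ c, α c ^ a c =
        (if a = 0 then 1 else 0) + ∑ k ∈ Finset.HasAntidiagonal.antidiagonal a,
          (MvPowerSeries.coeff k.1 f * ∏ c, α c ^ k.1 c) *
            (MvPowerSeries.coeff k.2 g * ∏ c, α c ^ k.2 c) := by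
      conv_lhs => rw [h1]
      rw [map_add, add_mul, coeff_mul_mul_prod, MvPowerSeries.coeff_one]
      congr 1
      split_ifs with h
      · simp [h]
      · rw [zero_mul]
    simp only [hB, hA]
    rw [h2]
    refine (norm_add_le _ _).trans (add_le_add ?_ ((norm_sum_le _ _).trans
      (Finset.sum_le_sum fun k _ => (norm_mul _ _).le)))
    split_ifs <;> simp
  -- On a box of exponents the convolution is at most the product of the box sums, so S ≤ 1 + ρ S.
  -- The sum S over a box is finite, which allows solving for it.
  have hbound : ∀ m : Fin d →₀ ℕ, ∑ a ∈ Finset.Iic m, B a ≤ 1 / (1 - ρ) := by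
    intro m
    have h1 : ∑ a ∈ Finset.Iic m, ∑ k ∈ Finset.HasAntidiagonal.antidiagonal a, A k.1 * B k.2 ≤
        (∑ a ∈ Finset.Iic m, A a) * ∑ a ∈ Finset.Iic m, B a := by
      rw [Finset.sum_mul_sum, ← Finset.sum_product', Finset.sum_sigma']
      have hinj : Set.InjOn (fun k : (_ : Fin d →₀ ℕ) × ((Fin d →₀ ℕ) × (Fin d →₀ ℕ)) => k.2)
          ((Finset.Iic m).sigma fun a => Finset.HasAntidiagonal.antidiagonal a) := by
        rintro ⟨a, k⟩ hk ⟨a', k'⟩ hk' rfl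
        simp only [Finset.coe_sigma, Set.mem_sigma_iff, Finset.mem_coe,
          Finset.HasAntidiagonal.mem_antidiagonal] at hk hk'
        obtain rfl : a = a' := hk.2.symm.trans hk'.2
        rfl
      rw [← Finset.sum_image (f := fun k : (Fin d →₀ ℕ) × (Fin d →₀ ℕ) => A k.1 * B k.2) hinj]
      refine Finset.sum_le_sum_of_subset_of_nonneg ?_
        fun k _ _ => mul_nonneg (hA0 _) (hB0 _)
      intro k hk
      obtain ⟨⟨a, k'⟩, hk', rfl⟩ := Finset.mem_image.mp hk
      simp only [Finset.mem_sigma, Finset.HasAntidiagonal.mem_antidiagonal, Finset.mem_Iic] at hk'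
      obtain ⟨ha, rfl⟩ := hk'
      exact Finset.mem_product.mpr ⟨Finset.mem_Iic.mpr (le_self_add.trans ha),
        Finset.mem_Iic.mpr (le_add_self.trans ha)⟩
    have h2 : ∑ a ∈ Finset.Iic m, A a ≤ ρ := (hAs.sum_le_tsum _ fun a _ => hA0 a).trans hfρ
    have h3 : ∑ a ∈ Finset.Iic m, B a ≤ 1 + ρ * ∑ a ∈ Finset.Iic m, B a := by
      refine (Finset.sum_le_sum fun a _ => hrec a).trans ?_
      rw [Finset.sum_add_distrib, Finset.sum_ite_eq']
      refine add_le_add (by split_ifs <;> simp) (h1.trans ?_)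
      exact mul_le_mul_of_nonneg_right h2 (Finset.sum_nonneg fun a _ => hB0 a)
    rw [le_div_iff₀ (by linarith)]
    linarith
  -- Every finite set of exponents lies in the box below its supremum.
  have hBs : Summable B := by
    refine summable_of_sum_le (c := 1 / (1 - ρ)) hB0 fun T => ?_
    refine (Finset.sum_le_sum_of_subset_of_nonneg (t := Finset.Iic (T.sup id)) ?_
      fun a _ _ => hB0 a).trans (hbound _)
    intro a ha
    exact Finset.mem_Iic.mpr (Finset.le_sup (f := id) ha)
  have hgs : HasValueAt g α (∑' a, MvPowerSeries.coeff a g * ∏ c, α c ^ a c) :=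
    (Summable.of_norm hBs).hasSum
  have h1 := HasSum.unique (hgs.mul (hasValueAt_one.sub hf)) (hg ▸ hasValueAt_one)
  have h2 := eq_inv_of_mul_eq_one_left h1
  rwa [h2] at hgs

lemma hasValueAt_colorSeries (c : Fin d) (hα : ‖α c‖ ^ 2 < 1) :
    HasValueAt (colorSeries c) α (1 - α c ^ 2)⁻¹ :=
  ((hasValueAt_X c).pow 2).geometric hα (norm_coeff_X_sq_mul c).tsum_eq.le (colorSeries_mul c)

lemma hasValueAt_totalSeries (hα : ∑ c, ‖α c‖ ^ 2 < 1) :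
    HasValueAt (totalSeries d) α (1 - ∑ c, α c ^ 2)⁻¹ := by
  have h := hasSum_sum fun c (_ : c ∈ (Finset.univ : Finset (Fin d))) =>
    norm_coeff_X_sq_mul (α := α) c
  have h1 : HasValueAt (∑ c : Fin d, MvPowerSeries.X c ^ 2) α (∑ c, α c ^ 2) :=
    hasValueAt_sum fun c _ => (hasValueAt_X c).pow 2
  refine h1.geometric hα ?_ totalSeries_mul
  rw [← h.tsum_eq]
  refine (HasSum.summable h1).norm.tsum_le_tsum (fun a => ?_) h.summable
  rw [map_sum, Finset.sum_mul]
  exact norm_sum_le _ _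

lemma HasValueAt.gueMoment (hf : HasValueAt f α v) (p : ℕ) :
    HasValueAt (gueMoment f p) α (gueMoment v p) := by
  induction p using Nat.strong_induction_on with
  | _ p ih =>
    rcases p with _ | p
    · simpa only [gueMoment_zero] using hasValueAt_one
    · rw [gueMoment_succ, gueMoment_succ]
      refine hf.mul (hasValueAt_sum fun k hk => ?_)
      have := Finset.mem_range.mp hk
      exact (ih k (by omega)).mul (ih (p - 1 - k) (by omega))

lemma HasValueAt.gueCov (hf : HasValueAt f α v) (q p : ℕ) :
    HasValueAt (gueCov f q p) α (gueCov v q p) := by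
  induction p using Nat.strong_induction_on with
  | _ p ih =>
    rcases p with _ | p
    · simpa only [gueCov_zero] using hasValueAt_zero
    · rw [gueCov_succ, gueCov_succ]
      refine hf.mul (((hasValueAt_natCast 2).mul (hasValueAt_sum fun k hk => ?_)).add
        ((hasValueAt_natCast q).mul (hf.gueMoment _)))
      have := Finset.mem_range.mp hk
      exact (hf.gueMoment k).mul (ih (p - 1 - k) (by omega))

end Values

/-! ### Generating functions of the planar moments and covariances -/

section Convolution

/-- The pairs (k, p - 1 - k) are distinct for distinct (p, k) and lie in a square. -/
lemma sum_convolution_le {a b : ℕ → ℝ} (ha : ∀ k, 0 ≤ a k) (hb : ∀ k, 0 ≤ b k) (P : ℕ) :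
    ∑ p ∈ Finset.range P, ∑ k ∈ Finset.range p, a k * b (p - 1 - k) ≤
      (∑ k ∈ Finset.range P, a k) * ∑ k ∈ Finset.range P, b k := by
  rw [Finset.sum_mul_sum, ← Finset.sum_product', Finset.sum_sigma']
  have hinj : Set.InjOn (fun k : (_ : ℕ) × ℕ => (k.2, k.1 - 1 - k.2))
      ((Finset.range P).sigma fun p => Finset.range p) := by
    rintro ⟨p, k⟩ hk ⟨p', k'⟩ hk' h
    simp only [Finset.coe_sigma, Set.mem_sigma_iff, Finset.mem_coe, Finset.mem_range,
      Prod.mk.injEq] at hk hk' h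
    obtain ⟨rfl, h⟩ := h
    obtain rfl : p = p' := by omega
    rfl
  rw [← Finset.sum_image (f := fun k : ℕ × ℕ => a k.1 * b k.2) hinj]
  refine Finset.sum_le_sum_of_subset_of_nonneg ?_ fun k _ _ => mul_nonneg (ha _) (hb _)
  intro k hk
  obtain ⟨⟨p, k'⟩, hk', rfl⟩ := Finset.mem_image.mp hk
  simp only [Finset.mem_sigma, Finset.mem_range] at hk'
  simp only [Finset.mem_product, Finset.mem_range]
  omega

lemma hasSum_convolution {a b : ℕ → ℂ} {v w : ℂ} (ha : HasSum a v) (hb : HasSum b w) :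
    HasSum (fun p => ∑ k ∈ Finset.range p, a k * b (p - 1 - k)) (v * w) := by
  have h1 := hasSum_sum_range_mul_of_summable_norm ha.summable.norm hb.summable.norm
  rw [ha.tsum_eq, hb.tsum_eq] at h1
  rw [← hasSum_nat_add_iff' 1]
  simpa using h1

end Convolution

/-! ### Exponential bounds on planar moments and covariances. -/

section Bounds

variable {u : ℂ} {r : ℝ}

/-- The bound 2 reproduces itself: the recursion gives S' ≤ 1 + S²/16 ≤ 1 + 4/16. The constant 1/16
is chosen for convenience and is not optimal. -/
lemma sum_norm_gueMoment_le (hr : 0 < r) (hu : ‖u‖ * r ^ 2 ≤ 1 / 16) (P : ℕ) :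
    ∑ p ∈ Finset.range P, ‖gueMoment u p‖ * r ^ p ≤ 2 := by
  induction P with
  | zero => simp
  | succ P ih =>
    set S := ∑ p ∈ Finset.range P, ‖gueMoment u p‖ * r ^ p with hS
    have hS0 : 0 ≤ S := Finset.sum_nonneg fun p _ => by positivity
    have h1 : ∀ p, ‖gueMoment u (p + 1)‖ * r ^ (p + 1) ≤ ‖u‖ * r ^ 2 *
        ∑ k ∈ Finset.range p, (‖gueMoment u k‖ * r ^ k) *
          (‖gueMoment u (p - 1 - k)‖ * r ^ (p - 1 - k)) := by
      intro p
      rw [gueMoment_succ, norm_mul, mul_assoc, mul_assoc]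
      refine mul_le_mul_of_nonneg_left ?_ (norm_nonneg u)
      refine (mul_le_mul_of_nonneg_right (norm_sum_le _ _) (by positivity)).trans (le_of_eq ?_)
      rw [Finset.sum_mul, Finset.mul_sum]
      refine Finset.sum_congr rfl fun k hk => ?_
      have hk := Finset.mem_range.mp hk
      have h4 : r ^ (p + 1) = r ^ 2 * (r ^ k * r ^ (p - 1 - k)) := by
        rw [← pow_add, ← pow_add]; congr 1; omega
      rw [norm_mul, h4]
      ring
    rw [Finset.sum_range_succ', gueMoment_zero]
    have h2 : ∑ p ∈ Finset.range P, ‖gueMoment u (p + 1)‖ * r ^ (p + 1) ≤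
        ‖u‖ * r ^ 2 * (S * S) := by
      refine (Finset.sum_le_sum fun p _ => h1 p).trans ?_
      rw [← Finset.mul_sum]
      exact mul_le_mul_of_nonneg_left (sum_convolution_le
        (a := fun k => ‖gueMoment u k‖ * r ^ k) (b := fun k => ‖gueMoment u k‖ * r ^ k)
        (fun k => by positivity) (fun k => by positivity) P) (by positivity)
    have h3 : ‖u‖ * r ^ 2 * (S * S) ≤ 1 / 16 * 4 :=
      mul_le_mul hu (by nlinarith) (by positivity) (by norm_num)
    simp only [norm_one, pow_zero, mul_one]
    linarith

lemma norm_gueMoment_le (hr : 0 < r) (hu : ‖u‖ * r ^ 2 ≤ 1 / 16) (p : ℕ) :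
    ‖gueMoment u p‖ * r ^ p ≤ 2 :=
  (Finset.single_le_sum (f := fun p => ‖gueMoment u p‖ * r ^ p) (fun p _ => by positivity)
    (Finset.self_mem_range_succ p)).trans (sum_norm_gueMoment_le hr hu (p + 1))

lemma sum_norm_gueMoment_shift_le (hr : 0 < r) (hu : ‖u‖ * r ^ 2 ≤ 1 / 16) (q P : ℕ) :
    ∑ p ∈ Finset.range P, ‖gueMoment u (p + q)‖ * r ^ (p + q) ≤ 2 := by
  refine le_trans ?_ (sum_norm_gueMoment_le hr hu (P + q))
  rw [add_comm P q, Finset.sum_range_add]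
  simp only [add_comm q]
  exact le_add_of_nonneg_left (Finset.sum_nonneg fun p _ => by positivity)

lemma gueCov_zero_left (u : ℂ) (p : ℕ) : gueCov u 0 p = 0 := by
  induction p using Nat.strong_induction_on with
  | _ p ih =>
    rcases p with _ | p
    · exact gueCov_zero u 0
    · rw [gueCov_succ, Finset.sum_eq_zero]
      · simp
      · intro k hk
        have := Finset.mem_range.mp hk
        rw [ih (p - 1 - k) (by omega), mul_zero]

/-- The same bootstrap for the partial sums: (2 · 2 + 2)/16 of the bound comes back, less than the
whole. The case q = 0 is separated because of the index p + q - 1. -/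
lemma norm_gueCov_le (hr : 0 < r) (hu : ‖u‖ * r ^ 2 ≤ 1 / 16) (q p : ℕ) :
    ‖gueCov u q p‖ * r ^ (p + q) ≤ q := by
  rcases q with _ | q
  · simp [gueCov_zero_left]
  have hT : ∀ P, ∑ p ∈ Finset.range P, ‖gueCov u (q + 1) p‖ * r ^ (p + (q + 1)) ≤ q + 1 := by
    intro P
    induction P with
    | zero => simp; positivity
    | succ P ih =>
      have h1 : ∀ p, ‖gueCov u (q + 1) (p + 1)‖ * r ^ (p + 1 + (q + 1)) ≤ ‖u‖ * r ^ 2 *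
          (2 * ∑ k ∈ Finset.range p, (‖gueMoment u k‖ * r ^ k) *
            (‖gueCov u (q + 1) (p - 1 - k)‖ * r ^ (p - 1 - k + (q + 1))) +
            (q + 1) * (‖gueMoment u (p + q)‖ * r ^ (p + q))) := by
        intro p
        rw [gueCov_succ, norm_mul, mul_assoc, mul_assoc]
        refine mul_le_mul_of_nonneg_left ?_ (norm_nonneg u)
        refine (mul_le_mul_of_nonneg_right ((norm_add_le _ _).trans (add_le_add
          ((norm_mul_le _ _).trans (mul_le_mul_of_nonneg_left (norm_sum_le _ _) (norm_nonneg _)))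
          (norm_mul_le _ _))) (by positivity)).trans (le_of_eq ?_)
        have h3 : ‖((q + 1 : ℕ) : ℂ)‖ = q + 1 := by
          rw [Complex.norm_natCast]; push_cast; rfl
        rw [h3, Complex.norm_ofNat, add_mul, mul_add]
        congr 1
        · rw [mul_assoc, mul_left_comm, Finset.sum_mul, Finset.mul_sum, Finset.mul_sum]
          refine Finset.sum_congr rfl fun k hk => ?_
          have hk := Finset.mem_range.mp hk
          have h4 : r ^ (p + 1 + (q + 1)) = r ^ 2 * (r ^ k * r ^ (p - 1 - k + (q + 1))) := by
            rw [← pow_add, ← pow_add]; congr 1; omega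
          rw [norm_mul, h4]
          ring
        · rw [show p + (q + 1) - 1 = p + q by omega]
          ring
      have h2 := sum_convolution_le (a := fun k => ‖gueMoment u k‖ * r ^ k)
        (b := fun k => ‖gueCov u (q + 1) k‖ * r ^ (k + (q + 1))) (fun k => by positivity)
        (fun k => by positivity) P
      have h3 := sum_norm_gueMoment_le hr hu P
      have h4 := sum_norm_gueMoment_shift_le hr hu q P
      rw [Finset.sum_range_succ', gueCov_zero, norm_zero, zero_mul, add_zero]
      refine (Finset.sum_le_sum fun p _ => h1 p).trans ?_
      rw [← Finset.mul_sum, Finset.sum_add_distrib, ← Finset.mul_sum, ← Finset.mul_sum]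
      have h5 := h2.trans (mul_le_mul h3 ih (Finset.sum_nonneg fun k _ => by positivity)
        (by norm_num))
      have h6 : (2 : ℝ) * ∑ p ∈ Finset.range P, ∑ k ∈ Finset.range p,
          (‖gueMoment u k‖ * r ^ k) *
            (‖gueCov u (q + 1) (p - 1 - k)‖ * r ^ (p - 1 - k + (q + 1))) +
          (q + 1) * ∑ p ∈ Finset.range P, ‖gueMoment u (p + q)‖ * r ^ (p + q) ≤
          2 * (2 * (q + 1)) + (q + 1) * 2 :=
        add_le_add (mul_le_mul_of_nonneg_left h5 (by norm_num))
          (mul_le_mul_of_nonneg_left h4 (by positivity))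
      refine (mul_le_mul hu h6 (by positivity) (by norm_num)).trans ?_
      have : (0 : ℝ) ≤ q := Nat.cast_nonneg q
      linarith
  have h := (Finset.single_le_sum (f := fun p => ‖gueCov u (q + 1) p‖ * r ^ (p + (q + 1)))
    (fun p _ => by positivity) (Finset.self_mem_range_succ p)).trans (hT (p + 1))
  exact_mod_cast h

end Bounds

/-! ### Splitting off a boundary row of a double series. -/

section DoubleSeries

lemma hasSum_of_forall_eq {ι : Type*} {f g : ι → ℂ} {v : ℂ} (h : HasSum f v)
    (e : ∀ p, g p = f p) : HasSum g v :=
  (funext e : g = f) ▸ h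

variable {a : ℕ × ℕ → ℂ}

lemma tsum_prod_split_left (h : Summable a) :
    ∑' k, a k = ∑' q, a (0, q) + ∑' k : ℕ × ℕ, a (k.1 + 1, k.2) := by
  have hinj : Function.Injective fun k : ℕ × ℕ => (k.1 + 1, k.2) := fun k k' hk => by
    simp only [Prod.mk.injEq, Nat.add_right_cancel_iff] at hk
    exact Prod.ext hk.1 hk.2
  rw [h.tsum_prod, h.prod.tsum_eq_zero_add]
  congr 1
  exact (h.comp_injective hinj).tsum_prod.symm

lemma tsum_prod_split_right (h : Summable a) :
    ∑' k, a k = ∑' p, a (p, 0) + ∑' k : ℕ × ℕ, a (k.1, k.2 + 1) := by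
  have h1 : Summable fun k : ℕ × ℕ => a k.swap := (Equiv.prodComm ℕ ℕ).summable_iff.mpr h
  have h2 := tsum_prod_split_left h1
  rw [← (Equiv.prodComm ℕ ℕ).tsum_eq a,
    ← (Equiv.prodComm ℕ ℕ).tsum_eq fun k : ℕ × ℕ => a (k.1, k.2 + 1)]
  exact h2

end DoubleSeries

/-! ### Algebraic equations for the generating functions. -/

section GeneratingFunctions

/-- The generating function `∑_p m_p y^p` of the planar moments. -/
def momentSeries (u y : ℂ) : ℂ := ∑' p, gueMoment u p * y ^ p

/-- The generating function `∑_p (p + 1) m_p y^p`. -/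
def momentDerivSeries (u y : ℂ) : ℂ := ∑' p : ℕ, ((p + 1 : ℂ) * gueMoment u p) * y ^ p

/-- The generating function `∑_{p,q} m_{p+q} y₁^p y₂^q`. -/
def hankelSeries (u y₁ y₂ : ℂ) : ℂ :=
  ∑' k : ℕ × ℕ, gueMoment u (k.1 + k.2) * (y₁ ^ k.1 * y₂ ^ k.2)

/-- The generating function `∑_{p,q} (q + 1) m_{p+q} y₁^p y₂^q`. -/
def hankelDerivSeries (u y₁ y₂ : ℂ) : ℂ :=
  ∑' k : ℕ × ℕ, ((k.2 + 1 : ℂ) * gueMoment u (k.1 + k.2)) * (y₁ ^ k.1 * y₂ ^ k.2)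

/-- The generating function of the planar covariances. -/
def covSeries (u y₁ y₂ : ℂ) : ℂ :=
  ∑' k : ℕ × ℕ, gueCov u (k.2 + 1) (k.1 + 1) * (y₁ ^ k.1 * y₂ ^ k.2)

variable {u : ℂ} {r : ℝ} {y y₁ y₂ : ℂ}

lemma norm_mul_pow_le {a : ℂ} {C : ℝ} {p : ℕ} (h : ‖a‖ * r ^ p ≤ C) (hy : ‖y‖ < r / 2) :
    ‖a * y ^ p‖ ≤ C * (1 / 2) ^ p := by
  have h1 : ‖y‖ ^ p ≤ (r * (1 / 2)) ^ p :=
    pow_le_pow_left₀ (norm_nonneg y) (by linarith) p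
  rw [norm_mul, norm_pow]
  calc ‖a‖ * ‖y‖ ^ p ≤ ‖a‖ * (r * (1 / 2)) ^ p := mul_le_mul_of_nonneg_left h1 (norm_nonneg a)
    _ = ‖a‖ * r ^ p * (1 / 2) ^ p := by rw [mul_pow, mul_assoc]
    _ ≤ C * (1 / 2) ^ p := mul_le_mul_of_nonneg_right h (by positivity)

/-- The majorant of the double series. -/
def doubleBound (k : ℕ × ℕ) : ℝ := (1 / 2) ^ k.1 * ((k.2 + 1) * (1 / 2) ^ k.2)

lemma summable_succ_mul_geometric : Summable fun q : ℕ => ((q : ℝ) + 1) * (1 / 2) ^ q := by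
  have h1 := summable_pow_mul_geometric_of_norm_lt_one (R := ℝ) 1 (r := 1 / 2) (by norm_num)
  have h2 := summable_geometric_of_lt_one (r := (1 / 2 : ℝ)) (by norm_num) (by norm_num)
  refine (h1.add h2).congr fun q => ?_
  rw [pow_one]; ring

lemma summable_doubleBound : Summable doubleBound :=
  (summable_geometric_of_lt_one (r := (1 / 2 : ℝ)) (by norm_num) (by norm_num)).mul_of_nonneg
    summable_succ_mul_geometric (fun p => by positivity) (fun q => by positivity)

lemma norm_mul_pow_pow_le {a : ℂ} {C : ℝ} {k : ℕ × ℕ}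
    (h : ‖a‖ * r ^ (k.1 + k.2) ≤ C * (k.2 + 1)) (hy₁ : ‖y₁‖ < r / 2) (hy₂ : ‖y₂‖ < r / 2) :
    ‖a * (y₁ ^ k.1 * y₂ ^ k.2)‖ ≤ C * doubleBound k := by
  have h1 : ‖a * y₁ ^ k.1‖ * r ^ k.2 ≤ C * (k.2 + 1) * (1 / 2) ^ k.1 := by
    have hr : 0 ≤ r := by linarith [norm_nonneg y₁]
    have h2 : ‖a * (r : ℂ) ^ k.2‖ * r ^ k.1 ≤ C * (k.2 + 1) := by
      rw [norm_mul, norm_pow, Complex.norm_real, Real.norm_of_nonneg hr, mul_assoc, ← pow_add,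
        add_comm k.2]
      exact h
    have h3 := norm_mul_pow_le h2 hy₁
    rwa [mul_right_comm, norm_mul, norm_pow, Complex.norm_real, Real.norm_of_nonneg hr] at h3
  have h4 := norm_mul_pow_le h1 hy₂
  rw [← mul_assoc]
  refine h4.trans (le_of_eq ?_)
  rw [doubleBound]; ring

lemma summable_double {a : ℕ × ℕ → ℂ} {C : ℝ}
    (h : ∀ k : ℕ × ℕ, ‖a k‖ * r ^ (k.1 + k.2) ≤ C * (k.2 + 1)) (hy₁ : ‖y₁‖ < r / 2)
    (hy₂ : ‖y₂‖ < r / 2) : Summable fun k : ℕ × ℕ => a k * (y₁ ^ k.1 * y₂ ^ k.2) :=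
  Summable.of_norm_bounded (summable_doubleBound.mul_left C) fun k =>
    norm_mul_pow_pow_le (h k) hy₁ hy₂

section

variable (hr : 0 < r) (hu : ‖u‖ * r ^ 2 ≤ 1 / 16)
include hr hu

lemma hasSum_momentSeries (hy : ‖y‖ < r / 2) :
    HasSum (fun p => gueMoment u p * y ^ p) (momentSeries u y) :=
  (Summable.of_norm_bounded ((summable_geometric_of_lt_one (r := (1 / 2 : ℝ)) (by norm_num)
    (by norm_num)).mul_left 2) fun p => norm_mul_pow_le (norm_gueMoment_le hr hu p) hy).hasSum

lemma hasSum_momentDerivSeries (hy : ‖y‖ < r / 2) :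
    HasSum (fun p : ℕ => ((p + 1 : ℂ) * gueMoment u p) * y ^ p) (momentDerivSeries u y) := by
  refine (Summable.of_norm_bounded (summable_succ_mul_geometric.mul_left 2) fun p => ?_).hasSum
  have h1 : ‖(p + 1 : ℂ) * gueMoment u p‖ * r ^ p ≤ (p + 1) * 2 := by
    rw [norm_mul, mul_assoc, show (p + 1 : ℂ) = ((p + 1 : ℕ) : ℂ) by push_cast; rfl,
      Complex.norm_natCast]
    push_cast
    exact mul_le_mul_of_nonneg_left (norm_gueMoment_le hr hu p) (by positivity)
  exact (norm_mul_pow_le h1 hy).trans (le_of_eq (by ring))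

lemma norm_gueMoment_add_le (p q : ℕ) :
    ‖gueMoment u (p + q)‖ * r ^ (p + q) ≤ 2 * (q + 1) := by
  have : (0 : ℝ) ≤ q := Nat.cast_nonneg q
  linarith [norm_gueMoment_le hr hu (p + q)]

lemma norm_succ_mul_gueMoment_add_le (p q : ℕ) :
    ‖(q + 1 : ℂ) * gueMoment u (p + q)‖ * r ^ (p + q) ≤ 2 * (q + 1) := by
  rw [norm_mul, mul_assoc, show (q + 1 : ℂ) = ((q + 1 : ℕ) : ℂ) by push_cast; rfl,
    Complex.norm_natCast, mul_comm (2 : ℝ)]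
  push_cast
  exact mul_le_mul_of_nonneg_left (norm_gueMoment_le hr hu _) (by positivity)

lemma norm_gueCov_succ_le (p q : ℕ) :
    ‖gueCov u (q + 1) (p + 1)‖ * r ^ (p + q) ≤ 1 / r ^ 2 * (q + 1) := by
  have h := norm_gueCov_le hr hu (q + 1) (p + 1)
  rw [show p + 1 + (q + 1) = p + q + 2 by ring, pow_add, ← mul_assoc] at h
  push_cast at h
  rw [one_div, ← div_eq_inv_mul, le_div_iff₀ (by positivity)]
  exact h

lemma hasSum_hankelSeries (hy₁ : ‖y₁‖ < r / 2) (hy₂ : ‖y₂‖ < r / 2) :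
    HasSum (fun k : ℕ × ℕ => gueMoment u (k.1 + k.2) * (y₁ ^ k.1 * y₂ ^ k.2))
      (hankelSeries u y₁ y₂) :=
  (summable_double (fun k => norm_gueMoment_add_le hr hu k.1 k.2) hy₁ hy₂).hasSum

lemma hasSum_hankelDerivSeries (hy₁ : ‖y₁‖ < r / 2) (hy₂ : ‖y₂‖ < r / 2) :
    HasSum (fun k : ℕ × ℕ => ((k.2 + 1 : ℂ) * gueMoment u (k.1 + k.2)) * (y₁ ^ k.1 * y₂ ^ k.2))
      (hankelDerivSeries u y₁ y₂) :=
  (summable_double (fun k => norm_succ_mul_gueMoment_add_le hr hu k.1 k.2) hy₁ hy₂).hasSum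

lemma hasSum_covSeries (hy₁ : ‖y₁‖ < r / 2) (hy₂ : ‖y₂‖ < r / 2) :
    HasSum (fun k : ℕ × ℕ => gueCov u (k.2 + 1) (k.1 + 1) * (y₁ ^ k.1 * y₂ ^ k.2))
      (covSeries u y₁ y₂) :=
  (summable_double (fun k => norm_gueCov_succ_le hr hu k.1 k.2) hy₁ hy₂).hasSum

lemma norm_momentSeries_le (hy : ‖y‖ < r / 2) : ‖momentSeries u y‖ ≤ 2 := by
  refine le_of_tendsto (hasSum_momentSeries hr hu hy).tendsto_sum_nat.norm
    (Eventually.of_forall fun P => ?_)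
  refine (norm_sum_le _ _).trans ((Finset.sum_le_sum fun p _ => ?_).trans
    (sum_norm_gueMoment_le hr hu P))
  rw [norm_mul, norm_pow]
  exact mul_le_mul_of_nonneg_left (pow_le_pow_left₀ (norm_nonneg y) (by linarith) p)
    (norm_nonneg _)

/-- The quadratic equation of the generating function of the planar moments. -/
lemma momentSeries_eq (hy : ‖y‖ < r / 2) :
    momentSeries u y = 1 + u * y ^ 2 * momentSeries u y ^ 2 := by
  have h1 := hasSum_momentSeries hr hu hy
  have h2 := (hasSum_convolution h1 h1).mul_left (u * y)
  have h3 : HasSum (fun p => gueMoment u (p + 1) * y ^ (p + 1))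
      (y * (u * y * (momentSeries u y * momentSeries u y))) := by
    refine hasSum_of_forall_eq (h2.mul_left y) fun p => ?_
    rw [gueMoment_succ, Finset.mul_sum, Finset.mul_sum, Finset.mul_sum, Finset.sum_mul]
    refine Finset.sum_congr rfl fun k hk => ?_
    have hk := Finset.mem_range.mp hk
    have h6 : y ^ (p + 1) = y * (y * (y ^ k * y ^ (p - 1 - k))) := by
      rw [← pow_add, ← pow_succ', ← pow_succ']; congr 1; omega
    rw [h6]
    ring
  have h4 := (hasSum_nat_add_iff' (f := fun p => gueMoment u p * y ^ p) 1).mpr h1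
  have h5 := h3.unique h4
  simp only [Finset.range_one, Finset.sum_singleton, gueMoment_zero, pow_zero, mul_one] at h5
  linear_combination -h5

/-- The generating form of `succ_mul_gueMoment`, the shift identity. -/
lemma momentDerivSeries_eq (hy : ‖y‖ < r / 2) :
    momentDerivSeries u y * (1 - 2 * u * y ^ 2 * momentSeries u y) = momentSeries u y := by
  have h1 := hasSum_momentSeries hr hu hy
  have h2 := hasSum_momentDerivSeries hr hu hy
  have h3 : HasSum (fun p : ℕ => (p * gueMoment u (p - 1)) * y ^ p)
      (y * momentDerivSeries u y) := by
    rw [← hasSum_nat_add_iff' 1]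
    simp only [Finset.range_one, Finset.sum_singleton, Nat.cast_zero, zero_mul, sub_zero]
    refine hasSum_of_forall_eq (h2.mul_left y) fun p => ?_
    rw [Nat.add_sub_cancel]; push_cast; ring
  have h4 := ((hasSum_convolution h1 h3).mul_left (2 * u * y)).add h1
  have h5 : HasSum (fun p : ℕ => ((p + 1 : ℂ) * gueMoment u p) * y ^ p)
      (2 * u * y * (momentSeries u y * (y * momentDerivSeries u y)) + momentSeries u y) := by
    refine hasSum_of_forall_eq (h4) fun p => ?_
    rw [succ_mul_gueMoment, add_mul, Finset.mul_sum, Finset.mul_sum, Finset.sum_mul]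
    congr 1
    refine Finset.sum_congr rfl fun k hk => ?_
    have hk := Finset.mem_range.mp hk
    have h6 : y ^ p = y * (y ^ k * y ^ (p - 1 - k)) := by
      rw [← pow_add, ← pow_succ']; congr 1; omega
    rw [h6]
    ring
  linear_combination h2.unique h5

/-- The coefficients depend on p + q only, so dropping the first row or the first column leaves the
same series Ψ up to a factor y₁ or y₂. Eliminating Ψ gives the divided difference of y F(y). -/
lemma hankelSeries_eq (hy₁ : ‖y₁‖ < r / 2) (hy₂ : ‖y₂‖ < r / 2) :
    (y₂ - y₁) * hankelSeries u y₁ y₂ = y₂ * momentSeries u y₂ - y₁ * momentSeries u y₁ := by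
  have h := (hasSum_hankelSeries hr hu hy₁ hy₂).summable
  have h1 := tsum_prod_split_left h
  have h2 := tsum_prod_split_right h
  set Ψ := ∑' k : ℕ × ℕ, gueMoment u (k.1 + k.2 + 1) * (y₁ ^ k.1 * y₂ ^ k.2) with hΨ
  have h3 : ∑' k : ℕ × ℕ, gueMoment u (k.1 + 1 + k.2) * (y₁ ^ (k.1 + 1) * y₂ ^ k.2) = y₁ * Ψ := by
    rw [hΨ, ← tsum_mul_left]
    refine tsum_congr fun k => ?_
    rw [add_right_comm]; ring
  have h4 : ∑' k : ℕ × ℕ, gueMoment u (k.1 + (k.2 + 1)) * (y₁ ^ k.1 * y₂ ^ (k.2 + 1)) =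
      y₂ * Ψ := by
    rw [hΨ, ← tsum_mul_left]
    refine tsum_congr fun k => ?_
    rw [← add_assoc]; ring
  simp only [zero_add, add_zero, pow_zero, one_mul, mul_one, h3, h4] at h1 h2
  change hankelSeries u y₁ y₂ = momentSeries u y₂ + _ at h1
  change hankelSeries u y₁ y₂ = momentSeries u y₁ + _ at h2
  linear_combination y₂ * h1 - y₁ * h2

/-- The same elimination; subtracting the Hankel series lowers the weight q + 1 to q, which kills
the first column and matches the shifted series. -/
lemma hankelDerivSeries_eq (hy₁ : ‖y₁‖ < r / 2) (hy₂ : ‖y₂‖ < r / 2) :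
    (y₂ - y₁) * hankelDerivSeries u y₁ y₂ =
      y₂ * momentDerivSeries u y₂ - y₁ * hankelSeries u y₁ y₂ := by
  have h := (hasSum_hankelDerivSeries hr hu hy₁ hy₂).summable
  have h' := (hasSum_hankelSeries hr hu hy₁ hy₂).summable
  have h1 := tsum_prod_split_left h
  have h2 := tsum_prod_split_right (h.sub h')
  rw [h.tsum_sub h'] at h2
  set Θ := ∑' k : ℕ × ℕ, ((k.2 + 1 : ℂ) * gueMoment u (k.1 + k.2 + 1)) * (y₁ ^ k.1 * y₂ ^ k.2)
    with hΘ
  have h3 : ∑' k : ℕ × ℕ, ((k.2 + 1 : ℂ) * gueMoment u (k.1 + 1 + k.2)) *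
      (y₁ ^ (k.1 + 1) * y₂ ^ k.2) = y₁ * Θ := by
    rw [hΘ, ← tsum_mul_left]
    refine tsum_congr fun k => ?_
    rw [add_right_comm k.1]; ring
  have h4 : ∑' k : ℕ × ℕ, ((((k.2 + 1 : ℕ) : ℂ) + 1) * gueMoment u (k.1 + (k.2 + 1)) *
      (y₁ ^ k.1 * y₂ ^ (k.2 + 1)) -
        gueMoment u (k.1 + (k.2 + 1)) * (y₁ ^ k.1 * y₂ ^ (k.2 + 1))) = y₂ * Θ := by
    rw [hΘ, ← tsum_mul_left]
    refine tsum_congr fun k => ?_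
    rw [← add_assoc]; push_cast; ring
  simp only [zero_add, pow_zero, one_mul, h3] at h1
  simp only [h4, Nat.cast_zero, zero_add, one_mul, sub_self, tsum_zero] at h2
  change hankelDerivSeries u y₁ y₂ = momentDerivSeries u y₂ + _ at h1
  change hankelDerivSeries u y₁ y₂ - hankelSeries u y₁ y₂ = _ at h2
  linear_combination y₂ * h1 - y₁ * h2

/-- For fixed q the covariance recursion is a linear convolution equation in p with kernel F(y₁), so
it is summed over p first. The order of the indices is swapped to make q the outer one. -/
lemma covSeries_eq (hy₁ : ‖y₁‖ < r / 2) (hy₂ : ‖y₂‖ < r / 2) :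
    covSeries u y₁ y₂ * (1 - 2 * u * y₁ ^ 2 * momentSeries u y₁) =
      u * hankelDerivSeries u y₁ y₂ := by
  have hswap : ∀ {f : ℕ × ℕ → ℂ} {v : ℂ}, HasSum f v → HasSum (fun k : ℕ × ℕ => f k.swap) v :=
    fun h => (Equiv.prodComm ℕ ℕ).hasSum_iff.mpr h
  have hF := hasSum_momentSeries hr hu hy₁
  have hC := hswap (hasSum_covSeries hr hu hy₁ hy₂)
  have hH := hswap (hasSum_hankelDerivSeries hr hu hy₁ hy₂)
  have hC1 := hC.prod_fiberwise fun q => (hC.summable.prod_factor q).hasSum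
  have hH1 := hH.prod_fiberwise fun q => (hH.summable.prod_factor q).hasSum
  simp only [Prod.fst_swap, Prod.snd_swap] at hC1 hH1
  refine (hC1.mul_right _).unique ?_
  refine hasSum_of_forall_eq (hH1.mul_left u) fun q => ?_
  have hCq := (hC.summable.prod_factor q).hasSum
  have hHq := (hH.summable.prod_factor q).hasSum
  simp only [Prod.swap_prod_mk] at hCq hHq
  set Cq := ∑' p : ℕ, gueCov u (q + 1) (p + 1) * (y₁ ^ p * y₂ ^ q)
  set Hq := ∑' p : ℕ, ((q + 1 : ℂ) * gueMoment u (p + q)) * (y₁ ^ p * y₂ ^ q)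
  have h1 : HasSum (fun p => gueCov u (q + 1) p * (y₁ ^ p * y₂ ^ q)) (y₁ * Cq) := by
    rw [← hasSum_nat_add_iff' 1]
    simp only [Finset.range_one, Finset.sum_singleton, gueCov_zero, zero_mul, sub_zero]
    refine hasSum_of_forall_eq (hCq.mul_left y₁) fun p => ?_
    ring
  have h2 := ((hasSum_convolution hF h1).mul_left (2 * u * y₁)).add (hHq.mul_left u)
  have h3 : HasSum (fun p => gueCov u (q + 1) (p + 1) * (y₁ ^ p * y₂ ^ q))
      (2 * u * y₁ * (momentSeries u y₁ * (y₁ * Cq)) + u * Hq) := by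
    refine hasSum_of_forall_eq (h2) fun p => ?_
    rw [gueCov_succ, show p + (q + 1) - 1 = p + q by omega, mul_add, add_mul]
    congr 1
    · rw [Finset.mul_sum, Finset.mul_sum, Finset.mul_sum, Finset.sum_mul]
      refine Finset.sum_congr rfl fun k hk => ?_
      have hk := Finset.mem_range.mp hk
      have h6 : y₁ ^ p = y₁ * (y₁ ^ k * y₁ ^ (p - 1 - k)) := by
        rw [← pow_add, ← pow_succ']; congr 1; omega
      rw [h6]
      ring
    · push_cast; ring
  linear_combination hCq.unique h3

/-- Off the diagonal the Hankel relations can be solved, and the quadratic equations for F₁ and F₂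
turn the divided difference of y F into F₁ F₂ / P. -/
lemma hankelDerivSeries_mul_of_ne (hy₁ : ‖y₁‖ < r / 2) (hy₂ : ‖y₂‖ < r / 2) (hne : y₁ ≠ y₂) :
    hankelDerivSeries u y₁ y₂ *
        ((1 - u * y₁ * y₂ * momentSeries u y₁ * momentSeries u y₂) ^ 2 *
          (1 - 2 * u * y₂ ^ 2 * momentSeries u y₂)) =
      momentSeries u y₁ * momentSeries u y₂ := by
  have e1 := momentSeries_eq hr hu hy₁
  have e2 := momentSeries_eq hr hu hy₂
  have e3 := momentDerivSeries_eq hr hu hy₂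
  have e4 := hankelSeries_eq hr hu hy₁ hy₂
  have e5 := hankelDerivSeries_eq hr hu hy₁ hy₂
  set F₁ := momentSeries u y₁
  set F₂ := momentSeries u y₂
  set P := 1 - u * y₁ * y₂ * F₁ * F₂ with hP
  have h1 : (y₂ * F₂ - y₁ * F₁) * P = (y₂ - y₁) * (F₁ * F₂) := by
    rw [hP]; linear_combination (y₁ * F₁) * e2 - y₂ * F₂ * e1
  -- The second factor y₂ - y₁, left over after h1, is cancelled by this identity.
  have h2 : P * y₂ * F₂ - y₁ * (1 - 2 * u * y₂ ^ 2 * F₂) * (F₁ * F₂) = y₂ * F₂ - y₁ * F₁ := by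
    rw [hP]; linear_combination (-y₁ * F₁) * e2
  have h3 : y₂ - y₁ ≠ 0 := sub_ne_zero.mpr hne.symm
  refine mul_left_cancel₀ (pow_ne_zero 2 h3) ?_
  linear_combination (P ^ 2 * (1 - 2 * u * y₂ ^ 2 * F₂) * (y₂ - y₁)) * e5 +
    P ^ 2 * y₂ * (y₂ - y₁) * e3 - P ^ 2 * y₁ * (1 - 2 * u * y₂ ^ 2 * F₂) * e4 -
    P * y₁ * (1 - 2 * u * y₂ ^ 2 * F₂) * h1 + P * (y₂ - y₁) * h2 + (y₂ - y₁) * h1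

lemma continuousOn_momentSeries : ContinuousOn (momentSeries u) (Metric.ball 0 (r / 2)) :=
  continuousOn_tsum (fun p => by fun_prop)
    ((summable_geometric_of_lt_one (r := (1 / 2 : ℝ)) (by norm_num) (by norm_num)).mul_left 2)
    fun p y hy => norm_mul_pow_le (norm_gueMoment_le hr hu p) (mem_ball_zero_iff.mp hy)

lemma continuousOn_hankelDerivSeries (hy₂ : ‖y₂‖ < r / 2) :
    ContinuousOn (fun y₁ => hankelDerivSeries u y₁ y₂) (Metric.ball 0 (r / 2)) :=
  continuousOn_tsum (fun k => by fun_prop) (summable_doubleBound.mul_left 2)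
    fun k y hy => norm_mul_pow_pow_le (norm_succ_mul_gueMoment_add_le hr hu k.1 k.2)
      (mem_ball_zero_iff.mp hy) hy₂

/-- Both sides are continuous in y₁, so the diagonal case is a limit of off-diagonal ones. -/
lemma hankelDerivSeries_mul (hy₁ : ‖y₁‖ < r / 2) (hy₂ : ‖y₂‖ < r / 2) :
    hankelDerivSeries u y₁ y₂ *
        ((1 - u * y₁ * y₂ * momentSeries u y₁ * momentSeries u y₂) ^ 2 *
          (1 - 2 * u * y₂ ^ 2 * momentSeries u y₂)) =
      momentSeries u y₁ * momentSeries u y₂ := by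
  rcases ne_or_eq y₁ y₂ with hne | rfl
  · exact hankelDerivSeries_mul_of_ne hr hu hy₁ hy₂ hne
  have hball : Metric.ball (0 : ℂ) (r / 2) ∈ 𝓝 y₁ :=
    Metric.isOpen_ball.mem_nhds (mem_ball_zero_iff.mpr hy₁)
  have hF := (continuousOn_momentSeries hr hu).continuousAt hball
  have hH := (continuousOn_hankelDerivSeries hr hu hy₁).continuousAt hball
  have hL : ContinuousAt (fun y => hankelDerivSeries u y y₁ *
      ((1 - u * y * y₁ * momentSeries u y * momentSeries u y₁) ^ 2 *
        (1 - 2 * u * y₁ ^ 2 * momentSeries u y₁))) y₁ := by fun_prop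
  have hR : ContinuousAt (fun y => momentSeries u y * momentSeries u y₁) y₁ := by fun_prop
  refine tendsto_nhds_unique_of_eventuallyEq (hL.tendsto.mono_left nhdsWithin_le_nhds)
    (hR.tendsto.mono_left nhdsWithin_le_nhds) (l := 𝓝[≠] y₁) ?_
  filter_upwards [nhdsWithin_le_nhds hball, self_mem_nhdsWithin] with y hy hne
  exact hankelDerivSeries_mul_of_ne hr hu (mem_ball_zero_iff.mp hy) hy₁ hne

end

end GeneratingFunctions

/-! ### The square root and the cut -/

section SquareRoot

variable {z w : ℂ}

lemma csqrt_sq (z : ℂ) : csqrt z ^ 2 = z := by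
  rw [csqrt, one_div]
  exact_mod_cast Complex.cpow_nat_inv_pow z two_ne_zero

lemma csqrt_eq (h : z ^ 2 = w) (hz : 0 < z.re) : csqrt w = z := by
  rw [csqrt, one_div, ← h, Complex.sq_cpow_two_inv hz]

lemma csqrt_re_pos (hz : z ∈ Complex.slitPlane) : 0 < (csqrt z).re := by
  have hz0 := Complex.slitPlane_ne_zero hz
  have harg := Complex.mem_slitPlane_iff_arg.mp hz
  rw [csqrt, Complex.cpow_def_of_ne_zero hz0, Complex.exp_re]
  have h1 : (Complex.log z * (1 / 2)).im = z.arg / 2 := by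
    rw [show (1 / 2 : ℂ) = ((1 / 2 : ℝ) : ℂ) by push_cast; rfl, Complex.im_mul_ofReal,
      Complex.log_im]
    ring
  rw [h1]
  have h2 := Complex.neg_pi_lt_arg z
  have h3 := lt_of_le_of_ne (Complex.arg_le_pi z) harg.1
  exact mul_pos (Real.exp_pos _) (Real.cos_pos_of_mem_Ioo ⟨by linarith, by linarith⟩)

lemma csqrt_re_pos_of_re_pos (hz : 0 < z.re) : 0 < (csqrt z).re :=
  csqrt_re_pos (Or.inl hz)

lemma csqrt_ne_zero (hz : z ≠ 0) : csqrt z ≠ 0 := fun h => hz (by rw [← csqrt_sq z, h]; simp)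

/-- A point of the right half-plane has its root in the sector |Im| < Re; a product of two such
roots has positive real part, hence is the principal root. -/
lemma csqrt_mul (hz : 0 < z.re) (hw : 0 < w.re) : csqrt (z * w) = csqrt z * csqrt w := by
  refine csqrt_eq (by rw [mul_pow, csqrt_sq, csqrt_sq]) ?_
  have h1 : ∀ {z : ℂ}, 0 < z.re → |(csqrt z).im| < (csqrt z).re := by
    intro z hz
    have h2 := congrArg Complex.re (csqrt_sq z)
    rw [pow_two, Complex.mul_re] at h2
    refine abs_lt_of_sq_lt_sq ?_ (csqrt_re_pos_of_re_pos hz).le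
    nlinarith
  have h2 := mul_lt_mul'' (h1 hz) (h1 hw) (abs_nonneg _) (abs_nonneg _)
  rw [← abs_mul] at h2
  rw [Complex.mul_re]
  linarith [le_abs_self ((csqrt z).im * (csqrt w).im)]

end SquareRoot

/-! ### Resolvent and cylinder function off the cut. -/

section Cut

variable {s x x₁ x₂ : ℂ}

lemma ne_zero_of_re_pos (hs : 0 < s.re) : s ≠ 0 := fun h => by simp [h] at hs

lemma real_mul_mem_cut (s : ℂ) {τ : ℝ} (h : |τ| ≤ 1) : (τ : ℂ) * (2 / csqrt s) ∈ cut s := by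
  obtain ⟨h1, h2⟩ := abs_le.mp h
  refine ⟨(1 - τ) / 2, (1 + τ) / 2, by linarith, by linarith, by ring, ?_⟩
  rw [Complex.real_smul, Complex.real_smul]
  push_cast; ring

lemma ne_zero_of_notMem_cut (hx : x ∉ cut s) : x ≠ 0 := by
  rintro rfl
  exact hx (by simpa using real_mul_mem_cut s (τ := 0) (by simp))

/-- If 1 - 4/(s x²) is real and nonpositive, then 4/(s x²) = t ≥ 1 and x = ±(2/√s)/√t lies on the
cut. This makes `sigma` holomorphic and nonzero off the cut. -/
lemma mem_slitPlane_of_notMem_cut (hs : s ≠ 0) (hx : x ∉ cut s) :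
    1 - 4 / (s * x ^ 2) ∈ Complex.slitPlane := by
  have hx0 := ne_zero_of_notMem_cut hx
  by_contra h
  rw [Complex.mem_slitPlane_iff, not_or, not_lt, not_not] at h
  set t : ℝ := (4 / (s * x ^ 2)).re with ht
  have h1 : 4 / (s * x ^ 2) = (t : ℂ) := by
    apply Complex.ext
    · simp [ht]
    · have := h.2
      simp only [Complex.sub_im, Complex.one_im] at this
      simp only [Complex.ofReal_im]; linarith
  have h2 : 1 ≤ t := by
    have := h.1
    simp only [Complex.sub_re, Complex.one_re] at this
    linarith
  have ht0 : 0 < √t := Real.sqrt_pos.mpr (by linarith)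
  have h3 : (√t : ℂ) ^ 2 = t := by
    rw [← Complex.ofReal_pow, Real.sq_sqrt (by linarith)]
  have hc := csqrt_ne_zero hs
  have ht0' : (√t : ℂ) ≠ 0 := by exact_mod_cast ht0.ne'
  have h4 : (x * (√t * csqrt s / 2)) ^ 2 = 1 := by
    rw [div_eq_iff (by positivity)] at h1
    rw [mul_pow, div_pow, mul_pow, h3, csqrt_sq]
    linear_combination -h1 / 4
  have h5 : |(√t)⁻¹| ≤ 1 := by
    rw [abs_of_pos (by positivity)]
    exact inv_le_one_of_one_le₀ (Real.one_le_sqrt.mpr h2)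
  rcases sq_eq_sq_iff_eq_or_eq_neg.mp (h4.trans (one_pow 2).symm) with h6 | h6
  · apply hx
    convert real_mul_mem_cut s h5 using 1
    push_cast
    field_simp
    linear_combination 2 * h6
  · apply hx
    convert real_mul_mem_cut s (τ := -(√t)⁻¹) (by rwa [abs_neg]) using 1
    push_cast
    field_simp
    linear_combination 2 * h6

lemma sigma_sq (hx : x ≠ 0) (s : ℂ) : sigma s x ^ 2 = x ^ 2 - 4 / s := by
  rw [sigma, mul_pow, csqrt_sq, mul_sub, mul_one]
  by_cases hs : s = 0
  · simp [hs]
  · field_simp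

lemma sigma_ne_zero (hs : s ≠ 0) (hx : x ∉ cut s) : sigma s x ≠ 0 :=
  mul_ne_zero (ne_zero_of_notMem_cut hx)
    (csqrt_ne_zero (Complex.slitPlane_ne_zero (mem_slitPlane_of_notMem_cut hs hx)))

lemma differentiableAt_sigma (hs : s ≠ 0) (hx : x ∉ cut s) : DifferentiableAt ℂ (sigma s) x := by
  have hx0 := ne_zero_of_notMem_cut hx
  unfold sigma csqrt
  refine differentiableAt_id.mul (DifferentiableAt.cpow ?_ (differentiableAt_const _)
    (mem_slitPlane_of_notMem_cut hs hx))
  refine (differentiableAt_const _).sub ((differentiableAt_const _).div ?_ ?_)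
  · fun_prop
  · exact mul_ne_zero hs (pow_ne_zero 2 hx0)

/-- Up to the common factor x this is |1 - c| < |1 + c|, which holds because the principal root c
has positive real part. -/
lemma norm_sub_sigma_lt (hs : s ≠ 0) (hx : x ∉ cut s) : ‖x - sigma s x‖ < ‖x + sigma s x‖ := by
  have h := csqrt_re_pos (mem_slitPlane_of_notMem_cut hs hx)
  set c := csqrt (1 - 4 / (s * x ^ 2)) with hc
  have h1 : x - sigma s x = x * (1 - c) := by rw [sigma]; ring
  have h2 : x + sigma s x = x * (1 + c) := by rw [sigma]; ring
  rw [h1, h2, norm_mul, norm_mul]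
  refine mul_lt_mul_of_pos_left ?_ (norm_pos_iff.mpr (ne_zero_of_notMem_cut hx))
  refine lt_of_pow_lt_pow_left₀ 2 (norm_nonneg _) ?_
  rw [← Complex.normSq_eq_norm_sq, ← Complex.normSq_eq_norm_sq, Complex.normSq_apply,
    Complex.normSq_apply]
  simp only [Complex.sub_re, Complex.add_re, Complex.sub_im, Complex.add_im, Complex.one_re,
    Complex.one_im]
  nlinarith

/-- The planar resolvent of the Gaussian unitary ensemble. -/
def gueResolvent (s x : ℂ) : ℂ := s / 2 * (x - sigma s x)

lemma resolvent_mul (hs : s ≠ 0) (hx : x ∉ cut s) : gueResolvent s x * (x + sigma s x) = 2 := by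
  have h := sigma_sq (ne_zero_of_notMem_cut hx) s
  rw [gueResolvent]
  field_simp at h ⊢
  linear_combination -h

lemma resolvent_ne_zero (hs : s ≠ 0) (hx : x ∉ cut s) : gueResolvent s x ≠ 0 := fun h => by
  have := resolvent_mul hs hx
  simp [h] at this

lemma sigma_eq (hs : s ≠ 0) (x : ℂ) : sigma s x = x - 2 * s⁻¹ * gueResolvent s x := by
  rw [gueResolvent]; field_simp; ring

lemma resolvent_eq (hs : s ≠ 0) (hx : x ∉ cut s) :
    x * gueResolvent s x = 1 + s⁻¹ * gueResolvent s x ^ 2 := by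
  have h := resolvent_mul hs hx
  rw [sigma_eq hs] at h
  linear_combination h / 2

/-- The quantity equals (x - σ)/(x + σ); in Joukowsky coordinates it is 1/z². -/
lemma norm_resolvent_sq_lt (hs : s ≠ 0) (hx : x ∉ cut s) : ‖s⁻¹ * gueResolvent s x ^ 2‖ < 1 := by
  have h := norm_sub_sigma_lt hs hx
  have h1 : s⁻¹ * gueResolvent s x ^ 2 * (x + sigma s x) = x - sigma s x := by
    have h2 := sigma_eq hs x
    linear_combination (s⁻¹ * gueResolvent s x) * resolvent_mul hs hx + h2
  have h3 : 0 < ‖x + sigma s x‖ := (norm_nonneg _).trans_lt h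
  rw [← h1, norm_mul] at h
  exact (mul_lt_iff_lt_one_left h3).mp h

lemma one_sub_resolvent_mul_ne_zero (hs : s ≠ 0) (hx₁ : x₁ ∉ cut s) (hx₂ : x₂ ∉ cut s) :
    1 - s⁻¹ * gueResolvent s x₁ * gueResolvent s x₂ ≠ 0 := by
  intro h
  have h1 : (s⁻¹ * gueResolvent s x₁ ^ 2) * (s⁻¹ * gueResolvent s x₂ ^ 2) = 1 := by
    linear_combination (-1 - s⁻¹ * gueResolvent s x₁ * gueResolvent s x₂) * h
  have h2 := mul_lt_mul'' (norm_resolvent_sq_lt hs hx₁) (norm_resolvent_sq_lt hs hx₂)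
    (norm_nonneg _) (norm_nonneg _)
  rw [← norm_mul, h1] at h2
  simp at h2

lemma differentiableAt_resolvent (hs : s ≠ 0) (hx : x ∉ cut s) :
    DifferentiableAt ℂ (gueResolvent s) x :=
  (differentiableAt_id.sub (differentiableAt_sigma hs hx)).const_mul _

/-- The planar cylinder function of the Gaussian unitary ensemble. -/
def gueCylinder (s x₁ x₂ : ℂ) : ℂ :=
  s⁻¹ * (gueResolvent s x₁ * gueResolvent s x₂) /
    ((1 - s⁻¹ * gueResolvent s x₁ * gueResolvent s x₂) ^ 2 * (sigma s x₁ * sigma s x₂))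

/-- Expressed through W, the cylinder function has no factor x₁ - x₂ in its denominator, so the
diagonal needs no separate treatment. -/
lemma differentiableOn_gueCylinder (hs : s ≠ 0) :
    DifferentiableOn ℂ (fun x : ℂ × ℂ => gueCylinder s x.1 x.2) ((cut s)ᶜ ×ˢ (cut s)ᶜ) := by
  rintro ⟨x₁, x₂⟩ ⟨hx₁, hx₂⟩
  have hr₁ : DifferentiableAt ℂ (fun x : ℂ × ℂ => gueResolvent s x.1) (x₁, x₂) :=
    (differentiableAt_resolvent hs hx₁).comp (x₁, x₂) differentiableAt_fst
  have hr₂ : DifferentiableAt ℂ (fun x : ℂ × ℂ => gueResolvent s x.2) (x₁, x₂) :=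
    (differentiableAt_resolvent hs hx₂).comp (x₁, x₂) differentiableAt_snd
  have hs₁ : DifferentiableAt ℂ (fun x : ℂ × ℂ => sigma s x.1) (x₁, x₂) :=
    (differentiableAt_sigma hs hx₁).comp (x₁, x₂) differentiableAt_fst
  have hs₂ : DifferentiableAt ℂ (fun x : ℂ × ℂ => sigma s x.2) (x₁, x₂) :=
    (differentiableAt_sigma hs hx₂).comp (x₁, x₂) differentiableAt_snd
  simp only [gueCylinder, div_eq_mul_inv _ (_ ^ 2 * _)]
  refine DifferentiableAt.differentiableWithinAt
    (DifferentiableAt.fun_mul ?_ (DifferentiableAt.fun_inv ?_ ?_))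
  · exact (hr₁.mul hr₂).const_mul _
  · exact ((((hr₁.const_mul _).mul hr₂).const_sub 1).pow 2).mul (hs₁.mul hs₂)
  · exact mul_ne_zero (pow_ne_zero 2 (one_sub_resolvent_mul_ne_zero hs hx₁ hx₂))
      (mul_ne_zero (sigma_ne_zero hs hx₁) (sigma_ne_zero hs hx₂))

lemma sub_mul_resolvent (hs : s ≠ 0) (hx₁ : x₁ ∉ cut s) (hx₂ : x₂ ∉ cut s) :
    (x₁ - x₂) * (gueResolvent s x₁ * gueResolvent s x₂) =
      (gueResolvent s x₂ - gueResolvent s x₁) * (1 - s⁻¹ * gueResolvent s x₁ * gueResolvent s x₂) := by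
  linear_combination gueResolvent s x₂ * resolvent_eq hs hx₁ - gueResolvent s x₁ * resolvent_eq hs hx₂

/-- The relation (x₁ - x₂) W₁ W₂ = (W₂ - W₁)(1 - W₁ W₂ / s) trades the denominator 1 - W₁ W₂ / s for
x₁ - x₂. -/
lemma gueCylinder_eq (hs : s ≠ 0) (hx₁ : x₁ ∉ cut s) (hx₂ : x₂ ∉ cut s) (hne : x₁ ≠ x₂) :
    gueCylinder s x₁ x₂ = (x₁ * x₂ - sigma s x₁ * sigma s x₂ - 4 / s) /
      (2 * (x₁ - x₂) ^ 2 * sigma s x₁ * sigma s x₂) := by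
  have h1 := sigma_ne_zero hs hx₁
  have h2 := sigma_ne_zero hs hx₂
  have h3 := one_sub_resolvent_mul_ne_zero hs hx₁ hx₂
  have h4 := sub_ne_zero.mpr hne
  have h5 := sub_mul_resolvent hs hx₁ hx₂
  have e1 := resolvent_eq hs hx₁
  have e2 := resolvent_eq hs hx₂
  have n1 := resolvent_ne_zero hs hx₁
  have n2 := resolvent_ne_zero hs hx₂
  have s1 := sigma_eq hs x₁
  have s2 := sigma_eq hs x₂
  rw [gueCylinder, div_eq_div_iff (mul_ne_zero (pow_ne_zero 2 h3) (mul_ne_zero h1 h2))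
    (mul_ne_zero (mul_ne_zero (mul_ne_zero two_ne_zero (pow_ne_zero 2 h4)) h1) h2)]
  generalize gueResolvent s x₁ = W₁ at *
  generalize gueResolvent s x₂ = W₂ at *
  generalize sigma s x₁ = σ₁ at *
  generalize sigma s x₂ = σ₂ at *
  rw [div_eq_mul_inv]
  generalize s⁻¹ = u at *
  have h6 : (x₁ * x₂ - σ₁ * σ₂ - 4 * u) * (W₁ * W₂) = 2 * u * (W₁ - W₂) ^ 2 := by
    rw [s1, s2]
    linear_combination (2 * u * W₂ ^ 2) * e1 + 2 * u * W₁ ^ 2 * e2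
  refine mul_right_cancel₀ (mul_ne_zero n1 n2) ?_
  linear_combination (2 * u * σ₁ * σ₂ * ((x₁ - x₂) * (W₁ * W₂) +
    (W₂ - W₁) * (1 - u * W₁ * W₂))) * h5 - (1 - u * W₁ * W₂) ^ 2 * (σ₁ * σ₂) * h6

end Cut

/-! ### Expansions at infinity -/

section Expansion

variable {s x x₁ x₂ : ℂ} {r : ℝ}

lemma norm_inv_lt (hr : 0 < r) (hx : 2 / r < ‖x‖) : ‖x⁻¹‖ < r / 2 := by
  rw [norm_inv, ← inv_div]
  exact inv_strictAnti₀ (by positivity) hx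

lemma ne_zero_of_lt_norm (hr : 0 < r) (hx : 2 / r < ‖x‖) : x ≠ 0 :=
  norm_pos_iff.mp ((by positivity : 0 < 2 / r).trans hx)

lemma exists_radius (u : ℂ) : ∃ r : ℝ, 0 < r ∧ ‖u‖ * r ^ 2 ≤ 1 / 16 := by
  have h := norm_nonneg u
  refine ⟨1 / (4 * (‖u‖ + 1)), by positivity, ?_⟩
  rw [div_pow, mul_div_assoc', div_le_div_iff₀ (by positivity) (by norm_num)]
  nlinarith

section

variable (hs : s ≠ 0) (hr : 0 < r) (hu : ‖s⁻¹‖ * r ^ 2 ≤ 1 / 16)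
include hs hr hu

lemma norm_mul_momentSeries_lt (hx₁ : 2 / r < ‖x₁‖) (hx₂ : 2 / r < ‖x₂‖) :
    ‖s⁻¹ * x₁⁻¹ * x₂⁻¹‖ * 2 < 1 / 16 := by
  have h1 := mul_lt_mul'' (norm_inv_lt hr hx₁) (norm_inv_lt hr hx₂) (norm_nonneg _) (norm_nonneg _)
  rw [norm_mul, norm_mul, mul_assoc ‖s⁻¹‖]
  have h2 : 0 < ‖s⁻¹‖ := norm_pos_iff.mpr (inv_ne_zero hs)
  nlinarith

lemma one_sub_momentSeries_re_pos (hx : 2 / r < ‖x‖) :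
    0 < (1 - 2 * s⁻¹ * x⁻¹ ^ 2 * momentSeries s⁻¹ x⁻¹).re := by
  have h1 := norm_mul_momentSeries_lt hs hr hu hx hx
  have h2 := norm_momentSeries_le hr hu (norm_inv_lt hr hx)
  have h3 : ‖2 * s⁻¹ * x⁻¹ ^ 2 * momentSeries s⁻¹ x⁻¹‖ ≤ ‖s⁻¹ * x⁻¹ * x⁻¹‖ * 2 * 2 := by
    rw [show 2 * s⁻¹ * x⁻¹ ^ 2 * momentSeries s⁻¹ x⁻¹ =
      s⁻¹ * x⁻¹ * x⁻¹ * 2 * momentSeries s⁻¹ x⁻¹ by ring, norm_mul, norm_mul _ (2 : ℂ),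
      Complex.norm_ofNat]
    exact mul_le_mul_of_nonneg_left h2 (by positivity)
  have h4 := Complex.re_le_norm (2 * s⁻¹ * x⁻¹ ^ 2 * momentSeries s⁻¹ x⁻¹)
  rw [Complex.sub_re, Complex.one_re]
  linarith

/-- By F = 1 + u y² F² the bracket squares to 1 - 4 u y², and its positive real part identifies it
as the principal root. -/
lemma sigma_eq_mul (hx : 2 / r < ‖x‖) :
    sigma s x = x * (1 - 2 * s⁻¹ * x⁻¹ ^ 2 * momentSeries s⁻¹ x⁻¹) := by
  have hx0 := ne_zero_of_lt_norm hr hx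
  have h1 := momentSeries_eq hr hu (norm_inv_lt hr hx)
  rw [sigma, csqrt_eq ?_ (one_sub_momentSeries_re_pos hs hr hu hx)]
  rw [show 4 / (s * x ^ 2) = 4 * s⁻¹ * x⁻¹ ^ 2 by field_simp]
  linear_combination (-4 * s⁻¹ * x⁻¹ ^ 2) * h1

lemma resolvent_eq_mul (hx : 2 / r < ‖x‖) : gueResolvent s x = x⁻¹ * momentSeries s⁻¹ x⁻¹ := by
  have hx0 := ne_zero_of_lt_norm hr hx
  rw [gueResolvent, sigma_eq_mul hs hr hu hx]
  field_simp
  ring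

lemma hasSum_resolvent (hx : 2 / r < ‖x‖) :
    HasSum (fun p => gueMoment s⁻¹ p / x ^ (p + 1)) (gueResolvent s x) := by
  rw [resolvent_eq_mul hs hr hu hx]
  refine hasSum_of_forall_eq ((hasSum_momentSeries hr hu (norm_inv_lt hr hx)).mul_left x⁻¹)
    fun p => ?_
  rw [inv_pow, pow_succ, div_eq_mul_inv, mul_inv]
  ring

/-- The quotient W/σ is -W', whose expansion has the coefficients p m_(p-1). -/
lemma hasSum_resolvent_div_sigma (hx : 2 / r < ‖x‖) :
    HasSum (fun p : ℕ => (p * gueMoment s⁻¹ (p - 1)) / x ^ (p + 1))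
      (gueResolvent s x / sigma s x) := by
  have hx0 := ne_zero_of_lt_norm hr hx
  have hτ : 1 - 2 * s⁻¹ * x⁻¹ ^ 2 * momentSeries s⁻¹ x⁻¹ ≠ 0 :=
    ne_zero_of_re_pos (one_sub_momentSeries_re_pos hs hr hu hx)
  have h1 := momentDerivSeries_eq hr hu (norm_inv_lt hr hx)
  have h2 : gueResolvent s x / sigma s x = x⁻¹ ^ 2 * momentDerivSeries s⁻¹ x⁻¹ := by
    rw [resolvent_eq_mul hs hr hu hx, sigma_eq_mul hs hr hu hx, div_eq_iff (mul_ne_zero hx0 hτ)]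
    rw [show x⁻¹ ^ 2 * momentDerivSeries s⁻¹ x⁻¹ *
      (x * (1 - 2 * s⁻¹ * x⁻¹ ^ 2 * momentSeries s⁻¹ x⁻¹)) = x⁻¹ ^ 2 * x *
        (momentDerivSeries s⁻¹ x⁻¹ * (1 - 2 * s⁻¹ * x⁻¹ ^ 2 * momentSeries s⁻¹ x⁻¹)) by ring, h1]
    congr 1
    field_simp
  rw [h2, ← hasSum_nat_add_iff' 1]
  simp only [Finset.range_one, Finset.sum_singleton, Nat.cast_zero, zero_mul, zero_div, sub_zero]
  refine hasSum_of_forall_eq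
    ((hasSum_momentDerivSeries hr hu (norm_inv_lt hr hx)).mul_left (x⁻¹ ^ 2)) fun p => ?_
  rw [Nat.add_sub_cancel, div_eq_mul_inv, ← inv_pow]
  push_cast
  ring

lemma hasSum_gueCylinder (hx₁ : 2 / r < ‖x₁‖) (hx₂ : 2 / r < ‖x₂‖) :
    HasSum (fun k : ℕ × ℕ => gueCov s⁻¹ k.2 k.1 / (x₁ ^ (k.1 + 1) * x₂ ^ (k.2 + 1)))
      (gueCylinder s x₁ x₂) := by
  have hy₁ := norm_inv_lt hr hx₁
  have hy₂ := norm_inv_lt hr hx₂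
  have n₁ := ne_zero_of_lt_norm hr hx₁
  have n₂ := ne_zero_of_lt_norm hr hx₂
  have h1 := covSeries_eq hr hu hy₁ hy₂
  have h2 := hankelDerivSeries_mul hr hu hy₁ hy₂
  have hτ₁ := ne_zero_of_re_pos (one_sub_momentSeries_re_pos hs hr hu hx₁)
  have hτ₂ := ne_zero_of_re_pos (one_sub_momentSeries_re_pos hs hr hu hx₂)
  have hP : 1 - s⁻¹ * x₁⁻¹ * x₂⁻¹ * momentSeries s⁻¹ x₁⁻¹ * momentSeries s⁻¹ x₂⁻¹ ≠ 0 := by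
    intro h
    have h3 := norm_mul_momentSeries_lt hs hr hu hx₁ hx₂
    have h4 := congrArg norm (sub_eq_zero.mp h)
    rw [norm_one, norm_mul, norm_mul _ (momentSeries s⁻¹ x₁⁻¹)] at h4
    have h5 := mul_le_mul_of_nonneg_left (norm_momentSeries_le hr hu hy₁)
      (norm_nonneg (s⁻¹ * x₁⁻¹ * x₂⁻¹))
    have h6 := mul_le_mul h5 (norm_momentSeries_le hr hu hy₂) (norm_nonneg _) (by positivity)
    linarith
  have h3 : gueCylinder s x₁ x₂ = x₁⁻¹ ^ 2 * x₂⁻¹ ^ 2 * covSeries s⁻¹ x₁⁻¹ x₂⁻¹ := by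
    rw [gueCylinder, resolvent_eq_mul hs hr hu hx₁, resolvent_eq_mul hs hr hu hx₂,
      sigma_eq_mul hs hr hu hx₁, sigma_eq_mul hs hr hu hx₂]
    generalize momentSeries s⁻¹ x₁⁻¹ = F₁ at *
    generalize momentSeries s⁻¹ x₂⁻¹ = F₂ at *
    generalize covSeries s⁻¹ x₁⁻¹ x₂⁻¹ = C at *
    generalize hankelDerivSeries s⁻¹ x₁⁻¹ x₂⁻¹ = H at *
    have e₁ : x₁⁻¹ * x₁ = 1 := inv_mul_cancel₀ n₁
    have e₂ : x₂⁻¹ * x₂ = 1 := inv_mul_cancel₀ n₂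
    generalize x₁⁻¹ = y₁ at *
    generalize x₂⁻¹ = y₂ at *
    generalize s⁻¹ = u at *
    rw [show 1 - u * (y₁ * F₁) * (y₂ * F₂) = 1 - u * y₁ * y₂ * F₁ * F₂ by ring,
      div_eq_iff (mul_ne_zero (pow_ne_zero 2 hP) (mul_ne_zero (mul_ne_zero n₁ hτ₁)
        (mul_ne_zero n₂ hτ₂)))]
    set P := 1 - u * y₁ * y₂ * F₁ * F₂
    set τ₁ := 1 - 2 * u * y₁ ^ 2 * F₁
    set τ₂ := 1 - 2 * u * y₂ ^ 2 * F₂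
    have h4 : y₁ ^ 2 * y₂ ^ 2 * C * (P ^ 2 * (x₁ * τ₁ * (x₂ * τ₂))) =
        y₁ * y₂ * (C * τ₁) * (P ^ 2 * τ₂) * (y₁ * x₁) * (y₂ * x₂) := by ring
    rw [h4, e₁, e₂, h1]
    linear_combination (-u * y₁ * y₂) * h2
  -- Covariances with tr M^0 vanish, so the double series effectively starts at p = q = 1, matching
  -- the shift in `covSeries`.
  have hinj : Function.Injective fun k : ℕ × ℕ => (k.1 + 1, k.2 + 1) := fun k k' hk => by
    simp only [Prod.mk.injEq, Nat.add_right_cancel_iff] at hk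
    exact Prod.ext hk.1 hk.2
  rw [← hinj.hasSum_iff]
  · rw [h3]
    refine hasSum_of_forall_eq ((hasSum_covSeries hr hu hy₁ hy₂).mul_left
      (x₁⁻¹ ^ 2 * x₂⁻¹ ^ 2)) fun k => ?_
    simp only [Function.comp_apply]
    rw [div_eq_mul_inv, mul_inv, ← inv_pow, ← inv_pow]
    ring
  · rintro ⟨p, q⟩ hpq
    rcases p with _ | p
    · simp [gueCov_zero]
    · rcases q with _ | q
      · simp [gueCov_zero_left]
      · exact absurd ⟨(p, q), rfl⟩ hpq

end

end Expansion

/-! ### Joukowsky coordinates -/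

section Joukowsky

variable {s z : ℂ}

lemma ne_zero_of_one_lt_norm (hz : 1 < ‖z‖) : z ≠ 0 :=
  norm_pos_iff.mp (zero_lt_one.trans hz)

/-- A point of the cut gives z + 1/z = 2τ with τ real and |τ| ≤ 1, which forces |z| = 1. -/
lemma joukowsky_notMem_cut (hs : s ≠ 0) (hz : 1 < ‖z‖) : joukowsky s z ∉ cut s := by
  rintro ⟨a, b, ha, hb, hab, h⟩
  have hz0 := ne_zero_of_one_lt_norm hz
  have hc := csqrt_ne_zero hs
  rw [joukowsky, Complex.real_smul, Complex.real_smul] at h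
  have h1 : z ^ 2 + 1 = 2 * ((b - a : ℝ) : ℂ) * z := by
    push_cast
    field_simp at h
    linear_combination -h
  set τ := b - a with hτ
  have hτ1 : τ ^ 2 ≤ 1 := by nlinarith
  have h2 := congrArg Complex.re h1
  have h3 := congrArg Complex.im h1
  simp only [pow_two, Complex.add_re, Complex.mul_re, Complex.add_im, Complex.mul_im,
    Complex.one_re, Complex.one_im, Complex.re_ofNat, Complex.im_ofNat, Complex.ofReal_re,
    Complex.ofReal_im] at h2 h3
  have h4 : z.im * (z.re - τ) = 0 := by linarith
  have h5 : 1 < z.re * z.re + z.im * z.im := by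
    rw [← Complex.normSq_apply, Complex.normSq_eq_norm_sq]
    nlinarith
  rcases mul_eq_zero.mp h4 with h6 | h6
  · rw [h6] at h2 h5
    nlinarith [sq_nonneg (z.re - τ)]
  · have h7 : z.re = τ := by linarith
    rw [h7] at h2 h5
    nlinarith

/-- The root of 1 - 4/(s x²) is (z² - 1)/(z² + 1), principal because its real part has the sign of
|z²|² - 1. -/
lemma sigma_joukowsky (hs : s ≠ 0) (hz : 1 < ‖z‖) :
    sigma s (joukowsky s z) = 1 / csqrt s * (z - 1 / z) := by
  have hz0 := ne_zero_of_one_lt_norm hz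
  have hc := csqrt_ne_zero hs
  have hcs := csqrt_sq s
  have hz2 : z ^ 2 + 1 ≠ 0 := by
    intro h
    have h1 := congrArg norm (eq_neg_of_add_eq_zero_left h)
    rw [norm_neg, norm_one, norm_pow] at h1
    nlinarith
  have h1 : csqrt (1 - 4 / (s * joukowsky s z ^ 2)) = (z ^ 2 - 1) / (z ^ 2 + 1) := by
    refine csqrt_eq ?_ ?_
    · have h2 : s * joukowsky s z ^ 2 = (z ^ 2 + 1) ^ 2 / z ^ 2 := by
        rw [joukowsky]
        nth_rewrite 1 [← hcs]
        field_simp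
      rw [h2]
      field_simp
      ring
    · rw [Complex.div_re, ← add_div]
      refine div_pos ?_ (Complex.normSq_pos.mpr hz2)
      have h3 : 1 < ‖z ^ 2‖ := by rw [norm_pow]; nlinarith
      have h4 : 1 < (z ^ 2).re * (z ^ 2).re + (z ^ 2).im * (z ^ 2).im := by
        rw [← Complex.normSq_apply, Complex.normSq_eq_norm_sq]
        nlinarith
      simp only [Complex.sub_re, Complex.add_re, Complex.sub_im, Complex.add_im, Complex.one_re,
        Complex.one_im]
      nlinarith
  rw [sigma, h1, joukowsky]
  field_simp

lemma resolvent_joukowsky (hs : s ≠ 0) (hz : 1 < ‖z‖) :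
    gueResolvent s (joukowsky s z) = csqrt s / z := by
  have hz0 := ne_zero_of_one_lt_norm hz
  have hc := csqrt_ne_zero hs
  rw [gueResolvent, sigma_joukowsky hs hz, joukowsky]
  nth_rewrite 1 [← csqrt_sq s]
  field_simp
  ring

lemma deriv_joukowsky (s : ℂ) (hz : z ≠ 0) :
    deriv (joukowsky s) z = 1 / csqrt s * (1 - 1 / z ^ 2) := by
  have h : HasDerivAt (fun z : ℂ => 1 / csqrt s * (z + z⁻¹)) (1 / csqrt s * (1 + -(z ^ 2)⁻¹)) z :=
    ((hasDerivAt_id z).add (hasDerivAt_inv hz)).const_mul _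
  have h1 : joukowsky s = fun z : ℂ => 1 / csqrt s * (z + z⁻¹) := by
    funext z; rw [joukowsky, one_div z]
  rw [h1, h.deriv]
  ring

lemma deriv_joukowsky_eq (hs : s ≠ 0) (hz : 1 < ‖z‖) :
    deriv (joukowsky s) z = sigma s (joukowsky s z) / z := by
  have hz0 := ne_zero_of_one_lt_norm hz
  have hc := csqrt_ne_zero hs
  rw [deriv_joukowsky s hz0, sigma_joukowsky hs hz]
  field_simp

variable {z₁ z₂ : ℂ}

/-- The cylinder term becomes 1/(z₁z₂ - 1)². From (z₁z₂ - 1)² - (z₁ - z₂)² = (z₁² - 1)(z₂² - 1) the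
term dx₁dx₂/(x₁ - x₂)² becomes 1/(z₁ - z₂)² - 1/(z₁z₂ - 1)², and the sum is the standard double
pole. -/
lemma gueCylinder_joukowsky (hs : s ≠ 0) (hz₁ : 1 < ‖z₁‖) (hz₂ : 1 < ‖z₂‖) (hne : z₁ ≠ z₂) :
    gueCylinder s (joukowsky s z₁) (joukowsky s z₂) * deriv (joukowsky s) z₁ *
        deriv (joukowsky s) z₂ +
      deriv (joukowsky s) z₁ * deriv (joukowsky s) z₂ / (joukowsky s z₁ - joukowsky s z₂) ^ 2 =
    1 / (z₁ - z₂) ^ 2 := by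
  have n₁ := ne_zero_of_one_lt_norm hz₁
  have n₂ := ne_zero_of_one_lt_norm hz₂
  have hc := csqrt_ne_zero hs
  have hcs := csqrt_sq s
  have hd : z₁ - z₂ ≠ 0 := sub_ne_zero.mpr hne
  have hp : z₁ * z₂ - 1 ≠ 0 := by
    intro h
    have h1 := congrArg norm (sub_eq_zero.mp h)
    rw [norm_mul, norm_one] at h1
    nlinarith
  have hσ₁ := sigma_ne_zero hs (joukowsky_notMem_cut hs hz₁)
  have hσ₂ := sigma_ne_zero hs (joukowsky_notMem_cut hs hz₂)
  have h1 : s⁻¹ * (csqrt s / z₁) * (csqrt s / z₂) = 1 / (z₁ * z₂) := by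
    rw [show s⁻¹ * (csqrt s / z₁) * (csqrt s / z₂) = s⁻¹ * csqrt s ^ 2 / (z₁ * z₂) by
      field_simp, hcs, inv_mul_cancel₀ hs]
  have h2 : gueCylinder s (joukowsky s z₁) (joukowsky s z₂) * deriv (joukowsky s) z₁ *
      deriv (joukowsky s) z₂ = 1 / (z₁ * z₂ - 1) ^ 2 := by
    rw [deriv_joukowsky_eq hs hz₁, deriv_joukowsky_eq hs hz₂, gueCylinder,
      resolvent_joukowsky hs hz₁, resolvent_joukowsky hs hz₂, ← mul_assoc s⁻¹, h1,
      show 1 - 1 / (z₁ * z₂) = (z₁ * z₂ - 1) / (z₁ * z₂) by field_simp]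
    field_simp
  have h3 : joukowsky s z₁ - joukowsky s z₂ =
      1 / csqrt s * ((z₁ - z₂) * (z₁ * z₂ - 1) / (z₁ * z₂)) := by
    rw [joukowsky, joukowsky]; field_simp; ring
  rw [h2, h3, deriv_joukowsky s n₁, deriv_joukowsky s n₂]
  field_simp
  ring

lemma resolvent_div_sigma_joukowsky (hs : s ≠ 0) (hz : 1 < ‖z‖) :
    gueResolvent s (joukowsky s z) / sigma s (joukowsky s z) * deriv (joukowsky s) z =
      csqrt s / z ^ 2 := by
  have hσ := sigma_ne_zero hs (joukowsky_notMem_cut hs hz)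
  have hz0 := ne_zero_of_one_lt_norm hz
  rw [deriv_joukowsky_eq hs hz, resolvent_joukowsky hs hz]
  field_simp

end Joukowsky

/-! ### Large `N` limits of the correlations -/

section Limits

variable {d : ℕ}

/-- The normalised correlations of the matrix model with sources. -/
def modelSystem (d : ℕ) (N : ℕ) (l : Multiset (Label d)) : MvPowerSeries (Var d) ℂ :=
  sourceExpect 1 (modelCoupling d) (l.map (normTr N)).prod

/-- The normalised correlations of the Gaussian unitary ensemble with sources. -/
def gueSystem (s : ℂ) (N : ℕ) (l : Multiset (Label 1)) : MvPowerSeries (Var 1) ℂ :=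
  sourceExpect s 0 (l.map (normTr N)).prod

lemma isLoopSystem_modelSystem :
    IsLoopSystem 1 (sourceCoupling (modelCoupling d)) (modelSystem d) :=
  isLoopSystem_sourceExpect (by simp) modelCoupling_zero

lemma isLoopSystem_gueSystem {s : ℂ} (hs : 0 < s.re) :
    IsLoopSystem s (sourceCoupling 0) (gueSystem s) :=
  isLoopSystem_sourceExpect hs fun _ => rfl

lemma tendsto_moment (hd : 3 ≤ d) (c : Fin d) (p : ℕ) (a : Fin d →₀ ℕ) :
    Tendsto (fun N : ℕ => (N : ℂ)⁻¹ * MvPowerSeries.coeff a (moment N c p)) atTop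
      (𝓝 (MvPowerSeries.coeff a (limitMoment (modelSystem d) c p))) := by
  rw [limitMoment, MvPowerSeries.coeff_killCompl]
  refine (isLoopSystem_modelSystem.tendsto_single (tendsto_sourceCoupling
    (tendsto_modelCoupling hd)) one_ne_zero (c, p) _).congr' ?_
  filter_upwards [eventually_ne_atTop 0] with N hN
  rw [moment_eq hN, MvPowerSeries.coeff_C_mul, inv_mul_cancel_left₀ (Nat.cast_ne_zero.mpr hN),
    MvPowerSeries.coeff_killCompl, modelSystem, Multiset.map_singleton, Multiset.prod_singleton]

lemma tendsto_covariance (hd : 3 ≤ d) (i j : Fin d) (p q : ℕ) (a : Fin d →₀ ℕ) :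
    Tendsto (fun N : ℕ => MvPowerSeries.coeff a (covariance N i j p q)) atTop
      (𝓝 (MvPowerSeries.coeff a (limitCov (modelSystem d) (j, q) i p))) := by
  rw [limitCov, MvPowerSeries.coeff_killCompl, MvPowerSeries.coeff_pderiv]
  refine ((isLoopSystem_modelSystem.tendsto_single (tendsto_sourceCoupling
    (tendsto_modelCoupling hd)) one_ne_zero (i, p) _).mul_const _).congr' ?_
  filter_upwards [eventually_ne_atTop 0] with N hN
  rw [covariance_eq hN, MvPowerSeries.coeff_killCompl, MvPowerSeries.coeff_pderiv, modelSystem,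
    Multiset.map_singleton, Multiset.prod_singleton]

lemma tendsto_gueExpect_trace {s : ℂ} (hs : 0 < s.re) (p : ℕ) :
    Tendsto (fun N : ℕ => (N : ℂ)⁻¹ * gueExpect N s (fun M => (M ^ p).trace)) atTop
      (𝓝 (gueMoment s⁻¹ p)) := by
  have h := isLoopSystem_gueSystem hs
  have hs0 := ne_zero_of_re_pos hs
  rw [← constantCoeff_limitMoment_gue h hs0 p, ← MvPowerSeries.coeff_zero_eq_constantCoeff_apply]
  refine (h.tendsto_single (tendsto_sourceCoupling (g' := 0) fun _ => tendsto_const_nhds) hs0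
    (0, p) 0).congr' ?_
  filter_upwards [eventually_ne_atTop 0] with N hN
  rw [gueExpect_trace hs hN, inv_mul_cancel_left₀ (Nat.cast_ne_zero.mpr hN), gueSystem,
    Multiset.map_singleton, Multiset.prod_singleton, MvPowerSeries.coeff_zero_eq_constantCoeff_apply]

lemma tendsto_gueExpect_covariance {s : ℂ} (hs : 0 < s.re) (p q : ℕ) :
    Tendsto (fun N : ℕ => gueExpect N s (fun M => (M ^ p).trace * (M ^ q).trace) -
      gueExpect N s (fun M => (M ^ p).trace) * gueExpect N s (fun M => (M ^ q).trace)) atTop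
      (𝓝 (gueCov s⁻¹ q p)) := by
  have h := isLoopSystem_gueSystem hs
  have hs0 := ne_zero_of_re_pos hs
  rw [← constantCoeff_limitCov_gue h hs0 p q, ← MvPowerSeries.coeff_zero_eq_constantCoeff_apply,
    MvPowerSeries.coeff_pderiv]
  refine ((h.tendsto_single (tendsto_sourceCoupling (g' := 0) fun _ => tendsto_const_nhds) hs0
    (0, p) _).mul_const _).congr' ?_
  filter_upwards [eventually_ne_atTop 0] with N hN
  rw [gueExpect_covariance hs hN, ← MvPowerSeries.coeff_zero_eq_constantCoeff_apply,
    MvPowerSeries.coeff_pderiv, gueSystem, Multiset.map_singleton, Multiset.prod_singleton]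

end Limits

/-! ### Planar functions -/

section PlanarFunctions

variable {d : ℕ} {α : Fin d → ℂ} {s : ℂ}

theorem isGUEDisc_resolvent (hs : 0 < s.re) : IsGUEDisc s (gueResolvent s) := by
  have hs0 := ne_zero_of_re_pos hs
  obtain ⟨r, hr, hu⟩ := exists_radius s⁻¹
  exact ⟨fun x hx => (differentiableAt_resolvent hs0 hx).differentiableWithinAt, _,
    tendsto_gueExpect_trace hs, 2 / r, fun x hx => hasSum_resolvent hs0 hr hu hx⟩

theorem isGUECylinder_gueCylinder (hs : 0 < s.re) : IsGUECylinder s (gueCylinder s) := by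
  have hs0 := ne_zero_of_re_pos hs
  obtain ⟨r, hr, hu⟩ := exists_radius s⁻¹
  exact ⟨differentiableOn_gueCylinder hs0, fun p q => gueCov s⁻¹ q p,
    tendsto_gueExpect_covariance hs, 2 / r, fun x₁ x₂ hx₁ hx₂ =>
      hasSum_gueCylinder hs0 hr hu hx₁ hx₂⟩

lemma norm_sq_lt_one (hα : ∑ c, ‖α c‖ ^ 2 < 1) (c : Fin d) : ‖α c‖ ^ 2 < 1 :=
  (Finset.single_le_sum (f := fun c => ‖α c‖ ^ 2) (fun c _ => by positivity)
    (Finset.mem_univ c)).trans_lt hα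

lemma one_sub_re_pos (hα : ∑ c, ‖α c‖ ^ 2 < 1) (c : Fin d) : 0 < (1 - α c ^ 2).re := by
  have h1 := norm_sq_lt_one hα c
  have h2 := Complex.re_le_norm (α c ^ 2)
  rw [norm_pow] at h2
  rw [Complex.sub_re, Complex.one_re]
  linarith

lemma one_sub_sum_ne_zero (hα : ∑ c, ‖α c‖ ^ 2 < 1) : 1 - ∑ c, α c ^ 2 ≠ 0 := by
  intro h
  have h1 : ‖∑ c, α c ^ 2‖ ≤ ∑ c, ‖α c‖ ^ 2 :=
    (norm_sum_le _ _).trans (Finset.sum_le_sum fun c _ => (norm_pow _ _).le)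
  rw [← sub_eq_zero.mp h, norm_one] at h1
  linarith

theorem isPlanarDisc_resolvent (hd : 3 ≤ d) (hα : ∑ c, ‖α c‖ ^ 2 < 1) (c : Fin d) :
    IsPlanarDisc α c (gueResolvent (1 - α c ^ 2)) := by
  have hs0 := ne_zero_of_re_pos (one_sub_re_pos hα c)
  obtain ⟨r, hr, hu⟩ := exists_radius (1 - α c ^ 2)⁻¹
  refine ⟨fun x hx => (differentiableAt_resolvent hs0 hx).differentiableWithinAt, _, _,
    tendsto_moment hd c, fun p => ?_, 2 / r, fun x hx => hasSum_resolvent hs0 hr hu hx⟩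
  rw [limitMoment_eq isLoopSystem_modelSystem (tendsto_modelCoupling hd)]
  exact (hasValueAt_colorSeries c (norm_sq_lt_one hα c)).gueMoment p

/-- The coefficient of the factorised part of the planar cylinder functions. -/
def cylinderCoeff (α : Fin d → ℂ) (i j : Fin d) : ℂ :=
  α i * α j * (1 - ∑ c, α c ^ 2)⁻¹ + if j = i then 1 - (1 - α i ^ 2)⁻¹ else 0

/-- The planar cylinder functions of the matrix model. -/
def modelCylinder (α : Fin d → ℂ) (i j : Fin d) (x₁ x₂ : ℂ) : ℂ :=
  (if j = i then gueCylinder (1 - α i ^ 2) x₁ x₂ else 0) + cylinderCoeff α i j *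
    (gueResolvent (1 - α i ^ 2) x₁ / sigma (1 - α i ^ 2) x₁ *
      (gueResolvent (1 - α j ^ 2) x₂ / sigma (1 - α j ^ 2) x₂))

/-- The planar covariances of the matrix model. -/
def modelCov (α : Fin d → ℂ) (i j : Fin d) (p q : ℕ) : ℂ :=
  (if j = i then gueCov (1 - α i ^ 2)⁻¹ q p else 0) + cylinderCoeff α i j *
    ((p * gueMoment (1 - α i ^ 2)⁻¹ (p - 1)) * (q * gueMoment (1 - α j ^ 2)⁻¹ (q - 1)))

lemma hasValueAt_limitCov (hd : 3 ≤ d) (hα : ∑ c, ‖α c‖ ^ 2 < 1) (i j : Fin d) (p q : ℕ) :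
    HasValueAt (limitCov (modelSystem d) (j, q) i p) α (modelCov α i j p q) := by
  have h : ∀ c, HasValueAt (colorSeries c) α (1 - α c ^ 2)⁻¹ := fun c =>
    hasValueAt_colorSeries c (norm_sq_lt_one hα c)
  rw [limitCov_eq isLoopSystem_modelSystem (tendsto_modelCoupling hd)]
  refine HasValueAt.add ?_ (HasValueAt.mul (HasValueAt.add (((hasValueAt_X i).mul
    (hasValueAt_X j)).mul (hasValueAt_totalSeries hα)) ?_)
    (((hasValueAt_natCast p).mul ((h i).gueMoment _)).mul
      ((hasValueAt_natCast q).mul ((h j).gueMoment _))))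
  · dsimp only
    split_ifs
    · exact (h i).gueCov q p
    · exact hasValueAt_zero
  · dsimp only
    split_ifs
    · exact hasValueAt_one.sub (h i)
    · exact hasValueAt_zero

lemma hasSum_mul_prod {f g : ℕ → ℂ} {v w : ℂ} (hf : HasSum f v) (hg : HasSum g w) :
    HasSum (fun k : ℕ × ℕ => f k.1 * g k.2) (v * w) :=
  hf.mul hg (summable_mul_of_summable_norm hf.summable.norm hg.summable.norm)

lemma differentiableOn_resolvent_div_sigma_mul {t : ℂ} (hs : s ≠ 0) (ht : t ≠ 0) :
    DifferentiableOn ℂ (fun x : ℂ × ℂ => gueResolvent s x.1 / sigma s x.1 *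
      (gueResolvent t x.2 / sigma t x.2)) ((cut s)ᶜ ×ˢ (cut t)ᶜ) := by
  have h : ∀ {s x : ℂ}, s ≠ 0 → x ∉ cut s →
      DifferentiableAt ℂ (fun x => gueResolvent s x / sigma s x) x := fun hs hx =>
    (differentiableAt_resolvent hs hx).fun_div (differentiableAt_sigma hs hx) (sigma_ne_zero hs hx)
  rintro ⟨x₁, x₂⟩ ⟨hx₁, hx₂⟩
  have h₁ := (h hs hx₁).comp (x₁, x₂) (f := Prod.fst) differentiableAt_fst
  have h₂ := (h ht hx₂).comp (x₁, x₂) (f := Prod.snd) differentiableAt_snd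
  exact (h₁.mul h₂).differentiableWithinAt

theorem isPlanarCylinder_modelCylinder (hd : 3 ≤ d) (hα : ∑ c, ‖α c‖ ^ 2 < 1) (i j : Fin d) :
    IsPlanarCylinder α i j (modelCylinder α i j) := by
  have hi := ne_zero_of_re_pos (one_sub_re_pos hα i)
  have hj := ne_zero_of_re_pos (one_sub_re_pos hα j)
  obtain ⟨r₁, hr₁, hu₁⟩ := exists_radius (1 - α i ^ 2)⁻¹
  obtain ⟨r₂, hr₂, hu₂⟩ := exists_radius (1 - α j ^ 2)⁻¹
  refine ⟨?_, _, _, tendsto_covariance hd i j, hasValueAt_limitCov hd hα i j,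
    max (2 / r₁) (2 / r₂), fun x₁ x₂ hx₁ hx₂ => ?_⟩
  · have h := (differentiableOn_resolvent_div_sigma_mul hi hj).const_mul (cylinderCoeff α i j)
    unfold modelCylinder
    split_ifs with hji
    · subst hji
      exact (differentiableOn_gueCylinder hi).fun_add h
    · simpa only [zero_add] using h
  · have hx₁' := (le_max_left _ _).trans_lt hx₁
    have hx₂' := (le_max_right _ _).trans_lt hx₂
    have h1 := hasSum_resolvent_div_sigma hi hr₁ hu₁ hx₁'
    have h2 := hasSum_resolvent_div_sigma hj hr₂ hu₂ hx₂'
    have h3 := (hasSum_mul_prod h1 h2).mul_left (cylinderCoeff α i j)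
    have h4 : HasSum (fun k : ℕ × ℕ => (if j = i then gueCov (1 - α i ^ 2)⁻¹ k.2 k.1 else 0) /
        (x₁ ^ (k.1 + 1) * x₂ ^ (k.2 + 1)))
        (if j = i then gueCylinder (1 - α i ^ 2) x₁ x₂ else 0) := by
      split_ifs with hji
      · subst hji
        exact hasSum_gueCylinder hi hr₁ hu₁ hx₁' ((le_max_left _ _).trans_lt hx₂)
      · simpa only [zero_div] using hasSum_zero
    refine hasSum_of_forall_eq (h4.add h3) fun k => ?_
    rw [modelCov, add_div, div_mul_div_comm, mul_div_assoc (cylinderCoeff α i j)]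

lemma cylinderCoeff_self (hα : ∑ c, ‖α c‖ ^ 2 < 1) (i : Fin d) :
    cylinderCoeff α i i = -((∑ p ∈ Finset.univ.erase i, (α i * α p) ^ 2) /
      ((∑ p, α p ^ 2) - 1)) / (1 - α i ^ 2) := by
  have h1 := one_sub_sum_ne_zero hα
  have h2 := ne_zero_of_re_pos (one_sub_re_pos hα i)
  have h3 : ∑ p ∈ Finset.univ.erase i, (α i * α p) ^ 2 =
      α i ^ 2 * ((∑ p, α p ^ 2) - α i ^ 2) := by
    rw [← Finset.add_sum_erase _ _ (Finset.mem_univ i), add_sub_cancel_left, Finset.mul_sum]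
    exact Finset.sum_congr rfl fun p _ => mul_pow _ _ _
  rw [cylinderCoeff, if_pos rfl, h3, ← neg_sub 1 (∑ p, α p ^ 2), div_neg, neg_neg]
  generalize ∑ p, α p ^ 2 = S at *
  field_simp
  ring

lemma cylinderCoeff_of_ne {i j : Fin d} (hij : i ≠ j) :
    cylinderCoeff α i j = -(α i * α j / ((∑ p, α p ^ 2) - 1)) := by
  rw [cylinderCoeff, if_neg hij.symm, add_zero, ← neg_sub 1 (∑ p, α p ^ 2), div_neg, neg_neg,
    div_eq_mul_inv]

lemma modelCylinder_self (hα : ∑ c, ‖α c‖ ^ 2 < 1) (i : Fin d) (x₁ x₂ : ℂ) :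
    modelCylinder α i i x₁ x₂ = gueCylinder (1 - α i ^ 2) x₁ x₂ -
      (∑ p ∈ Finset.univ.erase i, (α i * α p) ^ 2) / ((∑ p, α p ^ 2) - 1) *
        (gueResolvent (1 - α i ^ 2) x₁ * gueResolvent (1 - α i ^ 2) x₂ /
          ((1 - α i ^ 2) * sigma (1 - α i ^ 2) x₁ * sigma (1 - α i ^ 2) x₂)) := by
  rw [modelCylinder, if_pos rfl, cylinderCoeff_self hα, div_mul_div_comm, mul_assoc (1 - α i ^ 2),
    ← div_div (_ * _) (1 - α i ^ 2)]
  ring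

lemma modelCylinder_of_ne {i j : Fin d} (hij : i ≠ j) (x₁ x₂ : ℂ) :
    modelCylinder α i j x₁ x₂ = -(α i * α j / ((∑ p, α p ^ 2) - 1)) *
      (gueResolvent (1 - α i ^ 2) x₁ * gueResolvent (1 - α j ^ 2) x₂ /
        (sigma (1 - α i ^ 2) x₁ * sigma (1 - α j ^ 2) x₂)) := by
  rw [modelCylinder, if_neg hij.symm, zero_add, cylinderCoeff_of_ne hij, div_mul_div_comm]

lemma omega_modelCylinder_self (hα : ∑ c, ‖α c‖ ^ 2 < 1) (i : Fin d) {z₁ z₂ : ℂ}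
    (hz₁ : 1 < ‖z₁‖) (hz₂ : 1 < ‖z₂‖) (hne : z₁ ≠ z₂) :
    omega α (modelCylinder α) i i z₁ z₂ = 1 / (z₁ - z₂) ^ 2 -
      (∑ p ∈ Finset.univ.erase i, (α i * α p) ^ 2) / ((∑ p, α p ^ 2) - 1) *
        (1 / (z₁ ^ 2 * z₂ ^ 2)) := by
  have hs := ne_zero_of_re_pos (one_sub_re_pos hα i)
  have h1 := gueCylinder_joukowsky hs hz₁ hz₂ hne
  have h2 := resolvent_div_sigma_joukowsky hs hz₁
  have h3 := resolvent_div_sigma_joukowsky hs hz₂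
  have h4 := cylinderCoeff_self hα i
  have h5 : cylinderCoeff α i i * (csqrt (1 - α i ^ 2) / z₁ ^ 2 * (csqrt (1 - α i ^ 2) / z₂ ^ 2)) =
      -((∑ p ∈ Finset.univ.erase i, (α i * α p) ^ 2) / ((∑ p, α p ^ 2) - 1) *
        (1 / (z₁ ^ 2 * z₂ ^ 2))) := by
    rw [div_mul_div_comm, ← pow_two (csqrt _), csqrt_sq, h4, div_mul_div_comm, neg_mul, neg_div,
      mul_comm (1 - α i ^ 2), mul_div_mul_right _ _ hs, mul_one_div]
  simp only [omega, modelCylinder, if_true]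
  rw [← h2, ← h3] at h5
  linear_combination h1 + h5

/-- Each factor (W/σ) dx is √s dz/z². The two roots combine into one because both weights lie in the
right half-plane. -/
lemma omega_modelCylinder_of_ne (hα : ∑ c, ‖α c‖ ^ 2 < 1) {i j : Fin d} (hij : i ≠ j) {z₁ z₂ : ℂ}
    (hz₁ : 1 < ‖z₁‖) (hz₂ : 1 < ‖z₂‖) :
    omega α (modelCylinder α) i j z₁ z₂ =
      -(α i * α j * csqrt ((1 - α i ^ 2) * (1 - α j ^ 2)) / ((∑ p, α p ^ 2) - 1)) *
        (1 / (z₁ ^ 2 * z₂ ^ 2)) := by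
  have hi := one_sub_re_pos hα i
  have hj := one_sub_re_pos hα j
  have h2 := resolvent_div_sigma_joukowsky (ne_zero_of_re_pos hi) hz₁
  have h3 := resolvent_div_sigma_joukowsky (ne_zero_of_re_pos hj) hz₂
  have h5 : -(α i * α j * csqrt ((1 - α i ^ 2) * (1 - α j ^ 2)) / ((∑ p, α p ^ 2) - 1)) *
        (1 / (z₁ ^ 2 * z₂ ^ 2)) = cylinderCoeff α i j *
      (csqrt (1 - α i ^ 2) / z₁ ^ 2 * (csqrt (1 - α j ^ 2) / z₂ ^ 2)) := by
    rw [cylinderCoeff_of_ne hij, csqrt_mul hi hj]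
    ring
  simp only [omega, modelCylinder, if_neg hij, if_neg hij.symm]
  rw [h5, ← h2, ← h3]
  ring

lemma globalOmega_apply (α : Fin d → ℂ) (W : Fin d → Fin d → ℂ → ℂ → ℂ) (P Q : Fin d × ℂ) :
    globalOmega α W P Q = omega α W P.1 Q.1 P.2 Q.2 := by
  rw [globalOmega, Fintype.sum_eq_single P.1, Fintype.sum_eq_single Q.1]
  · simp
  · intro j hj
    rw [if_neg fun h => hj h.2.symm]
  · intro i hi
    refine Finset.sum_eq_zero fun j _ => ?_
    rw [if_neg fun h => hi h.1.symm]

/-- In the coordinate 1/z the form dz₁dz₂/(z₁²z₂²) has constant coefficient and the standard double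
pole keeps its shape, so the regular part can be taken constant for every pair of colours. -/
theorem hasDoublePoleOnlyOnDiagonal_modelCylinder (hα : ∑ c, ‖α c‖ ^ 2 < 1) :
    HasDoublePoleOnlyOnDiagonal (globalOmega α (modelCylinder α)) := by
  refine ⟨fun i j _ => if i = j then
      -((∑ p ∈ Finset.univ.erase i, (α i * α p) ^ 2) / ((∑ p, α p ^ 2) - 1))
    else -(α i * α j * csqrt ((1 - α i ^ 2) * (1 - α j ^ 2)) / ((∑ p, α p ^ 2) - 1)),
    fun i j => differentiable_const _, ?_⟩
  rintro ⟨i, z₁⟩ ⟨j, z₂⟩ hz₁ hz₂ hne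
  have n₁ := ne_zero_of_one_lt_norm hz₁
  have n₂ := ne_zero_of_one_lt_norm hz₂
  rw [globalOmega_apply]
  dsimp only
  split_ifs with hij
  · subst hij
    have hz : z₁ ≠ z₂ := fun h => hne (by rw [h])
    have hd : z₁ - z₂ ≠ 0 := sub_ne_zero.mpr hz
    rw [omega_modelCylinder_self hα i hz₁ hz₂ hz]
    have h1 : 1 / (1 / z₁ - 1 / z₂) ^ 2 * (1 / z₁ ^ 2) * (1 / z₂ ^ 2) = 1 / (z₁ - z₂) ^ 2 := by
      have h2 : 1 / z₁ - 1 / z₂ = -(z₁ - z₂) / (z₁ * z₂) := by field_simp; ring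
      rw [h2]
      field_simp
    rw [← h1]
    ring
  · rw [omega_modelCylinder_of_ne hα hij hz₁ hz₂]
    ring

end PlanarFunctions

end TensorMatrixModel

end

theorem mainTheorem5 (d : ℕ) (hd : 3 ≤ d) (α : Fin d → ℂ) (hα : ∑ c, ‖α c‖ ^ 2 < 1) :
    ∃ (W₁ : Fin d → ℂ → ℂ) (W₂ : Fin d → Fin d → ℂ → ℂ → ℂ) (G : Fin d → ℂ → ℂ → ℂ),
      -- `W₁`, `W₂` are the planar disc and cylinder functions of the model
      (∀ c, TensorMatrixModel.IsPlanarDisc α c (W₁ c)) ∧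
      (∀ i j, TensorMatrixModel.IsPlanarCylinder α i j (W₂ i j)) ∧
      -- the disc function of each colour is a GUE resolvent
      (∀ c, TensorMatrixModel.IsGUEDisc (1 - α c ^ 2) (W₁ c)) ∧
      (∀ c, ∀ x ∉ TensorMatrixModel.cut (1 - α c ^ 2),
        W₁ c x = (1 - α c ^ 2) / 2 * (x - TensorMatrixModel.sigma (1 - α c ^ 2) x)) ∧
      -- `G i` is the cylinder function of the same GUE
      (∀ i, TensorMatrixModel.IsGUECylinder (1 - α i ^ 2) (G i)) ∧
      (∀ i, ∀ x₁ ∉ TensorMatrixModel.cut (1 - α i ^ 2),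
        ∀ x₂ ∉ TensorMatrixModel.cut (1 - α i ^ 2), x₁ ≠ x₂ →
        G i x₁ x₂ =
          (x₁ * x₂ - TensorMatrixModel.sigma (1 - α i ^ 2) x₁ *
              TensorMatrixModel.sigma (1 - α i ^ 2) x₂ - 4 / (1 - α i ^ 2)) /
            (2 * (x₁ - x₂) ^ 2 * TensorMatrixModel.sigma (1 - α i ^ 2) x₁ *
              TensorMatrixModel.sigma (1 - α i ^ 2) x₂)) ∧
      -- monocoloured cylinder functions
      (∀ i, ∀ x₁ ∉ TensorMatrixModel.cut (1 - α i ^ 2),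
        ∀ x₂ ∉ TensorMatrixModel.cut (1 - α i ^ 2),
        W₂ i i x₁ x₂ = G i x₁ x₂ -
          (∑ p ∈ Finset.univ.erase i, (α i * α p) ^ 2) / ((∑ p, α p ^ 2) - 1) *
            (W₁ i x₁ * W₁ i x₂ /
              ((1 - α i ^ 2) * TensorMatrixModel.sigma (1 - α i ^ 2) x₁ *
                TensorMatrixModel.sigma (1 - α i ^ 2) x₂))) ∧
      -- bicoloured cylinder functions
      (∀ i j, i ≠ j → ∀ x₁ ∉ TensorMatrixModel.cut (1 - α i ^ 2),
        ∀ x₂ ∉ TensorMatrixModel.cut (1 - α j ^ 2),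
        W₂ i j x₁ x₂ = -(α i * α j / ((∑ p, α p ^ 2) - 1)) *
          (W₁ i x₁ * W₁ j x₂ /
            (TensorMatrixModel.sigma (1 - α i ^ 2) x₁ *
              TensorMatrixModel.sigma (1 - α j ^ 2) x₂))) ∧
      -- the same in Joukowsky coordinates
      (∀ i, ∀ z₁ z₂ : ℂ, 1 < ‖z₁‖ → 1 < ‖z₂‖ → z₁ ≠ z₂ →
        TensorMatrixModel.omega α W₂ i i z₁ z₂ =
          1 / (z₁ - z₂) ^ 2 -
            (∑ p ∈ Finset.univ.erase i, (α i * α p) ^ 2) / ((∑ p, α p ^ 2) - 1) *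
              (1 / (z₁ ^ 2 * z₂ ^ 2))) ∧
      (∀ i j, i ≠ j → ∀ z₁ z₂ : ℂ, 1 < ‖z₁‖ → 1 < ‖z₂‖ →
        TensorMatrixModel.omega α W₂ i j z₁ z₂ =
          -(α i * α j * TensorMatrixModel.csqrt ((1 - α i ^ 2) * (1 - α j ^ 2)) /
              ((∑ p, α p ^ 2) - 1)) *
            (1 / (z₁ ^ 2 * z₂ ^ 2))) ∧
      TensorMatrixModel.HasDoublePoleOnlyOnDiagonal (TensorMatrixModel.globalOmega α W₂) := by
  open TensorMatrixModel in
  exact ⟨fun c => gueResolvent (1 - α c ^ 2), modelCylinder α, fun i => gueCylinder (1 - α i ^ 2),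
    isPlanarDisc_resolvent hd hα,
    isPlanarCylinder_modelCylinder hd hα,
    fun c => isGUEDisc_resolvent (one_sub_re_pos hα c),
    fun _ _ _ => rfl,
    fun i => isGUECylinder_gueCylinder (one_sub_re_pos hα i),
    fun i _ hx₁ _ hx₂ hne => gueCylinder_eq (ne_zero_of_re_pos (one_sub_re_pos hα i)) hx₁ hx₂ hne,
    fun i x₁ _ x₂ _ => modelCylinder_self hα i x₁ x₂,
    fun _ _ hij x₁ _ x₂ _ => modelCylinder_of_ne hij x₁ x₂,
    fun i _ _ hz₁ hz₂ hne => omega_modelCylinder_self hα i hz₁ hz₂ hne,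
    fun _ _ hij _ _ hz₁ hz₂ => omega_modelCylinder_of_ne hα hij hz₁ hz₂,
    hasDoublePoleOnlyOnDiagonal_modelCylinder hα⟩
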